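/- **Setting.** Let $\{Z(\mathbf s):\mathbf s\in\mathbb Z^2\}$ be a real random field with finite fourth moments whose joint moments of order at most $4$ are translation invariant, with $\sum_{\mathbf h}|\gamma(\mathbf h)|<\infty$ and $\sum_{\mathbf h_1,\mathbf h_2,\mathbf h_3}|\mathrm{cum}(Z(\mathbf 0),Z(\mathbf h_1),Z(\mathbf h_2),Z(\mathbf h_3))|<\infty$, where $\gamma(\mathbf h)=\mathrm{Cov}(Z(\mathbf 0),Z(\mathbf h))$. Let $\Pi^2=[-\pi,\pi]^2$ and $$f(\boldsymbol\omega)=(2\pi)^{-2}\sum_{\mathbf h}\gamma(\mathbf h)e^{-\iota\mathbf h^{T}\boldsymbol\omega},\qquad f_4(\boldsymbol\omega_1,\boldsymbol\omega_2,\boldsymbol\omega_3)=(2\pi)^{-6}\sum_{\mathbf h_1,\mathbf h_2,\mathbf h_3}\mathrm{cum}(Z(\mathbf 0),Z(\mathbf h_1),Z(\mathbf h_2),Z(\mathbf h_3))e^{-\iota\sum_{\ell}\mathbf h_\ell^{T}\boldsymbol\omega_\ell}.$$ Let $\psi:\Pi^2\to\mathbb R$ be of bounded variation (its variation along coordinatewise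 nondecreasing chains in $\Pi^2$ is bounded; every function of bounded Hardy–Krause variation qualifies), and put $M(\psi)=\int_{\Pi^2}\psi f$, $\sigma^2=\sigma_1^2+\sigma_2^2$, $$\sigma_1^2=(2\pi)^2\int_{\Pi^2}\psi(\boldsymbol\omega)[\psi(\boldsymbol\omega)+\psi(-\boldsymbol\omega)]f^2(\boldsymbol\omega)\,d\boldsymbol\omega,\qquad \sigma_2^2=(2\pi)^2\int_{\Pi^2}\int_{\Pi^2}\psi(\boldsymbol\omega_1)\psi(\boldsymbol\omega_2)f_4(\boldsymbol\omega_1,\boldsymbol\omega_2,-\boldsymbol\omega_2)\,d\boldsymbol\omega_1d\boldsymbol\omega_2 .$$ For a size $p=(p_1,p_2)$, with $|p|=p_1p_2$, let $\mathcal D(p)=\{1,\dots,p_1\}\times\{1,\dots,p_2\}$, $\boldsymbol\omega_{\mathbf j,p}=(2\pi j_1/p_1,2\pi j_2/p_2)$, and $\mathcal J_p=\{\mathbf j\in\mathbb Z^2:|j_i|\le\lfloor p_i/2\rfloor\}\setminus\{\mathbf 0\}$. For $\mathbf k\in\mathbb Z^2$ let $$\mathcal I_{\mathbf k,p}(\boldsymbol\omega)=(2\pi)^{-2}|p|^{-1}\Big|\sum_{\mathbf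 s\in\mathbf k+\mathcal D(p)}Z(\mathbf s)e^{-\iota\mathbf s^{T}\boldsymbol\omega}\Big|^2,\quad \widehat M_{\mathbf k,p}=\frac{(2\pi)^2}{|p|}\sum_{\mathbf j\in\mathcal J_p}\psi(\boldsymbol\omega_{\mathbf j,p})\mathcal I_{\mathbf k,p}(\boldsymbol\omega_{\mathbf j,p}),\quad H_{\mathbf k,p}=|p|^{1/2}\{\widehat M_{\mathbf k,p}-M(\psi)\}.$$ Consider sequences of sample sizes $n=(n_1,n_2)$ and block sizes $b=(b_1,b_2)$ with $n_i\to\infty$, $b_i\to\infty$, $b_i/n_i\to0$ for $i=1,2$. Write $H_n(\psi)=H_{\mathbf 0,n}$. Assume that along $p=n$ and along $p=b$: 1. $H_{\mathbf 0,p}\to\mathcal N(0,\sigma^2)$ in distribution; 2. for all integer sequences $\mathbf j,\mathbf k$ (indexed along $p$) with $|j_i-k_i|/p_i\to\infty$ for $i=1,2$, $(H_{\mathbf j,p},H_{\mathbf k,p})$ converges in distribution to a pair of independent $\mathcal N(0,\sigma^2)$ variables; 3. for such $\mathbf j,\mathbf k$ and all integer sequences $\mathbf m$ with $|m_i|\le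 p_i-\lfloor p_i/2\rfloor$ and $\boldsymbol\omega_{\mathbf m,p}\to\boldsymbol\omega$, $0<|\omega_i|<\pi$, the pair $(\mathcal I_{\mathbf j,p}(\boldsymbol\omega_{\mathbf m,p}),\mathcal I_{\mathbf k,p}(\boldsymbol\omega_{\mathbf m,p}))$ converges in distribution to $f(\boldsymbol\omega)(U_1,U_2)$ with $U_1,U_2$ i.i.d. standard exponential. Let $\widehat f_n$ be random functions with $\max_{\mathbf j\in\mathcal J_n}|\widehat f_n(\boldsymbol\omega_{\mathbf j,n})-f(\boldsymbol\omega_{\mathbf j,n})|\to0$ in probability. **Subsampling.** Let $\mathbb A_{\mathbf k}$ denote the average over all $\mathbf k\in\mathbb Z^2$ with $0\le k_i\le n_i-b_i$, and put $\widehat\sigma^2_{2,n}=\widehat\sigma^2_n-\widehat\sigma^2_{1,n}$, where $\widehat\sigma_n^2=\mathbb A_{\mathbf k}\big[|b|(\widehat M_{\mathbf k,b}-\mathbb A_{\mathbf l}\widehat M_{\mathbf l,b})^2\big]$ and $$\widehat\sigma^2_{1,n}=\frac{(4\pi^2)^2}{|b|}\sum_{\mathbf j\in\mathcal J_b}\psi(\boldsymbol\omega_{\mathbf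 j,b})\{\psi(\boldsymbol\omega_{\mathbf j,b})+\psi(\boldsymbol\omega_{-\mathbf j,b})\}\,\mathbb A_{\mathbf k}\Big[\big(\mathcal I_{\mathbf k,b}(\boldsymbol\omega_{\mathbf j,b})-\mathbb A_{\mathbf l}\mathcal I_{\mathbf l,b}(\boldsymbol\omega_{\mathbf j,b})\big)^2\Big].$$ **Bootstrap.** Given the data, let $U^*_{\mathbf j}$ be i.i.d. standard exponential for $\mathbf j\in\mathcal J_n$ with $j_1>0$ or $j_1=0<j_2$, and $U^*_{-\mathbf j}=U^*_{\mathbf j}$; let $P_*,\mathrm{Var}_*$ be the resulting conditional probability and variance. Put $$Q^*_n=|n|^{1/2}\frac{(2\pi)^2}{|n|}\sum_{\mathbf j\in\mathcal J_n}\psi(\boldsymbol\omega_{\mathbf j,n})\widehat f_n(\boldsymbol\omega_{\mathbf j,n})(U^*_{\mathbf j}-1),\qquad H^*_n=\big[\mathrm{Var}_*(Q^*_n)+\widehat\sigma^2_{2,n}\big]^{1/2}\frac{Q^*_n}{[\mathrm{Var}_*(Q^*_n)]^{1/2}},$$ with the conventions that the square root of a negative number is $0$ and $0/0=0$. **Theorem.**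 (a) $\mathrm{Var}_*(Q^*_n)+\widehat\sigma^2_{2,n}\to\sigma^2$ in probability. If moreover $\sigma_1^2>0$ and $\sigma^2>0$, then $\mathrm{Var}_*(H^*_n)=\mathrm{Var}_*(Q^*_n)+\widehat\sigma^2_{2,n}$ with probability tending to $1$, and $\mathrm{Var}_*(H_n^*)\to\sigma^2$ in probability. (b) If $\sigma_1^2>0$ and $\sigma^2>0$, then $\sup_{x\in\mathbb R}|P_*(H^*_n\le x)-P(H_n(\psi)\le x)|\to0$ in probability. -/

import Mathlib

open MeasureTheory ProbabilityTheory Filter Topology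

noncomputable section

namespace HFDB

/-- The frequency domain `Π² = [-π, π]²`. -/
def freqDomain : Set (ℝ × ℝ) := Set.Icc (-Real.pi, -Real.pi) (Real.pi, Real.pi)

/-- `hᵀ ω` for an integer lag `h` and a frequency `ω`. -/
def phase (h : ℤ × ℤ) (ω : ℝ × ℝ) : ℝ := h.1 * ω.1 + h.2 * ω.2

/-- Bounded variation on `Π²`: the variation of `ψ` along chains that are nondecreasing in both
coordinates is bounded (equivalently, on `Π²` the function `ψ` is a difference of two functions
that are nondecreasing in each coordinate). Every function of bounded variation in the sense of
Hardy and Krause has this property. -/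
def IsBV (ψ : ℝ × ℝ → ℝ) : Prop :=
  ∃ C : ℝ, ∀ (N : ℕ) (u : ℕ → ℝ × ℝ), Monotone u → (∀ i, u i ∈ freqDomain) →
    ∑ i ∈ Finset.range N, |ψ (u (i + 1)) - ψ (u i)| ≤ C

section RandomField

variable {Ω : Type*} [MeasurableSpace Ω] (P : Measure Ω) (Z : ℤ × ℤ → Ω → ℝ)

/-- Fourth-order stationarity: finite fourth moments, and all joint moments of order at most four
are invariant under translation. -/
structure FourthOrderStationary : Prop where
  memLp : ∀ s, MemLp (Z s) 4 P
  shift : ∀ k : ℕ, k ≤ 4 → ∀ (s : Fin k → ℤ × ℤ) (h : ℤ × ℤ),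
    ∫ x, ∏ i, Z (s i + h) x ∂P = ∫ x, ∏ i, Z (s i) x ∂P

/-- `γ(h) = Cov(Z(0), Z(h))`. -/
def autocov (h : ℤ × ℤ) : ℝ := cov[Z 0, Z h; P]

/-- The fourth-order joint cumulant of four real random variables. -/
def cum4 (X₁ X₂ X₃ X₄ : Ω → ℝ) : ℝ :=
  ∫ x, (X₁ x - ∫ y, X₁ y ∂P) * (X₂ x - ∫ y, X₂ y ∂P) * (X₃ x - ∫ y, X₃ y ∂P)
      * (X₄ x - ∫ y, X₄ y ∂P) ∂P
    - cov[X₁, X₂; P] * cov[X₃, X₄; P] - cov[X₁, X₃; P] * cov[X₂, X₄; P]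
    - cov[X₁, X₄; P] * cov[X₂, X₃; P]

/-- `cum(Z(0), Z(h₁), Z(h₂), Z(h₃))`. -/
def lagCum4 (h : (ℤ × ℤ) × (ℤ × ℤ) × (ℤ × ℤ)) : ℝ :=
  cum4 P (Z 0) (Z h.1) (Z h.2.1) (Z h.2.2)

/-- The spectral density (the series is real, `γ` being even). -/
def specDensity (ω : ℝ × ℝ) : ℝ :=
  ((2 * Real.pi : ℂ) ^ (-2 : ℤ) *
    ∑' h : ℤ × ℤ, (autocov P Z h : ℂ) * Complex.exp (-Complex.I * phase h ω)).re

/-- The fourth-order cumulant spectral density of a process on the planar lattice. -/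
def cumSpecDensity (ω₁ ω₂ ω₃ : ℝ × ℝ) : ℂ :=
  (2 * Real.pi : ℂ) ^ (-6 : ℤ) *
    ∑' h : (ℤ × ℤ) × (ℤ × ℤ) × (ℤ × ℤ), (lagCum4 P Z h : ℂ) *
      Complex.exp (-Complex.I * (phase h.1 ω₁ + phase h.2.1 ω₂ + phase h.2.2 ω₃))

/-- The spectral mean `M(ψ)`. -/
def specMean (ψ : ℝ × ℝ → ℝ) : ℝ := ∫ ω in freqDomain, ψ ω * specDensity P Z ω

/-- `σ₁²(ψ)`. -/
def sigma1Sq (ψ : ℝ × ℝ → ℝ) : ℝ :=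
  (2 * Real.pi) ^ 2 * ∫ ω in freqDomain, ψ ω * (ψ ω + ψ (-ω)) * specDensity P Z ω ^ 2

/-- `σ₂²(ψ)`; by the symmetries of cumulants `f₄(ω₁, ω₂, -ω₂)` is real. -/
def sigma2Sq (ψ : ℝ × ℝ → ℝ) : ℝ :=
  (2 * Real.pi) ^ 2 * ∫ ω₁ in freqDomain, ∫ ω₂ in freqDomain,
    ψ ω₁ * ψ ω₂ * (cumSpecDensity P Z ω₁ ω₂ (-ω₂)).re

/-- `σ²(ψ) = σ₁²(ψ) + σ₂²(ψ)`. -/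
def sigmaSq (ψ : ℝ × ℝ → ℝ) : ℝ := sigma1Sq P Z ψ + sigma2Sq P Z ψ

end RandomField

/-! ### Periodograms and spectral mean statistics on an `n.1 × n.2` rectangle -/

/-- The number of sites `n = n₁ n₂`, as a real number. -/
def size (n : ℕ × ℕ) : ℝ := (n.1 : ℝ) * n.2

/-- The integer points of `k + [1, n₁] × [1, n₂]`. -/
def region (k : ℤ × ℤ) (n : ℕ × ℕ) : Finset (ℤ × ℤ) :=
  Finset.Icc (k.1 + 1) (k.1 + n.1) ×ˢ Finset.Icc (k.2 + 1) (k.2 + n.2)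

/-- The nonzero Fourier grid, which is symmetric about the origin. -/
def grid (n : ℕ × ℕ) : Finset (ℤ × ℤ) :=
  (Finset.Icc (-((n.1 / 2 : ℕ) : ℤ)) (n.1 / 2 : ℕ) ×ˢ
    Finset.Icc (-((n.2 / 2 : ℕ) : ℤ)) (n.2 / 2 : ℕ)).erase 0

/-- The Fourier frequency `ω_{j,n}`. -/
def freq (n : ℕ × ℕ) (j : ℤ × ℤ) : ℝ × ℝ :=
  (2 * Real.pi * j.1 / n.1, 2 * Real.pi * j.2 / n.2)

section Statistics

variable {Ω : Type*} (Z : ℤ × ℤ → Ω → ℝ)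

/-- The periodogram computed on the translated region `k + [1, n₁] × [1, n₂]`. -/
def periodogram (k : ℤ × ℤ) (n : ℕ × ℕ) (ω : ℝ × ℝ) (x : Ω) : ℝ :=
  (2 * Real.pi) ^ (-2 : ℤ) * (size n)⁻¹ *
    ‖∑ s ∈ region k n, (Z s x : ℂ) * Complex.exp (-Complex.I * phase s ω)‖ ^ 2

/-- The spectral mean statistic computed on `k + [1, n₁] × [1, n₂]`. -/
def specAvg (ψ : ℝ × ℝ → ℝ) (k : ℤ × ℤ) (n : ℕ × ℕ) (x : Ω) : ℝ :=
  (2 * Real.pi) ^ 2 * (size n)⁻¹ *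
    ∑ j ∈ grid n, ψ (freq n j) * periodogram Z k n (freq n j) x

/-- The version of `H_n(ψ)` computed on `k + [1, n₁] × [1, n₂]`; `H_n(ψ)` itself is `k = 0`. -/
def hStat [MeasurableSpace Ω] (P : Measure Ω) (ψ : ℝ × ℝ → ℝ) (k : ℤ × ℤ) (n : ℕ × ℕ)
    (x : Ω) : ℝ :=
  √(size n) * (specAvg Z ψ k n x - specMean P Z ψ)

/-- The translations `k` for which the block `k + [1, b₁] × [1, b₂]` lies in
`[1, n₁] × [1, n₂]`. -/
def blocks (n b : ℕ × ℕ) : Finset (ℤ × ℤ) :=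
  Finset.Icc 0 ((n.1 : ℤ) - b.1) ×ˢ Finset.Icc 0 ((n.2 : ℤ) - b.2)

/-- The average `L⁻¹ ∑_ℓ g(ℓ)` over all blocks. -/
def blockAvg (n b : ℕ × ℕ) (g : ℤ × ℤ → ℝ) : ℝ :=
  ((blocks n b).card : ℝ)⁻¹ * ∑ k ∈ blocks n b, g k

/-- The subsampling variance estimator `σ̂²_n`. -/
def subVar (ψ : ℝ × ℝ → ℝ) (n b : ℕ × ℕ) (x : Ω) : ℝ :=
  blockAvg n b fun k =>
    size b * (specAvg Z ψ k b x - blockAvg n b fun l => specAvg Z ψ l b x) ^ 2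

/-- The subsampling estimator `σ̂²_{1,n}` of the first variance component. -/
def subVar1 (ψ : ℝ × ℝ → ℝ) (n b : ℕ × ℕ) (x : Ω) : ℝ :=
  (size b)⁻¹ * (4 * Real.pi ^ 2) ^ 2 *
    ∑ j ∈ grid b, ψ (freq b j) * (ψ (freq b j) + ψ (freq b (-j))) *
      blockAvg n b fun k =>
        (periodogram Z k b (freq b j) x
          - blockAvg n b fun l => periodogram Z l b (freq b j) x) ^ 2

/-- The subsampling estimator `σ̂²_{2,n} = σ̂²_n - σ̂²_{1,n}`. -/
def subVar2 (ψ : ℝ × ℝ → ℝ) (n b : ℕ × ℕ) (x : Ω) : ℝ :=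
  subVar Z ψ n b x - subVar1 Z ψ n b x

end Statistics

/-- The standard exponential distribution. -/
def stdExp : Measure ℝ := expMeasure 1

instance : IsProbabilityMeasure stdExp := isProbabilityMeasure_expMeasure one_pos

/-- The limit laws that are assumed along a sequence `p` of rectangle sizes. -/
structure LimitLaws {Ω : Type*} [MeasurableSpace Ω] (P : Measure Ω) [IsProbabilityMeasure P]
    (Z : ℤ × ℤ → Ω → ℝ) (ψ : ℝ × ℝ → ℝ) (p : ℕ → ℕ × ℕ) : Prop where
  /-- `H_n(ψ)` is asymptotically `N(0, σ²)`. -/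
  clt : TendstoInDistribution (fun m x => hStat Z P ψ 0 (p m) x) atTop id (fun _ => P)
    (gaussianReal 0 (sigmaSq P Z ψ).toNNReal)
  /-- Versions of `H_n(ψ)` on distant regions are asymptotically independent `N(0, σ²)`. -/
  pair_normal : ∀ j k : ℕ → ℤ × ℤ,
    Tendsto (fun m => |((j m).1 - (k m).1 : ℝ)| / (p m).1) atTop atTop →
    Tendsto (fun m => |((j m).2 - (k m).2 : ℝ)| / (p m).2) atTop atTop →
    TendstoInDistribution
      (fun m x => (hStat Z P ψ (j m) (p m) x, hStat Z P ψ (k m) (p m) x)) atTop id (fun _ => P)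
      ((gaussianReal 0 (sigmaSq P Z ψ).toNNReal).prod
        (gaussianReal 0 (sigmaSq P Z ψ).toNNReal))
  /-- Periodograms on distant regions, at Fourier frequencies with an interior limit off the axes,
  are asymptotically independent and exponential, scaled by `f`. -/
  pair_exponential : ∀ (r : ℕ → ℤ × ℤ) (ω : ℝ × ℝ),
    (∀ m, |(r m).1| ≤ (p m).1 - ((p m).1 / 2 : ℕ) ∧ |(r m).2| ≤ (p m).2 - ((p m).2 / 2 : ℕ)) →
    Tendsto (fun m => freq (p m) (r m)) atTop (𝓝 ω) →
    0 < |ω.1| → |ω.1| < Real.pi → 0 < |ω.2| → |ω.2| < Real.pi →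
    ∀ j k : ℕ → ℤ × ℤ,
    Tendsto (fun m => |((j m).1 - (k m).1 : ℝ)| / (p m).1) atTop atTop →
    Tendsto (fun m => |((j m).2 - (k m).2 : ℝ)| / (p m).2) atTop atTop →
    TendstoInDistribution
      (fun m x => (periodogram Z (j m) (p m) (freq (p m) (r m)) x,
        periodogram Z (k m) (p m) (freq (p m) (r m)) x)) atTop
      (fun u : ℝ × ℝ => (specDensity P Z ω * u.1, specDensity P Z ω * u.2)) (fun _ => P)
      (stdExp.prod stdExp)

/-! ### The bootstrap -/

/-- The resampling law `P_*`: independent standard exponential variables. -/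
def bootLaw : Measure (ℤ × ℤ → ℝ) := Measure.infinitePi fun _ => stdExp

/-- The bootstrap variables: `U*_j` is drawn for `j₁ > 0` or `j₁ = 0, j₂ > 0`, and
`U*_{-j} = U*_j` otherwise. -/
def bootU (j : ℤ × ℤ) (u : ℤ × ℤ → ℝ) : ℝ :=
  if 0 < j.1 ∨ (j.1 = 0 ∧ 0 < j.2) then u j else u (-j)

/-- `Q*_{FDWB,n}(ψ)`, for a realized spectral density estimate `g`. -/
def qStar (ψ g : ℝ × ℝ → ℝ) (n : ℕ × ℕ) (u : ℤ × ℤ → ℝ) : ℝ :=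
  √(size n) * ((2 * Real.pi) ^ 2 * (size n)⁻¹ *
    ∑ j ∈ grid n, ψ (freq n j) * g (freq n j) * (bootU j u - 1))

/-- `Var_*{Q*_{FDWB,n}(ψ)}`. -/
def varQ (ψ g : ℝ × ℝ → ℝ) (n : ℕ × ℕ) : ℝ := Var[qStar ψ g n; bootLaw]

/-- `H*_{HFDB,n}(ψ)`, for a realized spectral density estimate `g` and a realized value `v` of
`σ̂²_{2,n}`. -/
def hStar (ψ g : ℝ × ℝ → ℝ) (v : ℝ) (n : ℕ × ℕ) (u : ℤ × ℤ → ℝ) : ℝ :=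
  √(varQ ψ g n + v) * (qStar ψ g n u / √(varQ ψ g n))

end HFDB

end

/-! Over the nonzero Fourier grid the periodogram ignores the mean of the field, so every spectral
average is a quadratic form `∑ A(s - t) Y(s) Y(t)` in the centred field. Fourth-order stationarity
gives its second moment exactly (`integral_quadForm_sq`): the squared mean, a series over lags with
cumulant coefficients, and twice a series with coefficients `γ γ`. The coefficients are absolutely
summable, so limits may be taken lag by lag. In the cumulant series the kernel tends to the Fourier
coefficients of `ψ`, which produces `σ₂²`. In the covariance series the autocorrelation of the
kernel over a full period is computed exactly by orthogonality (`sum_kernel_mul_kernel`), which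
produces `σ₁²` without any decay of Fourier coefficients. The Riemann sums converge because a
function of bounded variation is continuous almost everywhere (`IsBV.ae_continuousAt`). Hence the
variance of `H` tends to `σ²`.

The assumed limit laws are only weak, and nothing is assumed about the bias of `H`. But weak
convergence with bounded variances forces the means to converge (`tendsto_integral_of_variance_le`),
so the mean of `H` tends to `0` and its second moment to `σ²`. Convergence of second moments to
those of the limit law makes truncation harmless, and block averages of truncated statistics
converge in mean square because most pairs of blocks are distant and asymptotically independent. The
result is `PairLimit.tendsto_blockVar`. Applied to `H` it gives the consistency of `subVar`. Applied
to a periodogram ordinate, whose second moment tends to `2 f²` and whose limit law is exponential,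
it gives an empirical variance close to `f²` in mean; averaging over the grid gives the consistency
of `subVar1`. The difference estimates `σ₂²`.

In the bootstrap the frequencies `j` and `-j` share one variable, so `Q*` is a weighted sum of
independent centred exponentials. Its variance is a Riemann sum for `σ₁²`, its weights are of order
`|n|^(-1/2)`, and a characteristic function argument (`tendsto_charFun_bootSum`) gives a normal
limit, which the rescaling turns into `N(0, σ²)`. By Pólya's theorem the distribution functions of
`H*` and of `H` are both uniformly close to the same Gaussian one. Randomness of the estimates
enters only at the end: by `tendsto_measure_not_of_seq` it suffices to argue deterministically along
sequences of realizations on which the estimates converge. -/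

noncomputable section
set_option linter.unusedSectionVars false
namespace HFDB

/-! ### Joint moments and cumulants of a fourth-order stationary field. -/

section Moments

variable {Ω : Type*} [MeasurableSpace Ω] {P : Measure Ω} [IsProbabilityMeasure P]
  {Z : ℤ × ℤ → Ω → ℝ}

/-- The centred field. -/
def centred (P : Measure Ω) (Z : ℤ × ℤ → Ω → ℝ) (s : ℤ × ℤ) (x : Ω) : ℝ :=
  Z s x - ∫ y, Z s y ∂P

namespace FourthOrderStationary

lemma integral_eq (hZ : FourthOrderStationary P Z) (s : ℤ × ℤ) :
    ∫ x, Z s x ∂P = ∫ x, Z 0 x ∂P := by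
  simpa using hZ.shift 1 (by norm_num) (fun _ => 0) s

lemma memLp_centred (hZ : FourthOrderStationary P Z) (s : ℤ × ℤ) :
    MemLp (centred P Z s) 4 P :=
  (hZ.memLp s).sub (memLp_const _)

/-- Hölder's inequality: at most four factors, each in `L⁴`, have reciprocal exponents summing to at
most one. -/
lemma integrable_prod {W : ℤ × ℤ → Ω → ℝ} (hW : ∀ s, MemLp (W s) 4 P)
    {k : ℕ} (S : Finset (Fin k)) (hS : S.card ≤ 4)
    (s : Fin k → ℤ × ℤ) : Integrable (fun x => ∏ i ∈ S, W (s i) x) P := by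
  have h := MemLp.prod' (μ := P) (s := S) (f := fun i => W (s i)) (p := fun _ => 4)
    (fun i _ => hW (s i))
  refine h.integrable ?_
  rw [ENNReal.one_le_inv, Finset.sum_const, nsmul_eq_mul]
  calc (S.card : ENNReal) * 4⁻¹ ≤ 4 * 4⁻¹ := by gcongr; exact_mod_cast hS
    _ ≤ 1 := ENNReal.mul_inv_le_one 4

/-- Stationarity is stated for families indexed by `Fin k`; enumerating a subset in increasing order
brings its product into that form. -/
lemma shift_prod (hZ : FourthOrderStationary P Z) {k : ℕ} (S : Finset (Fin k)) (hS : S.card ≤ 4)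
    (s : Fin k → ℤ × ℤ) (h : ℤ × ℤ) :
    ∫ x, ∏ i ∈ S, Z (s i + h) x ∂P = ∫ x, ∏ i ∈ S, Z (s i) x ∂P := by
  have key : ∀ g : Fin k → ℝ, ∏ i ∈ S, g i = ∏ i : Fin S.card, g (S.orderEmbOfFin rfl i) := by
    intro g
    have := Finset.prod_map Finset.univ (S.orderEmbOfFin rfl).toEmbedding g
    simpa using this
  simp_rw [key]
  exact hZ.shift S.card hS (fun i => s (S.orderEmbOfFin rfl i)) h

/-- Expanding the product of `Z - μ` over subsets leaves raw moments of order at most four, each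
translation invariant, with coefficients that do not involve the sites. -/
lemma shift_centred (hZ : FourthOrderStationary P Z) (s : Fin 4 → ℤ × ℤ) (h : ℤ × ℤ) :
    ∫ x, ∏ i, centred P Z (s i + h) x ∂P = ∫ x, ∏ i, centred P Z (s i) x ∂P := by
  have key : ∀ h : ℤ × ℤ, ∫ x, ∏ i, centred P Z (s i + h) x ∂P =
      ∑ t ∈ (Finset.univ : Finset (Fin 4)).powerset,
        (∫ x, ∏ i ∈ t, Z (s i + h) x ∂P) * ∏ i ∈ Finset.univ \ t, (-∫ y, Z 0 y ∂P) := by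
    intro h
    have hc : ∀ t : Finset (Fin 4), t.card ≤ 4 := fun t => by
      simpa using Finset.card_le_univ t
    rw [← Finset.sum_congr rfl fun t _ => integral_mul_const _ _, ← integral_finsetSum]
    · refine integral_congr_ae (.of_forall fun x => ?_)
      simp only [centred, sub_eq_add_neg, hZ.integral_eq (_ + h)]
      exact Finset.prod_add _ _ _
    · intro t _
      exact (integrable_prod hZ.memLp t (hc t) fun i => s i + h).mul_const _
  have h0 := key 0
  simp only [add_zero] at h0
  rw [key h, h0]
  refine Finset.sum_congr rfl fun t _ => ?_
  rw [hZ.shift_prod t (by simpa using Finset.card_le_univ t)]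

lemma integral_mul_centred (hZ : FourthOrderStationary P Z) (s t : ℤ × ℤ) :
    ∫ x, centred P Z s x * centred P Z t x ∂P = autocov P Z (t - s) := by
  have h2 : ∀ s, MemLp (Z s) 2 P := fun s => (hZ.memLp s).mono_exponent (by norm_num)
  have e : ∀ s t, cov[Z s, Z t; P] = autocov P Z (t - s) := by
    intro s t
    rw [autocov, covariance_eq_sub (h2 _) (h2 _), covariance_eq_sub (h2 _) (h2 _),
      hZ.integral_eq s, hZ.integral_eq t, hZ.integral_eq (t - s)]
    have := hZ.shift 2 (by norm_num) ![0, t - s] s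
    simp [Fin.prod_univ_two] at this
    simp [this]
  -- The covariance unfolds to the integral of the product of the centred variables.
  exact e s t

lemma cum4_eq (hZ : FourthOrderStationary P Z) (s t u v : ℤ × ℤ) :
    cum4 P (Z s) (Z t) (Z u) (Z v) = lagCum4 P Z (t - s, u - s, v - s) := by
  have e : ∀ s t, cov[Z s, Z t; P] = autocov P Z (t - s) := hZ.integral_mul_centred
  have h4 := hZ.shift_centred ![0, t - s, u - s, v - s] s
  simp [Fin.prod_univ_four, centred] at h4
  simp only [lagCum4, cum4, e]
  rw [h4]
  simp

lemma autocov_neg (hZ : FourthOrderStationary P Z) (h : ℤ × ℤ) :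
    autocov P Z (-h) = autocov P Z h := by
  have h1 := hZ.integral_mul_centred h 0
  have h2 := hZ.integral_mul_centred 0 h
  simp only [zero_sub, sub_zero] at h1 h2
  rw [← h1, ← h2]
  simp_rw [mul_comm]

/-- The fourth-order moments of the centred field in terms of cumulants and covariances. -/
lemma integral_mul4_centred (hZ : FourthOrderStationary P Z) (s t u v : ℤ × ℤ) :
    ∫ x, centred P Z s x * centred P Z t x * centred P Z u x * centred P Z v x ∂P =
      lagCum4 P Z (t - s, u - s, v - s) + autocov P Z (t - s) * autocov P Z (v - u)
        + autocov P Z (u - s) * autocov P Z (v - t)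
        + autocov P Z (v - s) * autocov P Z (u - t) := by
  have e : ∀ s t, cov[Z s, Z t; P] = autocov P Z (t - s) := hZ.integral_mul_centred
  rw [← hZ.cum4_eq]
  simp only [cum4, e, centred]
  ring

/-- A block at `k` of the field is a block at the origin of the shifted field. As the shifted field
has the same covariances and cumulants, first and second moments of block statistics do not depend
on the block. -/
lemma translate (hZ : FourthOrderStationary P Z) (k : ℤ × ℤ) :
    FourthOrderStationary P (fun s => Z (s + k)) where
  memLp s := hZ.memLp _
  shift m hm s h := by
    rw [hZ.shift m hm (fun i => s i) k, ← hZ.shift m hm (fun i => s i) (h + k)]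
    simp_rw [add_assoc]

lemma autocov_translate (hZ : FourthOrderStationary P Z) (k : ℤ × ℤ) :
    autocov P (fun s => Z (s + k)) = autocov P Z := by
  funext h
  have := hZ.integral_mul_centred (0 + k) (h + k)
  simp only [add_sub_add_right_eq_sub, sub_zero] at this
  exact this

lemma lagCum4_translate (hZ : FourthOrderStationary P Z) (k : ℤ × ℤ) :
    lagCum4 P (fun s => Z (s + k)) = lagCum4 P Z := by
  funext h
  have := hZ.cum4_eq (0 + k) (h.1 + k) (h.2.1 + k) (h.2.2 + k)
  simp only [add_sub_add_right_eq_sub, sub_zero] at this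
  exact this

end FourthOrderStationary
end Moments

/-! ### First and second moments of translation-invariant quadratic forms. -/

section QuadraticForms

/-- Reindexing a finite double sum by differences with a base point. -/
lemma hasSum_translate {G ι : Type*} [AddCommGroup G] [DecidableEq G] (T : Finset ι)
    (E : Finset G) (β : ι → G) (F : ι → G → ℝ) :
    HasSum (fun h => ∑ t ∈ T, if β t + h ∈ E then F t (β t + h) else 0)
      (∑ t ∈ T, ∑ s ∈ E, F t s) := by
  have key : ∀ t ∈ T, HasSum (fun h => if β t + h ∈ E then F t (β t + h) else 0)
      (∑ s ∈ E, F t s) := by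
    intro t _
    have h0 : ∑ s ∈ E, F t s = ∑ s ∈ E, if s ∈ E then F t s else 0 :=
      Finset.sum_congr rfl fun s hs => by rw [if_pos hs]
    have h1 : HasSum (fun s => if s ∈ E then F t s else 0) (∑ s ∈ E, F t s) := by
      rw [h0]
      exact hasSum_sum_of_ne_finset_zero fun s hs => by rw [if_neg hs]
    have h2 := (Equiv.addLeft (β t)).hasSum_iff (f := fun s => if s ∈ E then F t s else 0)
      (a := ∑ s ∈ E, F t s)
    exact h2.2 h1
  exact hasSum_sum key

/-- The number of `s ∈ D` with `s + h ∈ D`. -/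
def overlap (D : Finset (ℤ × ℤ)) (h : ℤ × ℤ) : ℝ :=
  ∑ s ∈ D, if s + h ∈ D then 1 else 0

/-- The number of `s ∈ D` with `s + h₁, s + h₂, s + h₃ ∈ D`. -/
def overlap3 (D : Finset (ℤ × ℤ)) (h : (ℤ × ℤ) × (ℤ × ℤ) × (ℤ × ℤ)) : ℝ :=
  ∑ s ∈ D, if (s, s, s) + h ∈ D ×ˢ D ×ˢ D then 1 else 0

/-- The coefficient of `γ(h) γ(k)` in the variance of a quadratic form with kernel `A`. -/
def pairCoeff (D : Finset (ℤ × ℤ)) (A : ℤ × ℤ → ℝ) (h : (ℤ × ℤ) × (ℤ × ℤ)) : ℝ :=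
  ∑ p ∈ D ×ˢ D, if p + h ∈ D ×ˢ D then A (p.1 - p.2) * A (p.1 - p.2 + (h.1 - h.2)) else 0

variable {Ω : Type*} [MeasurableSpace Ω] {P : Measure Ω} [IsProbabilityMeasure P]
  {Z : ℤ × ℤ → Ω → ℝ}

/-- The quadratic form `∑ A(s - t) Y(s) Y(t)`. -/
def quadForm (D : Finset (ℤ × ℤ)) (A : ℤ × ℤ → ℝ) (Y : ℤ × ℤ → Ω → ℝ) (x : Ω) : ℝ :=
  ∑ p ∈ D ×ˢ D, A (p.1 - p.2) * (Y p.1 x * Y p.2 x)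

lemma FourthOrderStationary.memLp_mul_centred (hZ : FourthOrderStationary P Z) (s t : ℤ × ℤ) :
    MemLp (fun x => centred P Z s x * centred P Z t x) 2 P := by
  have : ENNReal.HolderTriple 4 4 2 := ⟨by
    rw [show (4 : ENNReal) = 2 * 2 by norm_num, ENNReal.mul_inv (by simp) (by simp), ← mul_add,
      ENNReal.inv_two_add_inv_two, mul_one]⟩
  exact (hZ.memLp_centred t).mul (hZ.memLp_centred s)

lemma FourthOrderStationary.memLp_quadForm (hZ : FourthOrderStationary P Z)
    (D : Finset (ℤ × ℤ)) (A : ℤ × ℤ → ℝ) : MemLp (quadForm D A (centred P Z)) 2 P :=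
  memLp_finsetSum _ fun p _ => (hZ.memLp_mul_centred p.1 p.2).const_mul _

lemma FourthOrderStationary.integral_quadForm_eq_sum (hZ : FourthOrderStationary P Z)
    (D : Finset (ℤ × ℤ)) (A : ℤ × ℤ → ℝ) :
    ∫ x, quadForm D A (centred P Z) x ∂P =
      ∑ p ∈ D ×ˢ D, A (p.1 - p.2) * autocov P Z (p.2 - p.1) := by
  unfold quadForm
  rw [integral_finsetSum _ fun p _ =>
    ((hZ.memLp_mul_centred p.1 p.2).integrable (by norm_num)).const_mul _]
  simp_rw [integral_const_mul, hZ.integral_mul_centred]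

/-- The pairs of sites are grouped by their lag; `overlap` counts the pairs with a given lag. -/
lemma FourthOrderStationary.hasSum_integral_quadForm (hZ : FourthOrderStationary P Z)
    (D : Finset (ℤ × ℤ)) {A : ℤ × ℤ → ℝ} (hA : ∀ h, A (-h) = A h) :
    HasSum (fun h => autocov P Z h * A h * overlap D h)
      (∫ x, quadForm D A (centred P Z) x ∂P) := by
  rw [hZ.integral_quadForm_eq_sum, Finset.sum_product]
  convert hasSum_translate D D id (fun s t => A (s - t) * autocov P Z (t - s)) using 2 with h
  rw [overlap, Finset.mul_sum]
  refine Finset.sum_congr rfl fun s _ => ?_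
  simp only [id, add_sub_cancel_left, sub_add_cancel_left, hA]
  split_ifs <;> ring

/-- The fourth-order cumulant part of the variance of a quadratic form. -/
def cumPart (P : Measure Ω) (Z : ℤ × ℤ → Ω → ℝ) (D : Finset (ℤ × ℤ)) (A : ℤ × ℤ → ℝ) : ℝ :=
  ∑' h : (ℤ × ℤ) × (ℤ × ℤ) × (ℤ × ℤ),
    lagCum4 P Z h * (A h.1 * A (h.2.1 - h.2.2) * overlap3 D h)

/-- The Gaussian part of the variance of a quadratic form, up to a factor of two. -/
def covPart (P : Measure Ω) (Z : ℤ × ℤ → Ω → ℝ) (D : Finset (ℤ × ℤ)) (A : ℤ × ℤ → ℝ) : ℝ :=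
  ∑' h : (ℤ × ℤ) × (ℤ × ℤ), autocov P Z h.1 * autocov P Z h.2 * pairCoeff D A h

/-- A quadruple of sites is a base point together with three lags, and the cumulant depends on the
lags only; `overlap3` counts the base points. -/
lemma cumPart_eq_sum (D : Finset (ℤ × ℤ)) {A : ℤ × ℤ → ℝ} (hA : ∀ h, A (-h) = A h) :
    cumPart P Z D A = ∑ p ∈ D ×ˢ D, ∑ r ∈ D ×ˢ D, A (p.1 - p.2) * A (r.1 - r.2) *
      lagCum4 P Z (p.2 - p.1, r.1 - p.1, r.2 - p.1) := by
  have := hasSum_translate D (D ×ˢ D ×ˢ D) (fun s => (s, s, s))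
    (fun s w => A (s - w.1) * A (w.2.1 - w.2.2) *
      lagCum4 P Z (w.1 - s, w.2.1 - s, w.2.2 - s))
  rw [Finset.sum_product]
  simp_rw [Finset.sum_product (s := D) (t := D ×ˢ D)] at this
  rw [← this.tsum_eq, cumPart]
  refine tsum_congr fun h => ?_
  rw [overlap3, Finset.mul_sum, Finset.mul_sum]
  refine Finset.sum_congr rfl fun s _ => ?_
  split_ifs
  · simp only [mul_one, Prod.fst_add, Prod.snd_add, add_sub_add_left_eq_sub, add_sub_cancel_left,
      sub_add_cancel_left, hA]
    ring
  · ring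

lemma covPart_eq_sum (D : Finset (ℤ × ℤ)) (A : ℤ × ℤ → ℝ) :
    covPart P Z D A = ∑ p ∈ D ×ˢ D, ∑ r ∈ D ×ˢ D, A (p.1 - p.2) * A (r.1 - r.2) *
      (autocov P Z (r.1 - p.1) * autocov P Z (r.2 - p.2)) := by
  have := hasSum_translate (D ×ˢ D) (D ×ˢ D) id
    (fun p r => A (p.1 - p.2) * A (r.1 - r.2) *
      (autocov P Z (r.1 - p.1) * autocov P Z (r.2 - p.2)))
  rw [← this.tsum_eq, covPart]
  refine tsum_congr fun h => ?_
  rw [pairCoeff, Finset.mul_sum]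
  refine Finset.sum_congr rfl fun p _ => ?_
  simp only [id]
  split_ifs
  · simp only [Prod.fst_add, Prod.snd_add, add_sub_cancel_left]
    rw [show p.1 + h.1 - (p.2 + h.2) = p.1 - p.2 + (h.1 - h.2) by abel]
    ring
  · ring

/-- The second moment of a quadratic form. -/
lemma FourthOrderStationary.integral_quadForm_sq (hZ : FourthOrderStationary P Z)
    (D : Finset (ℤ × ℤ)) {A : ℤ × ℤ → ℝ} (hA : ∀ h, A (-h) = A h) :
    ∫ x, quadForm D A (centred P Z) x ^ 2 ∂P =
      (∫ x, quadForm D A (centred P Z) x ∂P) ^ 2 + cumPart P Z D A + 2 * covPart P Z D A := by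
  have hint : ∀ p r : (ℤ × ℤ) × (ℤ × ℤ), Integrable (fun x =>
      (centred P Z p.1 x * centred P Z p.2 x) * (centred P Z r.1 x * centred P Z r.2 x)) P :=
    fun p r => (hZ.memLp_mul_centred p.1 p.2).integrable_mul (hZ.memLp_mul_centred r.1 r.2)
  have e1 : ∫ x, quadForm D A (centred P Z) x ^ 2 ∂P = ∑ p ∈ D ×ˢ D, ∑ r ∈ D ×ˢ D,
      A (p.1 - p.2) * A (r.1 - r.2) * ∫ x,
        (centred P Z p.1 x * centred P Z p.2 x) * (centred P Z r.1 x * centred P Z r.2 x) ∂P := by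
    simp_rw [← integral_const_mul]
    simp_rw [← integral_finsetSum (D ×ˢ D) fun r _ => (hint _ r).const_mul _]
    rw [← integral_finsetSum _ fun p _ => integrable_finsetSum _ fun r _ => (hint p r).const_mul _]
    refine integral_congr_ae (.of_forall fun x => ?_)
    simp only [quadForm, sq, Finset.sum_mul_sum]
    refine Finset.sum_congr rfl fun p _ => Finset.sum_congr rfl fun r _ => by ring
  -- The two crossed Gaussian pairings contribute equally: exchanging the entries of `r` maps one to
  -- the other because `A` is even. This accounts for the factor two.
  have e2 : ∑ p ∈ D ×ˢ D, ∑ r ∈ D ×ˢ D, A (p.1 - p.2) * A (r.1 - r.2) *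
      (autocov P Z (r.2 - p.1) * autocov P Z (r.1 - p.2)) = covPart P Z D A := by
    rw [covPart_eq_sum]
    refine Finset.sum_congr rfl fun p _ => ?_
    refine Finset.sum_equiv (Equiv.prodComm _ _) (by simp [and_comm]) fun r _ => ?_
    simp only [Equiv.prodComm_apply, Prod.fst_swap, Prod.snd_swap]
    rw [← hA (r.1 - r.2), neg_sub]
  rw [e1, hZ.integral_quadForm_eq_sum, cumPart_eq_sum D hA, two_mul, ← add_assoc]
  -- Only one of the two copies is rewritten as the other pairing, so that the sums agree term by
  -- term with the fourth-moment formula.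
  nth_rw 2 [← e2]
  rw [covPart_eq_sum, sq, Finset.sum_mul_sum]
  simp_rw [← Finset.sum_add_distrib]
  refine Finset.sum_congr rfl fun p _ => Finset.sum_congr rfl fun r _ => ?_
  have := hZ.integral_mul4_centred p.1 p.2 r.1 r.2
  simp_rw [mul_assoc] at this ⊢
  rw [this]
  ring

end QuadraticForms

/-! ### Orthogonality on the Fourier grid; periodograms as quadratic forms. -/

section Fourier

lemma phase_add (s t : ℤ × ℤ) (ω : ℝ × ℝ) : phase (s + t) ω = phase s ω + phase t ω := by
  simp [phase]; ring

lemma phase_sub (s t : ℤ × ℤ) (ω : ℝ × ℝ) : phase (s - t) ω = phase s ω - phase t ω := by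
  simp [phase]; ring

lemma phase_neg (s : ℤ × ℤ) (ω : ℝ × ℝ) : phase (-s) ω = -phase s ω := by
  simp [phase]; ring

/-- Multiplication by `2 sin(θ/2)` makes the sum telescope, and after `p` steps the angle has
advanced by `2πj`, a whole number of turns. The factor is nonzero because `p` does not divide `j`.
-/
lemma sum_cos_eq_zero {p : ℕ} {j : ℤ} (hj : ¬ (p : ℤ) ∣ j) (a : ℝ) :
    ∑ r ∈ Finset.Icc (1 : ℤ) p, Real.cos (r * (2 * Real.pi * j / p) + a) = 0 := by
  rcases Nat.eq_zero_or_pos p with rfl | hp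
  · simp
  have hp' : (p : ℝ) ≠ 0 := by positivity
  set θ : ℝ := 2 * Real.pi * j / p with hθ
  have hs : Real.sin (θ / 2) ≠ 0 := by
    intro h0
    obtain ⟨k, hk⟩ := Real.sin_eq_zero_iff.1 h0
    refine hj ⟨k, ?_⟩
    rw [hθ] at hk
    field_simp at hk
    have : ((k * p : ℤ) : ℝ) = (j : ℤ) := by
      push_cast
      linarith
    rw [mul_comm]; exact_mod_cast this.symm
  have key : ∀ q : ℕ, 2 * Real.sin (θ / 2) *
      ∑ r ∈ Finset.Icc (1 : ℤ) q, Real.cos (r * θ + a) =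
      Real.sin (q * θ + θ / 2 + a) - Real.sin (θ / 2 + a) := by
    intro q
    induction q with
    | zero => simp
    | succ q ih =>
      have : Finset.Icc (1 : ℤ) ((q + 1 : ℕ) : ℤ) = insert ((q : ℤ) + 1) (Finset.Icc (1 : ℤ) q) := by
        ext r; simp; omega
      rw [this, Finset.sum_insert (by simp), mul_add, ih]
      have h2 := Real.sin_sub_sin (((q + 1 : ℕ) : ℝ) * θ + θ / 2 + a) (q * θ + θ / 2 + a)
      have e1 : ((((q + 1 : ℕ) : ℝ) * θ + θ / 2 + a) - (q * θ + θ / 2 + a)) / 2 = θ / 2 := by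
        push_cast; ring
      have e2 : ((((q + 1 : ℕ) : ℝ) * θ + θ / 2 + a) + (q * θ + θ / 2 + a)) / 2
          = (((q : ℤ) + 1 : ℤ) : ℝ) * θ + a := by push_cast; ring
      rw [e1, e2] at h2
      linarith
  have := key p
  have e : (p : ℝ) * θ + θ / 2 + a = (θ / 2 + a) + j * (2 * Real.pi) := by
    rw [hθ]; field_simp; ring
  rw [e, Real.sin_add_int_mul_two_pi, sub_self] at this
  simpa [hs] using this

lemma sum_cos_eq {p : ℕ} {j : ℤ} (hj : (p : ℤ) ∣ j) (a : ℝ) :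
    ∑ r ∈ Finset.Icc (1 : ℤ) p, Real.cos (r * (2 * Real.pi * j / p) + a) = p * Real.cos a := by
  rcases Nat.eq_zero_or_pos p with rfl | hp
  · simp
  have hp' : (p : ℝ) ≠ 0 := by positivity
  obtain ⟨k, rfl⟩ := hj
  have : ∀ r : ℤ, Real.cos (r * (2 * Real.pi * ((p * k : ℤ) : ℝ) / p) + a) = Real.cos a := by
    intro r
    rw [← Real.cos_add_int_mul_two_pi a (r * k)]
    congr 1
    push_cast
    field_simp
    ring
  rw [Finset.sum_congr rfl fun r _ => this r]
  simp

/-- Orthogonality of the characters of `ℤ/p₁ × ℤ/p₂`, with a free phase `a` so that sums over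
shifted arguments are covered as well. -/
lemma sum_region_cos (p : ℕ × ℕ) (j : ℤ × ℤ) (a : ℝ) :
    ∑ r ∈ region 0 p, Real.cos (phase r (freq p j) + a) =
      if (p.1 : ℤ) ∣ j.1 ∧ (p.2 : ℤ) ∣ j.2 then size p * Real.cos a else 0 := by
  simp only [region, phase, freq, Prod.fst_zero, Prod.snd_zero, zero_add]
  rw [Finset.sum_product]
  by_cases h2 : (p.2 : ℤ) ∣ j.2
  · have : ∀ r₁ : ℤ, ∑ r₂ ∈ Finset.Icc (1 : ℤ) p.2, Real.cos (r₁ * (2 * Real.pi * j.1 / p.1) +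
        r₂ * (2 * Real.pi * j.2 / p.2) + a) =
        p.2 * Real.cos (r₁ * (2 * Real.pi * j.1 / p.1) + a) := by
      intro r₁
      rw [← sum_cos_eq h2]
      refine Finset.sum_congr rfl fun r₂ _ => by ring_nf
    simp_rw [this, ← Finset.mul_sum]
    by_cases h1 : (p.1 : ℤ) ∣ j.1
    · rw [sum_cos_eq h1, if_pos ⟨h1, h2⟩, size]; ring
    · rw [sum_cos_eq_zero h1, if_neg (by tauto), mul_zero]
  · rw [if_neg (by tauto)]
    refine Finset.sum_eq_zero fun r₁ _ => ?_
    rw [← sum_cos_eq_zero h2 (r₁ * (2 * Real.pi * j.1 / p.1) + a)]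
    refine Finset.sum_congr rfl fun r₂ _ => by ring_nf

lemma mem_grid {p : ℕ × ℕ} {j : ℤ × ℤ} : j ∈ grid p ↔
    j ≠ 0 ∧ 2 * |j.1| ≤ p.1 ∧ 2 * |j.2| ≤ p.2 := by
  simp only [grid, Finset.mem_erase, Finset.mem_product, Finset.mem_Icc, ← abs_le]
  refine and_congr Iff.rfl (and_congr ?_ ?_) <;> push_cast <;> omega

lemma neg_mem_grid {p : ℕ × ℕ} {j : ℤ × ℤ} : -j ∈ grid p ↔ j ∈ grid p := by
  simp [mem_grid]

/-- The entries of a grid index are at most half a period in absolute value, so the only multiple of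
the period among them is zero. -/
lemma not_dvd_of_mem_grid {p : ℕ × ℕ} {j : ℤ × ℤ} (hj : j ∈ grid p) :
    ¬ ((p.1 : ℤ) ∣ j.1 ∧ (p.2 : ℤ) ∣ j.2) := by
  rintro ⟨h1, h2⟩
  obtain ⟨h0, h3, h4⟩ := mem_grid.1 hj
  have aux : ∀ (q : ℕ) (i : ℤ), (q : ℤ) ∣ i → 2 * |i| ≤ q → i = 0 := by
    intro q i hd hl
    by_contra hne
    have := Int.le_of_dvd (abs_pos.2 hne) ((dvd_abs _ _).2 hd)
    have := abs_pos.2 hne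
    omega
  exact h0 (Prod.ext (aux _ _ h1 h3) (aux _ _ h2 h4))

lemma norm_sum_sq {ι : Type*} (D : Finset ι) (c θ : ι → ℝ) :
    ‖∑ s ∈ D, (c s : ℂ) * Complex.exp (-Complex.I * (θ s : ℝ))‖ ^ 2 =
      ∑ p ∈ D ×ˢ D, Real.cos (θ p.1 - θ p.2) * (c p.1 * c p.2) := by
  have hz : ∑ s ∈ D, (c s : ℂ) * Complex.exp (-Complex.I * (θ s : ℝ)) =
      ((∑ s ∈ D, c s * Real.cos (θ s) : ℝ) : ℂ) + ((-∑ s ∈ D, c s * Real.sin (θ s) : ℝ) : ℂ)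
        * Complex.I := by
    push_cast
    rw [← Finset.sum_neg_distrib, Finset.sum_mul, ← Finset.sum_add_distrib]
    refine Finset.sum_congr rfl fun s _ => ?_
    rw [show -Complex.I * (θ s : ℂ) = ((-θ s : ℝ) : ℂ) * Complex.I by push_cast; ring,
      Complex.exp_mul_I, ← Complex.ofReal_cos, ← Complex.ofReal_sin, Real.cos_neg, Real.sin_neg]
    push_cast
    ring
  rw [hz, Complex.sq_norm, Complex.normSq_add_mul_I, neg_sq, sq, sq, Finset.sum_mul_sum,
    Finset.sum_mul_sum, Finset.sum_product, ← Finset.sum_add_distrib]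
  refine Finset.sum_congr rfl fun s _ => ?_
  rw [← Finset.sum_add_distrib]
  refine Finset.sum_congr rfl fun t _ => ?_
  rw [Real.cos_sub]; ring

variable {Ω : Type*} [MeasurableSpace Ω] {P : Measure Ω} [IsProbabilityMeasure P]
  {Z : ℤ × ℤ → Ω → ℝ}

/-- Only differences of phases enter the squared modulus, so the position of the block affects the
field but not the kernel. -/
lemma periodogram_eq_quadForm (Z : ℤ × ℤ → Ω → ℝ) (k : ℤ × ℤ) (p : ℕ × ℕ) (ω : ℝ × ℝ) (x : Ω) :
    periodogram Z k p ω x = (2 * Real.pi) ^ (-2 : ℤ) * (size p)⁻¹ *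
      quadForm (region 0 p) (fun h => Real.cos (phase h ω)) (fun s => Z (s + k)) x := by
  rw [periodogram, norm_sum_sq]
  congr 1
  simp only [quadForm, phase_sub]
  symm
  refine Finset.sum_equiv (Equiv.addRight (k, k)) ?_ ?_
  · intro r
    simp [region]
    omega
  · intro r _
    simp [phase_add]

/-- Over the Fourier grid the quadratic form does not see the mean. -/
lemma quadForm_centred (hZ : FourthOrderStationary P Z) {p : ℕ × ℕ} {j : ℤ × ℤ}
    (hj : j ∈ grid p) (x : Ω) :
    quadForm (region 0 p) (fun h => Real.cos (phase h (freq p j))) Z x =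
      quadForm (region 0 p) (fun h => Real.cos (phase h (freq p j))) (centred P Z) x := by
  have hn := not_dvd_of_mem_grid hj
  set D := region 0 p
  have hc : ∀ a, ∑ r ∈ D, Real.cos (phase r (freq p j) + a) = 0 := fun a => by
    rw [sum_region_cos, if_neg hn]
  -- Every row and every column of the kernel matrix sums to zero, which kills the terms containing
  -- `μ`.
  have h1 : ∀ s, ∑ t ∈ D, Real.cos (phase (s - t) (freq p j)) = 0 := fun s => by
    rw [← hc (-phase s (freq p j))]
    refine Finset.sum_congr rfl fun t _ => ?_
    rw [phase_sub, ← Real.cos_neg]; ring_nf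
  have h2 : ∀ t, ∑ s ∈ D, Real.cos (phase (s - t) (freq p j)) = 0 := fun t => by
    rw [← hc (-phase t (freq p j))]
    refine Finset.sum_congr rfl fun s _ => ?_
    rw [phase_sub]; ring_nf
  set μ := ∫ y, Z 0 y ∂P
  have e : ∀ s, Z s x = centred P Z s x + μ := fun s => by
    rw [centred, hZ.integral_eq s]; ring
  simp only [quadForm, e]
  have e3 : ∀ r : (ℤ × ℤ) × (ℤ × ℤ), Real.cos (phase (r.1 - r.2) (freq p j)) *
      ((centred P Z r.1 x + μ) * (centred P Z r.2 x + μ)) =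
      Real.cos (phase (r.1 - r.2) (freq p j)) * (centred P Z r.1 x * centred P Z r.2 x) +
      (centred P Z r.1 x + μ) * μ * Real.cos (phase (r.1 - r.2) (freq p j)) +
      centred P Z r.2 x * μ * Real.cos (phase (r.1 - r.2) (freq p j)) := fun r => by ring
  simp_rw [e3, Finset.sum_add_distrib]
  have z1 : ∑ r ∈ D ×ˢ D, (centred P Z r.1 x + μ) * μ *
      Real.cos (phase (r.1 - r.2) (freq p j)) = 0 := by
    rw [Finset.sum_product]
    exact Finset.sum_eq_zero fun s _ => by simp only [← Finset.mul_sum, h1, mul_zero]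
  have z2 : ∑ r ∈ D ×ˢ D, centred P Z r.2 x * μ *
      Real.cos (phase (r.1 - r.2) (freq p j)) = 0 := by
    rw [Finset.sum_product_right]
    exact Finset.sum_eq_zero fun s _ => by simp only [← Finset.mul_sum, h2, mul_zero]
  rw [z1, z2, add_zero, add_zero]

/-- The smoothing kernel of the spectral mean statistic. -/
def kernel (ψ : ℝ × ℝ → ℝ) (p : ℕ × ℕ) (h : ℤ × ℤ) : ℝ :=
  (size p)⁻¹ * ∑ j ∈ grid p, ψ (freq p j) * Real.cos (phase h (freq p j))

lemma kernel_neg (ψ : ℝ × ℝ → ℝ) (p : ℕ × ℕ) (h : ℤ × ℤ) :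
    kernel ψ p (-h) = kernel ψ p h := by
  simp [kernel, phase_neg]

lemma FourthOrderStationary.periodogram_eq (hZ : FourthOrderStationary P Z) (k : ℤ × ℤ)
    {p : ℕ × ℕ} {j : ℤ × ℤ} (hj : j ∈ grid p) (x : Ω) :
    periodogram Z k p (freq p j) x = (2 * Real.pi) ^ (-2 : ℤ) * (size p)⁻¹ *
      quadForm (region 0 p) (fun h => Real.cos (phase h (freq p j)))
        (centred P fun s => Z (s + k)) x := by
  rw [periodogram_eq_quadForm, quadForm_centred (hZ.translate k) hj]

/-- Exchanging the sums over frequencies and over sites puts the whole dependence on `ψ` into one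
kernel; the powers of `2π` cancel. -/
lemma FourthOrderStationary.specAvg_eq (hZ : FourthOrderStationary P Z) (ψ : ℝ × ℝ → ℝ)
    (k : ℤ × ℤ) (p : ℕ × ℕ) (x : Ω) :
    specAvg Z ψ k p x = (size p)⁻¹ *
      quadForm (region 0 p) (kernel ψ p) (centred P fun s => Z (s + k)) x := by
  have hπ : ((2 * Real.pi) ^ 2 : ℝ) * (2 * Real.pi) ^ (-2 : ℤ) = 1 := by
    rw [zpow_neg, ← zpow_natCast (2 * Real.pi) 2]
    exact mul_inv_cancel₀ (by positivity)
  have e : ∑ j ∈ grid p, ψ (freq p j) * periodogram Z k p (freq p j) x =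
      (2 * Real.pi) ^ (-2 : ℤ) *
        quadForm (region 0 p) (kernel ψ p) (centred P fun s => Z (s + k)) x := by
    rw [Finset.sum_congr rfl fun j hj => by rw [hZ.periodogram_eq k hj]]
    simp only [quadForm, kernel, Finset.mul_sum, Finset.sum_mul]
    rw [Finset.sum_comm]
    refine Finset.sum_congr rfl fun r _ => Finset.sum_congr rfl fun j _ => by ring
  rw [specAvg, e]
  linear_combination (size p)⁻¹ *
    quadForm (region 0 p) (kernel ψ p) (centred P fun s => Z (s + k)) x * hπ

end Fourier

/-! ### Boundedness and almost everywhere continuity of functions of bounded variation. -/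

section BoundedVariation

lemma mem_freqDomain {ω : ℝ × ℝ} : ω ∈ freqDomain ↔ |ω.1| ≤ Real.pi ∧ |ω.2| ≤ Real.pi := by
  simp only [freqDomain, Set.mem_Icc, Prod.le_def, abs_le]
  tauto

lemma neg_mem_freqDomain {ω : ℝ × ℝ} : -ω ∈ freqDomain ↔ ω ∈ freqDomain := by
  simp [mem_freqDomain]

/-- The sums whose supremum is the variation of `ψ` along chains below `ω`. -/
def chainSums (ψ : ℝ × ℝ → ℝ) (ω : ℝ × ℝ) : Set ℝ :=
  {v | ∃ (N : ℕ) (u : ℕ → ℝ × ℝ), Monotone u ∧ (∀ i, u i ∈ freqDomain) ∧ (∀ i, u i ≤ ω) ∧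
    v = ∑ i ∈ Finset.range N, |ψ (u (i + 1)) - ψ (u i)|}

/-- The variation of `ψ` along chains below `ω`. -/
def chainVariation (ψ : ℝ × ℝ → ℝ) (ω : ℝ × ℝ) : ℝ := sSup (chainSums ψ ω)

variable {ψ : ℝ × ℝ → ℝ}

lemma IsBV.bddAbove (hψ : IsBV ψ) (ω : ℝ × ℝ) : BddAbove (chainSums ψ ω) := by
  obtain ⟨C, hC⟩ := hψ
  refine ⟨C, ?_⟩
  rintro v ⟨N, u, hu, hud, -, rfl⟩
  exact hC N u hu hud

/-- A chain below `ω` can be prolonged by `ω` and then `ω'`, which adds the increment of `ψ` from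
`ω` to `ω'` to its variation. -/
lemma IsBV.abs_sub_le (hψ : IsBV ψ) {ω ω' : ℝ × ℝ} (hω : ω ∈ freqDomain)
    (hω' : ω' ∈ freqDomain) (h : ω ≤ ω') :
    |ψ ω' - ψ ω| ≤ chainVariation ψ ω' - chainVariation ψ ω := by
  rw [le_sub_iff_add_le, add_comm, ← le_sub_iff_add_le]
  refine csSup_le ⟨0, 0, fun _ => ω, monotone_const, fun _ => hω, fun _ => le_rfl, by simp⟩ ?_
  rintro v ⟨N, u, hu, hud, hul, rfl⟩
  rw [le_sub_iff_add_le]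
  -- The chain stays at `ω'` afterwards, so that it is monotone on all of `ℕ`.
  let w : ℕ → ℝ × ℝ := fun i => if i ≤ N then u i else if i = N + 1 then ω else ω'
  have hw : Monotone w := by
    refine monotone_nat_of_le_succ fun i => ?_
    simp only [w]
    split_ifs <;> first | omega | exact hu (Nat.le_succ _) | exact hul _ | exact h | exact le_rfl
  have hmem : ∑ i ∈ Finset.range (N + 2), |ψ (w (i + 1)) - ψ (w i)| ∈ chainSums ψ ω' := by
    refine ⟨N + 2, w, hw, fun i => ?_, fun i => ?_, rfl⟩
    · simp only [w]; split_ifs <;> first | exact hud _ | assumption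
    · simp only [w]; split_ifs <;> first | exact (hul _).trans h | exact h | exact le_rfl
  refine le_trans ?_ (le_csSup (hψ.bddAbove ω') hmem)
  rw [Finset.sum_range_succ, Finset.sum_range_succ]
  have e1 : ∑ i ∈ Finset.range N, |ψ (w (i + 1)) - ψ (w i)| =
      ∑ i ∈ Finset.range N, |ψ (u (i + 1)) - ψ (u i)| := by
    refine Finset.sum_congr rfl fun i hi => ?_
    have := Finset.mem_range.1 hi
    simp only [w]
    rw [if_pos (by omega), if_pos (by omega)]
  have e2 : w (N + 1) = ω := by simp [w]
  have e3 : w (N + 1 + 1) = ω' := by simp [w]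
  rw [e1, e3, e2]
  have := abs_nonneg (ψ ω - ψ (w N))
  linarith

lemma IsBV.variation_mono (hψ : IsBV ψ) {ω ω' : ℝ × ℝ} (hω : ω ∈ freqDomain)
    (hω' : ω' ∈ freqDomain) (h : ω ≤ ω') : chainVariation ψ ω ≤ chainVariation ψ ω' := by
  have := hψ.abs_sub_le hω hω' h
  have := abs_nonneg (ψ ω' - ψ ω)
  linarith

lemma IsBV.bounded (hψ : IsBV ψ) : ∃ B : ℝ, 0 ≤ B ∧ ∀ ω ∈ freqDomain, |ψ ω| ≤ B := by
  set o : ℝ × ℝ := (-Real.pi, -Real.pi)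
  set t : ℝ × ℝ := (Real.pi, Real.pi)
  have hπ := Real.pi_pos
  have ho : o ∈ freqDomain := by simp [mem_freqDomain, o, abs_of_pos hπ]
  have ht : t ∈ freqDomain := by simp [mem_freqDomain, t, abs_of_pos hπ]
  have hb : ∀ ω ∈ freqDomain, |ψ ω| ≤ |ψ o| + (chainVariation ψ t - chainVariation ψ o) := by
    intro ω hω
    have h1 : o ≤ ω := hω.1
    have h2 : ω ≤ t := hω.2
    have h3 := hψ.abs_sub_le ho hω h1
    have h4 := hψ.variation_mono hω ht h2
    have h5 := abs_sub_abs_le_abs_sub (ψ ω) (ψ o)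
    linarith
  exact ⟨_, (abs_nonneg _).trans (hb o ho), hb⟩

/-- The open frequency square. -/
def openDomain : Set (ℝ × ℝ) := {ω | |ω.1| < Real.pi ∧ |ω.2| < Real.pi}

lemma isOpen_openDomain : IsOpen openDomain := by
  refine IsOpen.and ?_ ?_ <;> exact isOpen_lt (by fun_prop) continuous_const

lemma openDomain_subset : openDomain ⊆ freqDomain := fun _ h =>
  mem_freqDomain.2 ⟨h.1.le, h.2.le⟩

/-- Two points of a diagonal line are opposite corners of a box that contains a planar neighbourhood
of the points between them. Every point of the box is comparable with both corners, so `ψ`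
oscillates there by no more than a multiple of the increment of the variation. One-dimensional
continuity of the variation therefore gives planar continuity of `ψ`. -/
lemma IsBV.continuousAt_of_diagonal (hψ : IsBV ψ) {x t₀ : ℝ} (h₀ : (t₀, t₀ + x) ∈ openDomain)
    (hc : ContinuousAt (fun t => chainVariation ψ (t, t + x)) t₀) :
    ContinuousAt ψ (t₀, t₀ + x) := by
  rw [Metric.continuousAt_iff]
  intro ε hε
  have hopen : IsOpen {t : ℝ | (t, t + x) ∈ openDomain} :=
    isOpen_openDomain.preimage (by fun_prop)
  obtain ⟨δ₁, hδ₁, h1⟩ := Metric.isOpen_iff.1 hopen t₀ h₀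
  -- Two errors of `ε/4` bound the increment of the variation by `ε/2`; passing from `ω` to the
  -- lower corner and from there to the centre uses this twice.
  obtain ⟨δ₂, hδ₂, h2⟩ := Metric.continuousAt_iff.1 hc (ε / 4) (by positivity)
  set δ := min δ₁ δ₂ / 2 with hδ
  have hδp : 0 < δ := by positivity
  have hl1 : δ < δ₁ := by have := min_le_left δ₁ δ₂; linarith
  have hl2 : δ < δ₂ := by have := min_le_right δ₁ δ₂; linarith
  have hlo : (t₀ - δ, t₀ - δ + x) ∈ freqDomain := openDomain_subset
    (h1 (by simp [abs_of_pos hδp, hl1]))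
  have hhi : (t₀ + δ, t₀ + δ + x) ∈ freqDomain := openDomain_subset
    (h1 (by simp [abs_of_pos hδp, hl1]))
  have hvlo := h2 (x := t₀ - δ) (by simp [abs_of_pos hδp, hl2])
  have hvhi := h2 (x := t₀ + δ) (by simp [abs_of_pos hδp, hl2])
  rw [Real.dist_eq] at hvlo hvhi
  have hv : chainVariation ψ (t₀ + δ, t₀ + δ + x) - chainVariation ψ (t₀ - δ, t₀ - δ + x)
      < ε / 2 := by
    have := (abs_lt.1 hvlo).1
    have := (abs_lt.1 hvhi).2
    linarith
  have box : ∀ ω : ℝ × ℝ, (t₀ - δ, t₀ - δ + x) ≤ ω → ω ≤ (t₀ + δ, t₀ + δ + x) →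
      |ψ ω - ψ (t₀ - δ, t₀ - δ + x)| < ε / 2 := by
    intro ω hω1 hω2
    have hω : ω ∈ freqDomain := ⟨hlo.1.trans hω1, hω2.trans hhi.2⟩
    have a1 := hψ.abs_sub_le hlo hω hω1
    have a2 := hψ.variation_mono hω hhi hω2
    linarith
  refine ⟨δ, hδp, fun {ω} hω => ?_⟩
  rw [Prod.dist_eq, max_lt_iff, Real.dist_eq, Real.dist_eq, abs_lt, abs_lt] at hω
  have b1 := box ω (Prod.mk_le_mk.2 ⟨by linarith [hω.1.1], by linarith [hω.2.1]⟩)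
    (Prod.mk_le_mk.2 ⟨by linarith [hω.1.2], by linarith [hω.2.2]⟩)
  have b2 := box (t₀, t₀ + x) (Prod.mk_le_mk.2 ⟨by linarith, by linarith⟩)
    (Prod.mk_le_mk.2 ⟨by linarith, by linarith⟩)
  rw [Real.dist_eq]
  rw [abs_lt] at b1 b2 ⊢
  constructor <;> linarith [b1.1, b1.2, b2.1, b2.2]

/-- A function of bounded variation is continuous almost everywhere in the frequency square. -/
lemma IsBV.ae_continuousAt (hψ : IsBV ψ) :
    ∀ᵐ ω : ℝ × ℝ, ω ∈ openDomain → ContinuousAt ψ ω := by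
  have hm : MeasurableSet {ω : ℝ × ℝ | ¬ (ω ∈ openDomain → ContinuousAt ψ ω)} := by
    have : {ω : ℝ × ℝ | ¬ (ω ∈ openDomain → ContinuousAt ψ ω)} =
        openDomain ∩ {ω | ContinuousAt ψ ω}ᶜ := by ext; simp
    rw [this]
    exact isOpen_openDomain.measurableSet.inter (measurableSet_of_continuousAt ψ).compl
  rw [ae_iff]
  -- The shear `(x, t) ↦ (t, t + x)` preserves area and turns vertical slices into diagonal lines,
  -- so by Fubini it suffices that each diagonal meets the discontinuities in a null set. There they
  -- are countable, the variation being monotone along the diagonal.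
  have hmp := measurePreserving_prod_add_swap (volume : Measure ℝ) (volume : Measure ℝ)
  rw [← Measure.volume_eq_prod] at hmp
  rw [← hmp.measure_preimage hm.nullMeasurableSet, Measure.volume_eq_prod,
    Measure.measure_prod_null (hmp.measurable hm)]
  refine .of_forall fun x => ?_
  set T : Set ℝ := {t : ℝ | (t, t + x) ∈ openDomain} with hT
  have hopen : IsOpen T := isOpen_openDomain.preimage (by fun_prop)
  have hmono : MonotoneOn (fun t => chainVariation ψ (t, t + x)) T := by
    intro s hs t ht hst
    exact hψ.variation_mono (openDomain_subset hs) (openDomain_subset ht)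
      (Prod.mk_le_mk.2 ⟨hst, by linarith⟩)
  refine Set.Countable.measure_zero (hmono.countable_not_continuousWithinAt.mono ?_) _
  intro t ht
  simp only [Set.mem_preimage, Set.mem_ofPred_eq, Classical.not_imp] at ht
  exact ⟨ht.1, fun hc => ht.2
    (hψ.continuousAt_of_diagonal ht.1 (hc.continuousAt (hopen.mem_nhds ht.1)))⟩

end BoundedVariation

/-! ### Riemann sums over the Fourier grid. -/

section RiemannSums

/-- The index of the grid cell that contains `ω`. -/
def gridPoint (p : ℕ × ℕ) (ω : ℝ × ℝ) : ℤ × ℤ :=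
  (⌊p.1 * ω.1 / (2 * Real.pi)⌋, ⌊p.2 * ω.2 / (2 * Real.pi)⌋)

/-- Frequencies in the open square and off the axes. -/
def offAxes : Set (ℝ × ℝ) :=
  {ω | (0 < |ω.1| ∧ |ω.1| < Real.pi) ∧ (0 < |ω.2| ∧ |ω.2| < Real.pi)}

lemma measurable_gridPoint (p : ℕ × ℕ) : Measurable (gridPoint p) := by
  unfold gridPoint
  exact (Int.measurable_floor.comp (by fun_prop)).prodMk (Int.measurable_floor.comp (by fun_prop))

lemma freq_neg (p : ℕ × ℕ) (j : ℤ × ℤ) : freq p (-j) = -freq p j := by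
  simp [freq, neg_div]

lemma freq_mem_freqDomain {p : ℕ × ℕ} {j : ℤ × ℤ} (hj : j ∈ grid p) :
    freq p j ∈ freqDomain := by
  have aux : ∀ (q : ℕ) (i : ℤ), 2 * |i| ≤ q → |2 * Real.pi * i / q| ≤ Real.pi := by
    intro q i hi
    rcases Nat.eq_zero_or_pos q with rfl | hq
    · simp [Real.pi_pos.le]
    have hq' : (0 : ℝ) < q := by exact_mod_cast hq
    have hi' : 2 * |(i : ℝ)| ≤ q := by exact_mod_cast hi
    rw [abs_div, abs_mul, abs_of_pos hq', div_le_iff₀ hq', abs_of_pos Real.two_pi_pos]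
    nlinarith [Real.pi_pos]
  obtain ⟨-, h1, h2⟩ := mem_grid.1 hj
  exact mem_freqDomain.2 ⟨aux _ _ h1, aux _ _ h2⟩

lemma floor_eq_iff_mem_Ico {q : ℕ} (hq : 0 < q) (i : ℤ) (y : ℝ) :
    ⌊q * y / (2 * Real.pi)⌋ = i ↔
      y ∈ Set.Ico (2 * Real.pi * i / q) (2 * Real.pi * (i + 1) / q) := by
  have hq' : (0 : ℝ) < q := by exact_mod_cast hq
  rw [Int.floor_eq_iff, le_div_iff₀ Real.two_pi_pos, div_lt_iff₀ Real.two_pi_pos, Set.mem_Ico,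
    div_le_iff₀ hq', lt_div_iff₀ hq']
  constructor <;> rintro ⟨h1, h2⟩ <;> constructor <;> linarith

lemma abs_freq_sub_le {q : ℕ} (hq : 0 < q) (y : ℝ) :
    |2 * Real.pi * ⌊q * y / (2 * Real.pi)⌋ / q - y| ≤ 2 * Real.pi / q := by
  have hq' : (0 : ℝ) < q := by exact_mod_cast hq
  obtain ⟨h1, h2⟩ := (floor_eq_iff_mem_Ico hq _ y).1 rfl
  rw [mul_add, mul_one, add_div] at h2
  rw [abs_le]
  constructor <;> have := div_pos Real.two_pi_pos hq' <;> linarith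

lemma tendsto_fst_snd {p : ℕ → ℕ × ℕ} (hp : Tendsto p atTop atTop) :
    Tendsto (fun m => ((p m).1 : ℝ)) atTop atTop ∧ Tendsto (fun m => ((p m).2 : ℝ)) atTop atTop := by
  rw [← prod_atTop_atTop_eq, tendsto_prod_iff'] at hp
  exact ⟨tendsto_natCast_atTop_atTop.comp hp.1, tendsto_natCast_atTop_atTop.comp hp.2⟩

lemma eventually_pos {p : ℕ → ℕ × ℕ} (hp : Tendsto p atTop atTop) :
    ∀ᶠ m in atTop, 0 < (p m).1 ∧ 0 < (p m).2 := by
  rw [← prod_atTop_atTop_eq, tendsto_prod_iff'] at hp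
  exact (hp.1.eventually_gt_atTop 0).and (hp.2.eventually_gt_atTop 0)

lemma tendsto_size {p : ℕ → ℕ × ℕ} (hp : Tendsto p atTop atTop) :
    Tendsto (fun m => size (p m)) atTop atTop :=
  (tendsto_fst_snd hp).1.atTop_mul_atTop₀ (tendsto_fst_snd hp).2

lemma tendsto_freq_gridPoint {p : ℕ → ℕ × ℕ} (hp : Tendsto p atTop atTop) (ω : ℝ × ℝ) :
    Tendsto (fun m => freq (p m) (gridPoint (p m) ω)) atTop (𝓝 ω) := by
  have aux : ∀ (q : ℕ → ℕ) (y : ℝ), Tendsto (fun m => (q m : ℝ)) atTop atTop →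
      Tendsto (fun m => 2 * Real.pi * ⌊q m * y / (2 * Real.pi)⌋ / q m) atTop (𝓝 y) := by
    intro q y hq
    rw [tendsto_iff_dist_tendsto_zero]
    refine squeeze_zero' (.of_forall fun _ => dist_nonneg) ?_ (hq.const_div_atTop (2 * Real.pi))
    filter_upwards [hq.eventually_gt_atTop 0] with m hm
    exact abs_freq_sub_le (by exact_mod_cast hm) y
  exact (aux _ ω.1 (tendsto_fst_snd hp).1).prodMk_nhds (aux _ ω.2 (tendsto_fst_snd hp).2)

/-- For a frequency off the axes and the boundary the grid point is eventually interior. -/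
lemma eventually_gridPoint {p : ℕ → ℕ × ℕ} (hp : Tendsto p atTop atTop) {ω : ℝ × ℝ}
    (hω : ω ∈ offAxes) : ∀ᶠ m in atTop, (gridPoint (p m) ω).1 ≠ 0 ∧ (gridPoint (p m) ω).2 ≠ 0 ∧
      2 * |(gridPoint (p m) ω).1| < (p m).1 ∧ 2 * |(gridPoint (p m) ω).2| < (p m).2 := by
  have h := tendsto_freq_gridPoint hp ω
  have h1 := (continuous_fst.abs.tendsto ω).comp h
  have h2 := (continuous_snd.abs.tendsto ω).comp h
  have aux : ∀ (q : ℕ) (i : ℤ), 0 < q → 0 < |2 * Real.pi * i / q| →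
      |2 * Real.pi * i / q| < Real.pi → i ≠ 0 ∧ 2 * |i| < q := by
    intro q i hq h0 hlt
    have hq' : (0 : ℝ) < q := by exact_mod_cast hq
    refine ⟨by rintro rfl; simp at h0, ?_⟩
    rw [abs_div, abs_mul, abs_of_pos hq', div_lt_iff₀ hq', abs_of_pos Real.two_pi_pos] at hlt
    have : 2 * |(i : ℝ)| < q := by nlinarith [Real.pi_pos]
    exact_mod_cast this
  filter_upwards [h1.eventually (lt_mem_nhds hω.1.1), h1.eventually (gt_mem_nhds hω.1.2),
    h2.eventually (lt_mem_nhds hω.2.1), h2.eventually (gt_mem_nhds hω.2.2),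
    eventually_pos hp] with m a1 a2 a3 a4 a5
  have c1 := aux _ _ a5.1 a1 a2
  have c2 := aux _ _ a5.2 a3 a4
  exact ⟨c1.1, c2.1, c1.2, c2.2⟩

lemma eventually_gridPoint_mem {p : ℕ → ℕ × ℕ} (hp : Tendsto p atTop atTop) {ω : ℝ × ℝ}
    (hω : ω ∈ offAxes) : ∀ᶠ m in atTop, gridPoint (p m) ω ∈ grid (p m) := by
  filter_upwards [eventually_gridPoint hp hω] with m hm
  exact mem_grid.2 ⟨fun h => hm.1 (by rw [h]; rfl), hm.2.2.1.le, hm.2.2.2.le⟩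

lemma eventually_gridPoint_notMem {p : ℕ → ℕ × ℕ} (hp : Tendsto p atTop atTop) {ω : ℝ × ℝ}
    (hω : ω ∉ freqDomain) : ∀ᶠ m in atTop, gridPoint (p m) ω ∉ grid (p m) := by
  have hcl : IsClosed freqDomain := isClosed_Icc
  have h := (tendsto_freq_gridPoint hp ω).eventually (hcl.isOpen_compl.mem_nhds hω)
  filter_upwards [h] with m hm hg
  exact hm (freq_mem_freqDomain hg)

/-- The exceptional frequencies lie on finitely many lines parallel to the axes. -/
lemma ae_offAxes : ∀ᵐ ω : ℝ × ℝ, ω ∈ freqDomain → ω ∈ offAxes := by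
  have aux : ∀ᵐ y : ℝ, y ≠ 0 ∧ y ≠ Real.pi ∧ y ≠ -Real.pi := by
    simp only [eventually_and]
    exact ⟨Measure.ae_ne _ _, Measure.ae_ne _ _, Measure.ae_ne _ _⟩
  have h1 : ∀ᵐ ω : ℝ × ℝ, ω.1 ≠ 0 ∧ ω.1 ≠ Real.pi ∧ ω.1 ≠ -Real.pi :=
    Measure.quasiMeasurePreserving_fst.ae aux
  have h2 : ∀ᵐ ω : ℝ × ℝ, ω.2 ≠ 0 ∧ ω.2 ≠ Real.pi ∧ ω.2 ≠ -Real.pi :=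
    Measure.quasiMeasurePreserving_snd.ae aux
  have key : ∀ y : ℝ, (y ≠ 0 ∧ y ≠ Real.pi ∧ y ≠ -Real.pi) → |y| ≤ Real.pi →
      0 < |y| ∧ |y| < Real.pi := by
    intro y hy hl
    refine ⟨abs_pos.2 hy.1, lt_of_le_of_ne hl fun he => ?_⟩
    rcases (abs_eq Real.pi_pos.le).1 he with h | h
    · exact hy.2.1 h
    · exact hy.2.2 h
  filter_upwards [h1, h2] with ω a1 a2 hω
  exact ⟨key _ a1 (mem_freqDomain.1 hω).1, key _ a2 (mem_freqDomain.1 hω).2⟩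

/-- A Riemann sum over the grid as the integral of a step function. -/
lemma integral_step {p : ℕ × ℕ} (hp : 0 < p.1 ∧ 0 < p.2) (g : ℤ × ℤ → ℝ) :
    ∫ ω : ℝ × ℝ, (if gridPoint p ω ∈ grid p then g (gridPoint p ω) else 0) =
      (2 * Real.pi) ^ 2 / size p * ∑ j ∈ grid p, g j := by
  have h1 : (0 : ℝ) < p.1 := by exact_mod_cast hp.1
  have h2 : (0 : ℝ) < p.2 := by exact_mod_cast hp.2
  set cell : ℤ × ℤ → Set (ℝ × ℝ) := fun j => {ω | gridPoint p ω = j} with hcell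
  have hm : ∀ j, MeasurableSet (cell j) := fun j => measurable_gridPoint p (measurableSet_singleton j)
  have hc : ∀ j, cell j = Set.Ico (2 * Real.pi * j.1 / p.1) (2 * Real.pi * (j.1 + 1) / p.1) ×ˢ
      Set.Ico (2 * Real.pi * j.2 / p.2) (2 * Real.pi * (j.2 + 1) / p.2) := by
    intro j
    ext ω
    simp only [hcell, Set.mem_ofPred_eq, gridPoint, Prod.ext_iff, Set.mem_prod,
      floor_eq_iff_mem_Ico hp.1, floor_eq_iff_mem_Ico hp.2]
  have aux : ∀ (q : ℝ) (i : ℝ), 2 * Real.pi * (i + 1) / q - 2 * Real.pi * i / q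
      = 2 * Real.pi / q := fun q i => by ring
  have hv : ∀ j, volume (cell j) = ENNReal.ofReal ((2 * Real.pi) ^ 2 / size p) := by
    intro j
    rw [hc, Measure.volume_eq_prod, Measure.prod_prod, Real.volume_Ico, Real.volume_Ico, aux, aux,
      ← ENNReal.ofReal_mul (by positivity)]
    congr 1
    rw [size]
    ring
  have e : (fun ω : ℝ × ℝ => if gridPoint p ω ∈ grid p then g (gridPoint p ω) else 0) =
      fun ω => ∑ j ∈ grid p, (cell j).indicator (fun _ => g j) ω := by
    funext ω
    simp only [Set.indicator_apply, hcell, Set.mem_ofPred_eq]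
    rw [Finset.sum_ite_eq]
  rw [e, integral_finsetSum]
  · rw [Finset.mul_sum]
    refine Finset.sum_congr rfl fun j _ => ?_
    rw [integral_indicator_const _ (hm j), Measure.real, hv,
      ENNReal.toReal_ofReal (by unfold size; positivity), smul_eq_mul]
  · intro j _
    refine (integrable_indicator_iff (hm j)).2 (integrableOn_const ?_)
    rw [hv]; exact ENNReal.ofReal_ne_top

/-- Convergence of Riemann-type sums over the Fourier grid. -/
lemma tendsto_riemann {p : ℕ → ℕ × ℕ} (hp : Tendsto p atTop atTop) {g : ℕ → ℤ × ℤ → ℝ} {C : ℝ}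
    (hC : ∀ᶠ m in atTop, ∀ j ∈ grid (p m), |g m j| ≤ C) {G : ℝ × ℝ → ℝ}
    (hG : ∀ᵐ ω : ℝ × ℝ, ω ∈ offAxes →
      Tendsto (fun m => g m (gridPoint (p m) ω)) atTop (𝓝 (G ω))) :
    Tendsto (fun m => (2 * Real.pi) ^ 2 / size (p m) * ∑ j ∈ grid (p m), g m j) atTop
      (𝓝 (∫ ω in freqDomain, G ω)) := by
  have hmeas : MeasurableSet freqDomain := measurableSet_Icc
  -- Grid frequencies lie in the frequency square and the cells have sides at most `2π`, so all step
  -- functions vanish outside this box.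
  set box : Set (ℝ × ℝ) := Set.Icc (-(3 * Real.pi), -(3 * Real.pi)) (3 * Real.pi, 3 * Real.pi)
  have key : Tendsto (fun m => ∫ ω : ℝ × ℝ,
      (if gridPoint (p m) ω ∈ grid (p m) then g m (gridPoint (p m) ω) else 0)) atTop
      (𝓝 (∫ ω, freqDomain.indicator G ω)) := by
    refine tendsto_integral_filter_of_dominated_convergence (box.indicator fun _ => |C|)
      ?_ ?_ ?_ ?_
    · refine .of_forall fun m => Measurable.aestronglyMeasurable ?_
      exact (Measurable.of_discrete
        (f := fun j => if j ∈ grid (p m) then g m j else 0)).comp (measurable_gridPoint (p m))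
    · filter_upwards [eventually_pos hp, hC] with m hm hCm
      refine .of_forall fun ω => ?_
      split_ifs with hg
      · have hbox : ω ∈ box := by
          have aux : ∀ (q : ℕ) (y : ℝ), 0 < q → |2 * Real.pi * ⌊q * y / (2 * Real.pi)⌋ / q|
              ≤ Real.pi → -(3 * Real.pi) ≤ y ∧ y ≤ 3 * Real.pi := by
            intro q y hq hy
            have h1 := abs_freq_sub_le hq y
            have h2 : 2 * Real.pi / q ≤ 2 * Real.pi :=
              div_le_self Real.two_pi_pos.le (by exact_mod_cast hq)
            rw [abs_le] at h1 hy
            constructor <;> linarith [h1.1, h1.2, hy.1, hy.2]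
          have hf := mem_freqDomain.1 (freq_mem_freqDomain hg)
          have b1 := aux _ ω.1 hm.1 hf.1
          have b2 := aux _ ω.2 hm.2 hf.2
          exact ⟨⟨b1.1, b2.1⟩, ⟨b1.2, b2.2⟩⟩
        rw [Set.indicator_of_mem hbox, Real.norm_eq_abs]
        exact (hCm _ hg).trans (le_abs_self C)
      · rw [norm_zero]
        exact Set.indicator_nonneg (fun _ _ => abs_nonneg C) _
    · refine (integrable_indicator_iff measurableSet_Icc).2 (integrableOn_const ?_)
      exact (isCompact_Icc (a := ((-(3 * Real.pi), -(3 * Real.pi)) : ℝ × ℝ))).measure_lt_top.ne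
    · filter_upwards [hG, ae_offAxes] with ω h1 h2
      -- The closed square is treated up to a null set; off it, grid frequencies near `ω` eventually
      -- leave the grid and the step functions vanish.
      by_cases hω : ω ∈ freqDomain
      · rw [Set.indicator_of_mem hω]
        refine (h1 (h2 hω)).congr' ?_
        filter_upwards [eventually_gridPoint_mem hp (h2 hω)] with m hm
        rw [if_pos hm]
      · rw [Set.indicator_of_notMem hω]
        refine tendsto_const_nhds.congr' ?_
        filter_upwards [eventually_gridPoint_notMem hp hω] with m hm
        rw [if_neg hm]
  rw [integral_indicator hmeas] at key
  refine key.congr' ?_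
  filter_upwards [eventually_pos hp] with m hm
  exact integral_step hm (g m)

lemma offAxes_subset_openDomain : offAxes ⊆ openDomain := fun _ h => ⟨h.1.2, h.2.2⟩

lemma neg_mem_offAxes {ω : ℝ × ℝ} (h : ω ∈ offAxes) : -ω ∈ offAxes := by
  simpa [offAxes] using h

/-- Almost every `ω` has both `ω` and `-ω` as continuity points, since reflection preserves null
sets. -/
lemma IsBV.ae_tendsto {ψ : ℝ × ℝ → ℝ} (hψ : IsBV ψ) {p : ℕ → ℕ × ℕ}
    (hp : Tendsto p atTop atTop) : ∀ᵐ ω : ℝ × ℝ, ω ∈ offAxes →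
      Tendsto (fun m => ψ (freq (p m) (gridPoint (p m) ω))) atTop (𝓝 (ψ ω)) ∧
      Tendsto (fun m => ψ (freq (p m) (-gridPoint (p m) ω))) atTop (𝓝 (ψ (-ω))) := by
  have h1 := hψ.ae_continuousAt
  have h2 : ∀ᵐ ω : ℝ × ℝ, -ω ∈ openDomain → ContinuousAt ψ (-ω) :=
    (Measure.measurePreserving_neg (volume : Measure (ℝ × ℝ))).quasiMeasurePreserving.ae h1
  filter_upwards [h1, h2] with ω a1 a2 hω
  have ht := tendsto_freq_gridPoint hp ω
  refine ⟨(a1 (offAxes_subset_openDomain hω)).tendsto.comp ht, ?_⟩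
  simp_rw [freq_neg]
  exact (a2 (offAxes_subset_openDomain (neg_mem_offAxes hω))).tendsto.comp ht.neg

end RiemannSums

/-! ### Counting sites that stay in the rectangle under shifts. -/

section Overlaps

lemma card_region (p : ℕ × ℕ) : ((region 0 p).card : ℝ) = size p := by
  simp [region, size]

lemma size_nonneg (p : ℕ × ℕ) : 0 ≤ size p := by unfold size; positivity

lemma size_pos {p : ℕ × ℕ} (hp : 0 < p.1 ∧ 0 < p.2) : 0 < size p := by
  unfold size
  exact mul_pos (by exact_mod_cast hp.1) (by exact_mod_cast hp.2)

lemma one_le_size {p : ℕ × ℕ} (hp : 0 < p.1 ∧ 0 < p.2) : 1 ≤ size p := by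
  unfold size
  exact one_le_mul_of_one_le_of_one_le (by exact_mod_cast hp.1) (by exact_mod_cast hp.2)

/-- The number of `s ∈ D` with `s + h ∉ D`. -/
def defect (D : Finset (ℤ × ℤ)) (h : ℤ × ℤ) : ℝ := ∑ s ∈ D, if s + h ∈ D then 0 else 1

lemma overlap_add_defect (D : Finset (ℤ × ℤ)) (h : ℤ × ℤ) :
    overlap D h + defect D h = D.card := by
  rw [overlap, defect, ← Finset.sum_add_distrib, Finset.card_eq_sum_ones]
  push_cast
  refine Finset.sum_congr rfl fun s _ => ?_
  split_ifs <;> norm_num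

lemma overlap_nonneg (D : Finset (ℤ × ℤ)) (h : ℤ × ℤ) : 0 ≤ overlap D h :=
  Finset.sum_nonneg fun s _ => by split_ifs <;> norm_num

lemma defect_nonneg (D : Finset (ℤ × ℤ)) (h : ℤ × ℤ) : 0 ≤ defect D h :=
  Finset.sum_nonneg fun s _ => by split_ifs <;> norm_num

lemma overlap_le (D : Finset (ℤ × ℤ)) (h : ℤ × ℤ) : overlap D h ≤ D.card := by
  linarith [overlap_add_defect D h, defect_nonneg D h]

lemma overlap3_nonneg (D : Finset (ℤ × ℤ)) (h : (ℤ × ℤ) × (ℤ × ℤ) × (ℤ × ℤ)) :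
    0 ≤ overlap3 D h :=
  Finset.sum_nonneg fun s _ => by split_ifs <;> norm_num

lemma overlap3_le (D : Finset (ℤ × ℤ)) (h : (ℤ × ℤ) × (ℤ × ℤ) × (ℤ × ℤ)) :
    overlap3 D h ≤ D.card := by
  rw [overlap3, Finset.card_eq_sum_ones]
  push_cast
  exact Finset.sum_le_sum fun s _ => by split_ifs <;> norm_num

/-- A union bound: a base point that is not counted in `overlap3` is lost under at least one of the
three lags. -/
lemma le_overlap3_add (D : Finset (ℤ × ℤ)) (h : (ℤ × ℤ) × (ℤ × ℤ) × (ℤ × ℤ)) :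
    (D.card : ℝ) ≤ overlap3 D h + (defect D h.1 + defect D h.2.1 + defect D h.2.2) := by
  rw [overlap3, defect, defect, defect, ← Finset.sum_add_distrib, ← Finset.sum_add_distrib,
    ← Finset.sum_add_distrib, Finset.card_eq_sum_ones]
  push_cast
  refine Finset.sum_le_sum fun s _ => ?_
  simp only [Finset.mem_product, Prod.fst_add, Prod.snd_add]
  by_cases h1 : s + h.1 ∈ D <;> by_cases h2 : s + h.2.1 ∈ D <;> by_cases h3 : s + h.2.2 ∈ D <;>
    simp [h1, h2, h3]

lemma card_Icc_shift_le (q : ℕ) (h : ℤ) :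
    ((Finset.Icc (1 : ℤ) q).filter fun r => ¬ (r + h ∈ Finset.Icc (1 : ℤ) q)).card ≤ h.natAbs := by
  rcases le_total 0 h with h0 | h0
  · refine (Finset.card_le_card (t := Finset.Ioc ((q : ℤ) - h) q) fun r hr => ?_).trans ?_
    · simp at hr ⊢; omega
    · rw [Int.card_Ioc]; omega
  · refine (Finset.card_le_card (t := Finset.Icc (1 : ℤ) (-h)) fun r hr => ?_).trans ?_
    · simp at hr ⊢; omega
    · rw [Int.card_Icc]; omega

/-- A site lost under the shift leaves the rectangle in its first or in its second coordinate, hence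
lies in one of two boundary strips. -/
lemma defect_region_le (p : ℕ × ℕ) (h : ℤ × ℤ) :
    defect (region 0 p) h ≤ h.1.natAbs * p.2 + p.1 * h.2.natAbs := by
  have e : defect (region 0 p) h =
      (((region 0 p).filter fun s => ¬ (s + h ∈ region 0 p)).card : ℝ) := by
    rw [defect, Finset.card_filter]
    push_cast
    refine Finset.sum_congr rfl fun s _ => ?_
    by_cases hs : s + h ∈ region 0 p <;> simp [hs]
  rw [e]
  have hsub : ((region 0 p).filter fun s => ¬ (s + h ∈ region 0 p)) ⊆
      (((Finset.Icc (1 : ℤ) p.1).filter fun r => ¬ (r + h.1 ∈ Finset.Icc (1 : ℤ) p.1)) ×ˢ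
        Finset.Icc (1 : ℤ) p.2) ∪
      (Finset.Icc (1 : ℤ) p.1 ×ˢ
        ((Finset.Icc (1 : ℤ) p.2).filter fun r => ¬ (r + h.2 ∈ Finset.Icc (1 : ℤ) p.2))) := by
    intro s hs
    simp only [region, Prod.fst_zero, Prod.snd_zero, zero_add, Finset.mem_filter,
      Finset.mem_product, Finset.mem_union, Prod.fst_add, Prod.snd_add] at hs ⊢
    tauto
  have h1 := (Finset.card_le_card hsub).trans (Finset.card_union_le _ _)
  rw [Finset.card_product, Finset.card_product] at h1
  have h2 := card_Icc_shift_le p.1 h.1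
  have h3 := card_Icc_shift_le p.2 h.2
  have h4 : (Finset.Icc (1 : ℤ) p.1).card = p.1 := by simp
  have h5 : (Finset.Icc (1 : ℤ) p.2).card = p.2 := by simp
  rw [h4, h5] at h1
  have := h1.trans (Nat.add_le_add (Nat.mul_le_mul_right _ h2) (Nat.mul_le_mul_left _ h3))
  exact_mod_cast this

variable {p : ℕ → ℕ × ℕ}

lemma tendsto_defect (hp : Tendsto p atTop atTop) (h : ℤ × ℤ) :
    Tendsto (fun m => defect (region 0 (p m)) h / size (p m)) atTop (𝓝 0) := by
  obtain ⟨h1, h2⟩ := tendsto_fst_snd hp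
  have hlim : Tendsto (fun m => (h.1.natAbs : ℝ) / (p m).1 + (h.2.natAbs : ℝ) / (p m).2)
      atTop (𝓝 0) := by
    simpa using (h1.const_div_atTop (h.1.natAbs : ℝ)).add (h2.const_div_atTop (h.2.natAbs : ℝ))
  refine squeeze_zero' (.of_forall fun m => div_nonneg (defect_nonneg _ _) (size_nonneg _)) ?_ hlim
  filter_upwards [eventually_pos hp] with m hm
  have a1 : (0 : ℝ) < (p m).1 := by exact_mod_cast hm.1
  have a2 : (0 : ℝ) < (p m).2 := by exact_mod_cast hm.2
  rw [div_le_iff₀ (size_pos hm)]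
  refine (defect_region_le _ _).trans (le_of_eq ?_)
  rw [size]; field_simp

lemma tendsto_overlap (hp : Tendsto p atTop atTop) (h : ℤ × ℤ) :
    Tendsto (fun m => overlap (region 0 (p m)) h / size (p m)) atTop (𝓝 1) := by
  have : Tendsto (fun m => 1 - defect (region 0 (p m)) h / size (p m)) atTop (𝓝 (1 - 0)) :=
    tendsto_const_nhds.sub (tendsto_defect hp h)
  rw [sub_zero] at this
  refine this.congr' ?_
  filter_upwards [eventually_pos hp] with m hm
  have := size_pos hm
  rw [eq_div_iff this.ne', sub_mul, div_mul_cancel₀ _ this.ne', ← card_region,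
    ← overlap_add_defect _ h]
  ring

lemma tendsto_overlap3 (hp : Tendsto p atTop atTop) (h : (ℤ × ℤ) × (ℤ × ℤ) × (ℤ × ℤ)) :
    Tendsto (fun m => overlap3 (region 0 (p m)) h / size (p m)) atTop (𝓝 1) := by
  have hl : Tendsto (fun m => 1 - (defect (region 0 (p m)) h.1 / size (p m) +
      defect (region 0 (p m)) h.2.1 / size (p m) + defect (region 0 (p m)) h.2.2 / size (p m)))
      atTop (𝓝 (1 - (0 + 0 + 0))) :=
    tendsto_const_nhds.sub (((tendsto_defect hp _).add (tendsto_defect hp _)).add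
      (tendsto_defect hp _))
  simp only [add_zero, sub_zero] at hl
  refine tendsto_of_tendsto_of_tendsto_of_le_of_le' hl tendsto_const_nhds ?_ ?_
  · filter_upwards [eventually_pos hp] with m hm
    have hs := size_pos hm
    rw [le_div_iff₀ hs, sub_mul, add_mul, add_mul, div_mul_cancel₀ _ hs.ne',
      div_mul_cancel₀ _ hs.ne', div_mul_cancel₀ _ hs.ne', one_mul, ← card_region]
    linarith [le_overlap3_add (region 0 (p m)) h]
  · filter_upwards [eventually_pos hp] with m hm
    rw [div_le_one (size_pos hm), ← card_region]
    exact overlap3_le _ _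

end Overlaps

/-! ### Limits and bounds of series over lags. -/

/-- Dominated convergence for series with summable coefficients. -/
lemma tendsto_tsum_mul {β : Type*} {c : β → ℝ} (hc : Summable c) {a : ℕ → β → ℝ} {B : ℝ}
    (hB : ∀ᶠ m in atTop, ∀ h, |a m h| ≤ B) {a' : β → ℝ}
    (ha : ∀ h, Tendsto (fun m => a m h) atTop (𝓝 (a' h))) :
    Tendsto (fun m => ∑' h, c h * a m h) atTop (𝓝 (∑' h, c h * a' h)) := by
  refine tendsto_tsum_of_dominated_convergence (bound := fun h => |c h| * B)
    (hc.abs.mul_right B) (fun h => (ha h).const_mul _) ?_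
  filter_upwards [hB] with m hm h
  rw [Real.norm_eq_abs, abs_mul]
  exact mul_le_mul_of_nonneg_left (hm h) (abs_nonneg _)

lemma abs_tsum_mul_le {β : Type*} {c : β → ℝ} (hc : Summable c) {a : β → ℝ} {B : ℝ}
    (hB : ∀ h, |a h| ≤ B) : |∑' h, c h * a h| ≤ (∑' h, |c h|) * B := by
  rw [← tsum_mul_right, ← Real.norm_eq_abs]
  refine tsum_of_norm_bounded (hc.abs.mul_right B).hasSum fun h => ?_
  rw [Real.norm_eq_abs, abs_mul]
  exact mul_le_mul_of_nonneg_left (hB h) (abs_nonneg _)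

/-! ### Spectral densities as real cosine series. -/

section Spectra

variable {Ω : Type*} [MeasurableSpace Ω] {P : Measure Ω} [IsProbabilityMeasure P]
  {Z : ℤ × ℤ → Ω → ℝ}

lemma re_exp_phase (c θ : ℝ) : ((c : ℂ) * Complex.exp (-Complex.I * (θ : ℂ))).re =
    c * Real.cos θ := by
  rw [show -Complex.I * (θ : ℂ) = ((-θ : ℝ) : ℂ) * Complex.I by push_cast; ring,
    Complex.re_ofReal_mul, Complex.exp_ofReal_mul_I_re, Real.cos_neg]

lemma summable_mul_exp {β : Type*} {c : β → ℝ} (hc : Summable c) (θ : β → ℝ) :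
    Summable fun h => (c h : ℂ) * Complex.exp (-Complex.I * (θ h : ℂ)) := by
  refine Summable.of_norm (hc.abs.congr fun h => ?_)
  rw [norm_mul, show -Complex.I * (θ h : ℂ) = ((-θ h : ℝ) : ℂ) * Complex.I by push_cast; ring,
    Complex.norm_exp_ofReal_mul_I, mul_one, Complex.norm_real, Real.norm_eq_abs]

lemma summable_mul_bdd {β : Type*} {c : β → ℝ} (hc : Summable c) {a : β → ℝ} {B : ℝ}
    (ha : ∀ h, |a h| ≤ B) : Summable fun h => c h * a h := by
  refine Summable.of_norm_bounded (hc.abs.mul_right B) fun h => ?_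
  rw [Real.norm_eq_abs, abs_mul]
  exact mul_le_mul_of_nonneg_left (ha h) (abs_nonneg _)

lemma two_pi_zpow_ofReal (n : ℤ) : ((2 * Real.pi : ℂ)) ^ n = (((2 * Real.pi) ^ n : ℝ) : ℂ) := by
  push_cast; rfl

lemma specDensity_eq (hγ : Summable (autocov P Z)) (ω : ℝ × ℝ) :
    specDensity P Z ω =
      (2 * Real.pi) ^ (-2 : ℤ) * ∑' h, autocov P Z h * Real.cos (phase h ω) := by
  rw [specDensity, two_pi_zpow_ofReal, Complex.re_ofReal_mul,
    Complex.re_tsum (summable_mul_exp hγ fun h => phase h ω)]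
  simp_rw [re_exp_phase]

lemma specDensity_neg (hγ : Summable (autocov P Z)) (ω : ℝ × ℝ) :
    specDensity P Z (-ω) = specDensity P Z ω := by
  have : ∀ h : ℤ × ℤ, phase h (-ω) = -phase h ω := fun h => by simp [phase]; ring
  simp_rw [specDensity_eq hγ, this, Real.cos_neg]

lemma continuous_phase (h : ℤ × ℤ) : Continuous fun ω => phase h ω := by
  unfold phase; fun_prop

lemma continuous_specDensity (hγ : Summable (autocov P Z)) : Continuous (specDensity P Z) := by
  have : specDensity P Z = fun ω =>
      (2 * Real.pi) ^ (-2 : ℤ) * ∑' h, autocov P Z h * Real.cos (phase h ω) :=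
    funext (specDensity_eq hγ)
  rw [this]
  refine continuous_const.mul (continuous_tsum (fun h => continuous_const.mul
    (Real.continuous_cos.comp (continuous_phase h))) hγ.abs fun h ω => ?_)
  rw [Real.norm_eq_abs, abs_mul]
  exact mul_le_of_le_one_right (abs_nonneg _) (Real.abs_cos_le_one _)

lemma specDensity_bounded (hγ : Summable (autocov P Z)) :
    ∃ F : ℝ, 0 ≤ F ∧ ∀ ω, |specDensity P Z ω| ≤ F := by
  refine ⟨(2 * Real.pi) ^ (-2 : ℤ) * ((∑' h, |autocov P Z h|) * 1), ?_, fun ω => ?_⟩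
  · have : 0 ≤ ∑' h, |autocov P Z h| := tsum_nonneg fun h => abs_nonneg _
    positivity
  · rw [specDensity_eq hγ, abs_mul, abs_of_pos (by positivity)]
    gcongr
    exact abs_tsum_mul_le hγ fun h => Real.abs_cos_le_one _

lemma FourthOrderStationary.tsum_sin (hZ : FourthOrderStationary P Z) (ω : ℝ × ℝ) :
    ∑' h, autocov P Z h * Real.sin (phase h ω) = 0 := by
  have h1 : ∑' h, autocov P Z h * Real.sin (phase h ω) =
      ∑' h, autocov P Z (-h) * Real.sin (phase (-h) ω) :=
    ((Equiv.neg (ℤ × ℤ)).tsum_eq fun h => autocov P Z h * Real.sin (phase h ω)).symm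
  simp_rw [hZ.autocov_neg, phase_neg, Real.sin_neg, mul_neg, tsum_neg] at h1
  linarith

lemma summable_autocov_mul (hγ : Summable (autocov P Z)) :
    Summable fun h : (ℤ × ℤ) × (ℤ × ℤ) => autocov P Z h.1 * autocov P Z h.2 :=
  summable_mul_of_summable_norm hγ.norm hγ.norm

/-- By the addition formula for `cos(a - b)` the double series is the square of the cosine series
plus the square of the sine series, and the latter vanishes because `γ` is even. -/
lemma FourthOrderStationary.tsum_autocov_mul_cos (hZ : FourthOrderStationary P Z)
    (hγ : Summable (autocov P Z)) (ω : ℝ × ℝ) :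
    ∑' h : (ℤ × ℤ) × (ℤ × ℤ), autocov P Z h.1 * autocov P Z h.2 *
      Real.cos (phase (h.1 - h.2) ω) = ((2 * Real.pi) ^ 2 * specDensity P Z ω) ^ 2 := by
  have hc : Summable fun h => autocov P Z h * Real.cos (phase h ω) :=
    summable_mul_bdd hγ fun h => Real.abs_cos_le_one _
  have hs : Summable fun h => autocov P Z h * Real.sin (phase h ω) :=
    summable_mul_bdd hγ fun h => Real.abs_sin_le_one _
  have ec := tsum_mul_tsum_of_summable_norm hc.norm hc.norm
  have es := tsum_mul_tsum_of_summable_norm hs.norm hs.norm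
  have sc := summable_mul_of_summable_norm hc.norm hc.norm
  have ss := summable_mul_of_summable_norm hs.norm hs.norm
  have hπ : ((2 * Real.pi) ^ 2 : ℝ) * (2 * Real.pi) ^ (-2 : ℤ) = 1 := by
    rw [zpow_neg, ← zpow_natCast (2 * Real.pi) 2]
    exact mul_inv_cancel₀ (by positivity)
  rw [specDensity_eq hγ, ← mul_assoc, hπ, one_mul, sq, ec]
  have : ∑' h : (ℤ × ℤ) × (ℤ × ℤ), autocov P Z h.1 * autocov P Z h.2 *
      Real.cos (phase (h.1 - h.2) ω) = (∑' h : (ℤ × ℤ) × (ℤ × ℤ),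
        autocov P Z h.1 * Real.cos (phase h.1 ω) * (autocov P Z h.2 * Real.cos (phase h.2 ω))) +
      ∑' h : (ℤ × ℤ) × (ℤ × ℤ),
        autocov P Z h.1 * Real.sin (phase h.1 ω) * (autocov P Z h.2 * Real.sin (phase h.2 ω)) := by
    rw [← sc.tsum_add ss]
    refine tsum_congr fun h => ?_
    rw [phase_sub, Real.cos_sub]; ring
  rw [this, ← es, hZ.tsum_sin ω, mul_zero, add_zero]

lemma lagCum4_swap (h₁ h₂ h₃ : ℤ × ℤ) :
    lagCum4 P Z (h₁, h₂, h₃) = lagCum4 P Z (h₁, h₃, h₂) := by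
  simp only [lagCum4, cum4]
  rw [covariance_comm (Z h₂) (Z h₃)]
  have : ∀ x, (Z 0 x - ∫ y, Z 0 y ∂P) * (Z h₁ x - ∫ y, Z h₁ y ∂P) * (Z h₂ x - ∫ y, Z h₂ y ∂P) *
      (Z h₃ x - ∫ y, Z h₃ y ∂P) = (Z 0 x - ∫ y, Z 0 y ∂P) * (Z h₁ x - ∫ y, Z h₁ y ∂P) *
      (Z h₃ x - ∫ y, Z h₃ y ∂P) * (Z h₂ x - ∫ y, Z h₂ y ∂P) := fun x => by ring
  simp_rw [this]
  ring

/-- The sine-sine term of the addition formula changes sign when the last two lags are exchanged,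
while the cumulant is symmetric in them. What remains factors into a function of `ω₁` and a function
of `ω₂`. -/
lemma re_cumSpecDensity (hκ : Summable (lagCum4 P Z)) (ω₁ ω₂ : ℝ × ℝ) :
    (cumSpecDensity P Z ω₁ ω₂ (-ω₂)).re = (2 * Real.pi) ^ (-6 : ℤ) *
      ∑' h : (ℤ × ℤ) × (ℤ × ℤ) × (ℤ × ℤ), lagCum4 P Z h *
        (Real.cos (phase h.1 ω₁) * Real.cos (phase (h.2.1 - h.2.2) ω₂)) := by
  have hph : ∀ h : (ℤ × ℤ) × (ℤ × ℤ) × (ℤ × ℤ), ((phase h.1 ω₁ : ℂ) + (phase h.2.1 ω₂ : ℂ) +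
      (phase h.2.2 (-ω₂) : ℂ)) = ((phase h.1 ω₁ + phase (h.2.1 - h.2.2) ω₂ : ℝ) : ℂ) := by
    intro h
    simp [phase]; ring
  rw [cumSpecDensity, two_pi_zpow_ofReal, Complex.re_ofReal_mul]
  simp_rw [hph]
  rw [Complex.re_tsum (summable_mul_exp hκ _)]
  simp_rw [re_exp_phase]
  have bc : ∀ a b : ℝ, |Real.cos a * Real.cos b| ≤ 1 := fun a b => by
    rw [abs_mul]; exact mul_le_one₀ (Real.abs_cos_le_one _) (abs_nonneg _) (Real.abs_cos_le_one _)
  have bs : ∀ a b : ℝ, |Real.sin a * Real.sin b| ≤ 1 := fun a b => by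
    rw [abs_mul]; exact mul_le_one₀ (Real.abs_sin_le_one _) (abs_nonneg _) (Real.abs_sin_le_one _)
  have sc := summable_mul_bdd hκ
    fun h => bc (phase h.1 ω₁) (phase (h.2.1 - h.2.2) ω₂)
  have ss := summable_mul_bdd hκ
    fun h => bs (phase h.1 ω₁) (phase (h.2.1 - h.2.2) ω₂)
  simp_rw [Real.cos_add, mul_sub]
  rw [sc.tsum_sub ss]
  have hz : ∑' h : (ℤ × ℤ) × (ℤ × ℤ) × (ℤ × ℤ), lagCum4 P Z h *
      (Real.sin (phase h.1 ω₁) * Real.sin (phase (h.2.1 - h.2.2) ω₂)) = 0 := by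
    set S := ∑' h : (ℤ × ℤ) × (ℤ × ℤ) × (ℤ × ℤ), lagCum4 P Z h *
      (Real.sin (phase h.1 ω₁) * Real.sin (phase (h.2.1 - h.2.2) ω₂)) with hS
    have h1 : S = -S := by
      conv_lhs => rw [hS, ← ((Equiv.refl (ℤ × ℤ)).prodCongr
        (Equiv.prodComm (ℤ × ℤ) (ℤ × ℤ))).tsum_eq]
      rw [hS, ← tsum_neg]
      refine tsum_congr fun h => ?_
      simp only [Equiv.prodCongr_apply, Equiv.coe_refl, Equiv.coe_prodComm, Prod.map, id,
        Prod.fst_swap, Prod.snd_swap]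
      rw [← lagCum4_swap, ← neg_sub h.2.1 h.2.2, phase_neg, Real.sin_neg]
      simp
    linarith
  rw [hz, sub_zero]

end Spectra

/-! ### Second moments of single periodogram ordinates. -/

section SecondMoments

variable {Ω : Type*} [MeasurableSpace Ω] {P : Measure Ω} [IsProbabilityMeasure P]
  {Z : ℤ × ℤ → Ω → ℝ}

/-- The mean of a quadratic form. -/
def meanPart (P : Measure Ω) (Z : ℤ × ℤ → Ω → ℝ) (D : Finset (ℤ × ℤ)) (A : ℤ × ℤ → ℝ) : ℝ :=
  ∑' h, autocov P Z h * (A h * overlap D h)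

lemma FourthOrderStationary.integral_quadForm_translate (hZ : FourthOrderStationary P Z)
    (k : ℤ × ℤ) (D : Finset (ℤ × ℤ)) {A : ℤ × ℤ → ℝ} (hA : ∀ h, A (-h) = A h) :
    ∫ x, quadForm D A (centred P fun s => Z (s + k)) x ∂P = meanPart P Z D A := by
  rw [← ((hZ.translate k).hasSum_integral_quadForm D hA).tsum_eq, hZ.autocov_translate, meanPart]
  simp_rw [mul_assoc]

lemma FourthOrderStationary.integral_quadForm_sq_translate (hZ : FourthOrderStationary P Z)
    (k : ℤ × ℤ) (D : Finset (ℤ × ℤ)) {A : ℤ × ℤ → ℝ} (hA : ∀ h, A (-h) = A h) :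
    ∫ x, quadForm D A (centred P fun s => Z (s + k)) x ^ 2 ∂P =
      meanPart P Z D A ^ 2 + cumPart P Z D A + 2 * covPart P Z D A := by
  rw [(hZ.translate k).integral_quadForm_sq D hA, hZ.integral_quadForm_translate k D hA]
  simp only [cumPart, covPart, hZ.autocov_translate, hZ.lagCum4_translate]

lemma abs_pairCoeff_le {D : Finset (ℤ × ℤ)} {A : ℤ × ℤ → ℝ} (hA : ∀ h, |A h| ≤ 1)
    (h : (ℤ × ℤ) × (ℤ × ℤ)) : |pairCoeff D A h| ≤ (D.card : ℝ) ^ 2 := by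
  refine (Finset.abs_sum_le_sum_abs _ _).trans ?_
  refine (Finset.sum_le_card_nsmul _ _ 1 fun p _ => ?_).trans (le_of_eq ?_)
  · split_ifs
    · rw [abs_mul]; exact mul_le_one₀ (hA _) (abs_nonneg _) (hA _)
    · simp
  · simp [Finset.card_product, sq]

lemma cos_phase_neg (ω : ℝ × ℝ) (h : ℤ × ℤ) :
    Real.cos (phase (-h) ω) = Real.cos (phase h ω) := by
  rw [phase_neg, Real.cos_neg]

lemma FourthOrderStationary.memLp_periodogram (hZ : FourthOrderStationary P Z) (k : ℤ × ℤ)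
    {p : ℕ × ℕ} {j : ℤ × ℤ} (hj : j ∈ grid p) : MemLp (periodogram Z k p (freq p j)) 2 P := by
  have : periodogram Z k p (freq p j) = fun x => (2 * Real.pi) ^ (-2 : ℤ) * (size p)⁻¹ *
      quadForm (region 0 p) (fun h => Real.cos (phase h (freq p j)))
        (centred P fun s => Z (s + k)) x := funext fun x => hZ.periodogram_eq k hj x
  rw [this]
  exact ((hZ.translate k).memLp_quadForm _ _).const_mul _

lemma FourthOrderStationary.integral_periodogram_sq (hZ : FourthOrderStationary P Z) (k : ℤ × ℤ)
    {p : ℕ × ℕ} {j : ℤ × ℤ} (hj : j ∈ grid p) :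
    ∫ x, periodogram Z k p (freq p j) x ^ 2 ∂P = ((2 * Real.pi) ^ (-2 : ℤ) * (size p)⁻¹) ^ 2 *
      (meanPart P Z (region 0 p) (fun h => Real.cos (phase h (freq p j))) ^ 2 +
        cumPart P Z (region 0 p) (fun h => Real.cos (phase h (freq p j))) +
        2 * covPart P Z (region 0 p) (fun h => Real.cos (phase h (freq p j)))) := by
  simp_rw [hZ.periodogram_eq k hj, mul_pow _ (quadForm _ _ _ _), integral_const_mul]
  rw [hZ.integral_quadForm_sq_translate k _ (cos_phase_neg _)]

section Bounds

variable {A : ℤ × ℤ → ℝ} (hA : ∀ h, |A h| ≤ 1) (D : Finset (ℤ × ℤ))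
include hA

lemma abs_meanPart_le (hγ : Summable (autocov P Z)) :
    |meanPart P Z D A| ≤ (∑' h, |autocov P Z h|) * D.card := by
  refine abs_tsum_mul_le hγ fun h => ?_
  rw [abs_mul, abs_of_nonneg (overlap_nonneg D h)]
  exact (mul_le_of_le_one_left (overlap_nonneg D h) (hA h)).trans (overlap_le D h)

/-- The cumulant part is linear in the number of sites, whereas the squared mean and the covariance
part may be quadratic; so cumulants drop out of the limiting second moment of an ordinate. -/
lemma abs_cumPart_le (hκ : Summable (lagCum4 P Z)) :
    |cumPart P Z D A| ≤ (∑' h, |lagCum4 P Z h|) * D.card := by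
  refine abs_tsum_mul_le hκ fun h => ?_
  rw [abs_mul, abs_of_nonneg (overlap3_nonneg D h), abs_mul]
  exact (mul_le_of_le_one_left (overlap3_nonneg D h)
    (mul_le_one₀ (hA _) (abs_nonneg _) (hA _))).trans (overlap3_le D h)

lemma abs_covPart_le (hγ : Summable (autocov P Z)) :
    |covPart P Z D A| ≤ (∑' h : (ℤ × ℤ) × (ℤ × ℤ), |autocov P Z h.1 * autocov P Z h.2|) *
      (D.card : ℝ) ^ 2 :=
  abs_tsum_mul_le (summable_autocov_mul hγ) fun h => abs_pairCoeff_le hA h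

end Bounds

/-- The second moments of the periodogram ordinates are uniformly bounded. -/
lemma FourthOrderStationary.exists_periodogram_bound (hZ : FourthOrderStationary P Z)
    (hγ : Summable (autocov P Z)) (hκ : Summable (lagCum4 P Z)) :
    ∃ C : ℝ, ∀ p : ℕ × ℕ, 0 < p.1 ∧ 0 < p.2 → ∀ j ∈ grid p, ∀ k,
      ∫ x, periodogram Z k p (freq p j) x ^ 2 ∂P ≤ C := by
  set Γ := ∑' h, |autocov P Z h|
  set K := ∑' h, |lagCum4 P Z h|
  set Γ₂ := ∑' h : (ℤ × ℤ) × (ℤ × ℤ), |autocov P Z h.1 * autocov P Z h.2|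
  have hK : 0 ≤ K := tsum_nonneg fun _ => abs_nonneg _
  refine ⟨((2 * Real.pi) ^ (-2 : ℤ)) ^ 2 * (Γ ^ 2 + K + 2 * Γ₂), fun p hp j hj k => ?_⟩
  have hs := size_pos hp
  have hs1 := one_le_size hp
  rw [hZ.integral_periodogram_sq k hj, mul_pow, mul_assoc]
  have hA : ∀ h, |Real.cos (phase h (freq p j))| ≤ 1 := fun h => Real.abs_cos_le_one _
  have h1 := abs_meanPart_le (P := P) (Z := Z) hA (region 0 p) hγ
  have h2 := (le_abs_self _).trans (abs_cumPart_le (P := P) (Z := Z) hA (region 0 p) hκ)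
  have h3 := (le_abs_self _).trans (abs_covPart_le (P := P) (Z := Z) hA (region 0 p) hγ)
  rw [card_region] at h1 h2 h3
  have h1' := sq_le_sq' (abs_le.1 h1).1 (abs_le.1 h1).2
  gcongr
  rw [inv_pow, inv_mul_le_iff₀ (by positivity)]
  -- The rectangle has at least one site, so a linear bound is also a quadratic one.
  have h2' : K * size p ≤ K * size p ^ 2 := mul_le_mul_of_nonneg_left (by nlinarith) hK
  nlinarith

variable {p : ℕ → ℕ × ℕ} {r : ℕ → ℤ × ℤ} {ω : ℝ × ℝ}

/-- For each fixed lag the proportion of sites that remain in the rectangle tends to one, and the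
cosine converges by continuity. -/
lemma tendsto_meanPart (hγ : Summable (autocov P Z)) (hp : Tendsto p atTop atTop)
    (hω : Tendsto (fun m => freq (p m) (r m)) atTop (𝓝 ω)) :
    Tendsto (fun m => (size (p m))⁻¹ * meanPart P Z (region 0 (p m))
      (fun h => Real.cos (phase h (freq (p m) (r m))))) atTop
      (𝓝 ((2 * Real.pi) ^ 2 * specDensity P Z ω)) := by
  have hπ : ((2 * Real.pi) ^ 2 : ℝ) * (2 * Real.pi) ^ (-2 : ℤ) = 1 := by
    rw [zpow_neg, ← zpow_natCast (2 * Real.pi) 2]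
    exact mul_inv_cancel₀ (by positivity)
  rw [specDensity_eq hγ, ← mul_assoc, hπ, one_mul]
  have key := tendsto_tsum_mul hγ (B := 1) (a := fun m h =>
    Real.cos (phase h (freq (p m) (r m))) * (overlap (region 0 (p m)) h / size (p m)))
    (a' := fun h => Real.cos (phase h ω)) ?_ ?_
  · refine key.congr fun m => ?_
    rw [meanPart, ← tsum_mul_left]
    refine tsum_congr fun h => by ring
  · filter_upwards [eventually_pos hp] with m hm h
    rw [abs_mul]
    refine mul_le_one₀ (Real.abs_cos_le_one _) (abs_nonneg _) ?_
    rw [abs_of_nonneg (div_nonneg (overlap_nonneg _ _) (size_nonneg _)),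
      div_le_one (size_pos hm), ← card_region]
    exact overlap_le _ _
  · intro h
    have h1 : Tendsto (fun m => Real.cos (phase h (freq (p m) (r m)))) atTop
        (𝓝 (Real.cos (phase h ω))) :=
      ((Real.continuous_cos.comp (continuous_phase h)).tendsto ω).comp hω
    simpa using h1.mul (tendsto_overlap hp h)

lemma freq_two_mul (p : ℕ × ℕ) (j s : ℤ × ℤ) :
    phase s (freq p (2 * j.1, 2 * j.2)) = 2 * phase s (freq p j) := by
  simp [phase, freq]; ring

/-- The oscillating part of the pair coefficient is negligible. -/
lemma pairCoeff_cos_sub_le {q : ℕ × ℕ} {j : ℤ × ℤ}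
    (hj : ¬ ((q.1 : ℤ) ∣ 2 * j.1 ∧ (q.2 : ℤ) ∣ 2 * j.2)) (h : (ℤ × ℤ) × (ℤ × ℤ)) :
    |2 * pairCoeff (region 0 q) (fun h => Real.cos (phase h (freq q j))) h -
      Real.cos (phase (h.1 - h.2) (freq q j)) *
        (overlap (region 0 q) h.1 * overlap (region 0 q) h.2)| ≤
      size q * defect (region 0 q) h.1 := by
  set D := region 0 q
  set θ := freq q j
  -- In the product-to-sum formula the difference of the two angles does not involve the sites and
  -- gives the main term; their sum oscillates in `u` at the doubled frequency.
  have e : 2 * pairCoeff D (fun h => Real.cos (phase h θ)) h -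
      Real.cos (phase (h.1 - h.2) θ) * (overlap D h.1 * overlap D h.2) =
      ∑ v ∈ D, if v + h.2 ∈ D then ∑ u ∈ D, (if u + h.1 ∈ D then
        Real.cos (phase u (freq q (2 * j.1, 2 * j.2)) +
          (phase (h.1 - h.2) θ - 2 * phase v θ)) else 0) else 0 := by
    rw [pairCoeff, overlap, overlap, Finset.sum_mul_sum, ← Finset.sum_product', Finset.mul_sum,
      Finset.mul_sum, ← Finset.sum_sub_distrib, Finset.sum_product_right]
    refine Finset.sum_congr rfl fun v _ => ?_
    by_cases hv : v + h.2 ∈ D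
    · rw [if_pos hv]
      refine Finset.sum_congr rfl fun u _ => ?_
      by_cases hu : u + h.1 ∈ D
      · rw [if_pos (by simp [hu, hv]), if_pos hu, if_pos hv, if_pos hu, freq_two_mul,
          ← mul_assoc, Real.two_mul_cos_mul_cos]
        simp only [phase_sub, phase_add]
        rw [← Real.cos_neg (phase u θ - phase v θ - _)]
        have e1 : -(phase u θ - phase v θ - (phase u θ - phase v θ + (phase h.1 θ - phase h.2 θ))) =
          phase h.1 θ - phase h.2 θ := by ring
        have e2 : phase u θ - phase v θ + (phase u θ - phase v θ + (phase h.1 θ - phase h.2 θ)) =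
          2 * phase u θ + (phase h.1 θ - phase h.2 θ - 2 * phase v θ) := by ring
        rw [e1, e2]
        ring
      · simp [hu]
    · simp [hv]
  rw [e]
  refine (Finset.abs_sum_le_sum_abs _ _).trans ?_
  rw [← card_region, ← nsmul_eq_mul]
  refine Finset.sum_le_card_nsmul _ _ _ fun v _ => ?_
  split_ifs
  · set a := phase (h.1 - h.2) θ - 2 * phase v θ
    have hz : ∑ u ∈ D, Real.cos (phase u (freq q (2 * j.1, 2 * j.2)) + a) = 0 := by
      rw [sum_region_cos, if_neg hj]
    -- Over the whole rectangle the oscillation sums to zero, so the restricted sum is minus the sum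
    -- over the lost sites, of which there are `defect D h.1`.
    have : ∑ u ∈ D, (if u + h.1 ∈ D then
        Real.cos (phase u (freq q (2 * j.1, 2 * j.2)) + a) else 0) =
        -∑ u ∈ D, (if u + h.1 ∈ D then 0 else
          Real.cos (phase u (freq q (2 * j.1, 2 * j.2)) + a)) := by
      rw [eq_neg_iff_add_eq_zero, ← Finset.sum_add_distrib]
      refine Eq.trans ?_ hz
      refine Finset.sum_congr rfl fun u _ => ?_
      split_ifs <;> simp
    rw [this, abs_neg, defect]
    refine (Finset.abs_sum_le_sum_abs _ _).trans (Finset.sum_le_sum fun u _ => ?_)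
    split_ifs
    · simp
    · exact Real.abs_cos_le_one _
  · simpa using defect_nonneg D h.1

/-- Twice the pair coefficient is asymptotic to `cos((h₁ - h₂)ᵀω)` times the square of the size. The
series with that cosine is the squared spectral density, up to the power of `2π`. -/
lemma FourthOrderStationary.tendsto_covPart_cos (hZ : FourthOrderStationary P Z)
    (hγ : Summable (autocov P Z)) (hp : Tendsto p atTop atTop)
    (hr : ∀ᶠ m in atTop, (r m).1 ≠ 0 ∧ 2 * |(r m).1| < (p m).1)
    (hω : Tendsto (fun m => freq (p m) (r m)) atTop (𝓝 ω)) :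
    Tendsto (fun m => ((size (p m))⁻¹) ^ 2 * (2 * covPart P Z (region 0 (p m))
      (fun h => Real.cos (phase h (freq (p m) (r m)))))) atTop
      (𝓝 (((2 * Real.pi) ^ 2 * specDensity P Z ω) ^ 2)) := by
  rw [← hZ.tsum_autocov_mul_cos hγ]
  have key := tendsto_tsum_mul (summable_autocov_mul hγ) (B := 2) (a := fun m h =>
    2 * pairCoeff (region 0 (p m)) (fun h => Real.cos (phase h (freq (p m) (r m)))) h /
      size (p m) ^ 2) (a' := fun h => Real.cos (phase (h.1 - h.2) ω)) ?_ ?_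
  · refine key.congr fun m => ?_
    rw [covPart, ← tsum_mul_left, ← tsum_mul_left]
    refine tsum_congr fun h => by ring
  · filter_upwards [eventually_pos hp] with m hm h
    have hs := size_pos hm
    rw [abs_div, abs_mul, abs_two, abs_of_pos (pow_pos hs 2), div_le_iff₀ (pow_pos hs 2)]
    have := abs_pairCoeff_le (D := region 0 (p m))
      (A := fun h => Real.cos (phase h (freq (p m) (r m)))) (fun h => Real.abs_cos_le_one _) h
    rw [card_region] at this
    linarith
  · intro h
    have h1 : Tendsto (fun m => Real.cos (phase (h.1 - h.2) (freq (p m) (r m)))) atTop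
        (𝓝 (Real.cos (phase (h.1 - h.2) ω))) :=
      ((Real.continuous_cos.comp (continuous_phase (h.1 - h.2))).tendsto ω).comp hω
    have h2 := h1.mul ((tendsto_overlap hp h.1).mul (tendsto_overlap hp h.2))
    rw [mul_one, mul_one] at h2
    refine tendsto_of_tendsto_of_dist h2 (squeeze_zero' (.of_forall fun _ => dist_nonneg) ?_
      (tendsto_defect hp h.1))
    filter_upwards [eventually_pos hp, hr] with m hm hrm
    have hs := size_pos hm
    -- The first coordinate suffices: `2 r₁` is nonzero and smaller than `p₁` in absolute value.
    have hd : ¬ (((p m).1 : ℤ) ∣ 2 * (r m).1 ∧ ((p m).2 : ℤ) ∣ 2 * (r m).2) := by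
      rintro ⟨hd, -⟩
      have h0 : 2 * (r m).1 ≠ 0 := by simpa using hrm.1
      have := Int.le_of_dvd (abs_pos.2 h0) ((dvd_abs _ _).2 hd)
      rw [abs_mul, abs_two] at this
      omega
    have h3 := pairCoeff_cos_sub_le hd h
    rw [dist_comm, Real.dist_eq, le_div_iff₀ hs]
    have e : 2 * pairCoeff (region 0 (p m)) (fun h => Real.cos (phase h (freq (p m) (r m)))) h /
        size (p m) ^ 2 - Real.cos (phase (h.1 - h.2) (freq (p m) (r m))) *
          (overlap (region 0 (p m)) h.1 / size (p m) * (overlap (region 0 (p m)) h.2 / size (p m)))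
        = (2 * pairCoeff (region 0 (p m)) (fun h => Real.cos (phase h (freq (p m) (r m)))) h -
          Real.cos (phase (h.1 - h.2) (freq (p m) (r m))) *
          (overlap (region 0 (p m)) h.1 * overlap (region 0 (p m)) h.2)) / size (p m) ^ 2 := by
      field_simp
    rw [e, abs_div, abs_of_pos (pow_pos hs 2), div_mul_eq_mul_div, div_le_iff₀ (pow_pos hs 2)]
    nlinarith

/-- The second moment of a periodogram ordinate converges to `2 f²`. -/
lemma FourthOrderStationary.tendsto_integral_periodogram_sq (hZ : FourthOrderStationary P Z)
    (hγ : Summable (autocov P Z)) (hκ : Summable (lagCum4 P Z)) (hp : Tendsto p atTop atTop)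
    (hg : ∀ᶠ m in atTop, r m ∈ grid (p m))
    (hr : ∀ᶠ m in atTop, (r m).1 ≠ 0 ∧ 2 * |(r m).1| < (p m).1)
    (hω : Tendsto (fun m => freq (p m) (r m)) atTop (𝓝 ω)) :
    Tendsto (fun m => ∫ x, periodogram Z 0 (p m) (freq (p m) (r m)) x ^ 2 ∂P) atTop
      (𝓝 (2 * specDensity P Z ω ^ 2)) := by
  have h1 := (tendsto_meanPart hγ hp hω).pow 2
  have h3 := hZ.tendsto_covPart_cos hγ hp hr hω
  -- The squared mean and the covariance part contribute `f²` each; the cumulant part is of order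
  -- the inverse size.
  have h2 : Tendsto (fun m => ((size (p m))⁻¹) ^ 2 * cumPart P Z (region 0 (p m))
      (fun h => Real.cos (phase h (freq (p m) (r m))))) atTop (𝓝 0) := by
    have hlim : Tendsto (fun m => (∑' h, |lagCum4 P Z h|) * (size (p m))⁻¹) atTop (𝓝 0) := by
      simpa using (tendsto_inv_atTop_zero.comp (tendsto_size hp)).const_mul
        (∑' h, |lagCum4 P Z h|)
    refine squeeze_zero_norm' ?_ hlim
    filter_upwards [eventually_pos hp] with m hm
    have hs := size_pos hm
    have := abs_cumPart_le (P := P) (Z := Z)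
      (A := fun h => Real.cos (phase h (freq (p m) (r m)))) (fun h => Real.abs_cos_le_one _)
      (region 0 (p m)) hκ
    rw [card_region] at this
    rw [Real.norm_eq_abs, abs_mul, abs_of_pos (by positivity)]
    calc _ ≤ ((size (p m))⁻¹) ^ 2 * ((∑' h, |lagCum4 P Z h|) * size (p m)) := by gcongr
      _ = _ := by field_simp
  have hsum := ((h1.add h2).add h3).const_mul (((2 * Real.pi) ^ (-2 : ℤ)) ^ 2)
  have hπ : ((2 * Real.pi) ^ 2 : ℝ) * (2 * Real.pi) ^ (-2 : ℤ) = 1 := by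
    rw [zpow_neg, ← zpow_natCast (2 * Real.pi) 2]
    exact mul_inv_cancel₀ (by positivity)
  have e : ((2 * Real.pi) ^ (-2 : ℤ)) ^ 2 * (((2 * Real.pi) ^ 2 * specDensity P Z ω) ^ 2 + 0 +
      ((2 * Real.pi) ^ 2 * specDensity P Z ω) ^ 2) = 2 * specDensity P Z ω ^ 2 := by
    calc _ = 2 * (((2 * Real.pi) ^ 2 : ℝ) * (2 * Real.pi) ^ (-2 : ℤ)) ^ 2 *
        specDensity P Z ω ^ 2 := by ring
      _ = _ := by rw [hπ]; ring
  rw [e] at hsum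
  refine hsum.congr' ?_
  filter_upwards [hg] with m hm
  rw [hZ.integral_periodogram_sq 0 hm]
  ring

lemma FourthOrderStationary.integral_periodogram_sq_translate (hZ : FourthOrderStationary P Z)
    (k : ℤ × ℤ) {p : ℕ × ℕ} {j : ℤ × ℤ} (hj : j ∈ grid p) :
    ∫ x, periodogram Z k p (freq p j) x ^ 2 ∂P =
      ∫ x, periodogram Z 0 p (freq p j) x ^ 2 ∂P := by
  rw [hZ.integral_periodogram_sq k hj, hZ.integral_periodogram_sq 0 hj]

end SecondMoments

/-! ### The autocorrelation of the smoothing kernel. -/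

section Kernel

variable {ψ : ℝ × ℝ → ℝ} {p : ℕ × ℕ}

/-- The sum of `ψ` over the grid points congruent to `j`. -/
def congrSum (ψ : ℝ × ℝ → ℝ) (p : ℕ × ℕ) (j : ℤ × ℤ) : ℝ :=
  ∑ l ∈ grid p, if (p.1 : ℤ) ∣ (j - l).1 ∧ (p.2 : ℤ) ∣ (j - l).2 then ψ (freq p l) else 0

/-- The autocorrelation of the smoothing kernel over one period. -/
def kernelCorr (ψ : ℝ × ℝ → ℝ) (p : ℕ × ℕ) (a : ℤ × ℤ) : ℝ :=
  (size p)⁻¹ * ∑ j ∈ grid p, ψ (freq p j) * Real.cos (phase a (freq p j)) *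
    ((congrSum ψ p j + congrSum ψ p (-j)) / 2)

lemma freq_sub (p : ℕ × ℕ) (j l : ℤ × ℤ) : freq p (j - l) = freq p j - freq p l := by
  simp only [freq, Prod.fst_sub, Prod.snd_sub, Int.cast_sub, Prod.mk_sub_mk]
  congr 1 <;> ring

lemma phase_sub_right (a : ℤ × ℤ) (ω ω' : ℝ × ℝ) :
    phase a (ω - ω') = phase a ω - phase a ω' := by
  simp [phase]; ring

lemma phase_neg_right (a : ℤ × ℤ) (ω : ℝ × ℝ) : phase a (-ω) = -phase a ω := by
  simp [phase]; ring

lemma exists_phase_freq_eq (hp : 0 < p.1 ∧ 0 < p.2) (a : ℤ × ℤ) {d : ℤ × ℤ}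
    (hd : (p.1 : ℤ) ∣ d.1 ∧ (p.2 : ℤ) ∣ d.2) :
    ∃ n : ℤ, phase a (freq p d) = n * (2 * Real.pi) := by
  obtain ⟨⟨c₁, h₁⟩, ⟨c₂, h₂⟩⟩ := hd
  have a1 : (p.1 : ℝ) ≠ 0 := by exact_mod_cast hp.1.ne'
  have a2 : (p.2 : ℝ) ≠ 0 := by exact_mod_cast hp.2.ne'
  refine ⟨a.1 * c₁ + a.2 * c₂, ?_⟩
  simp only [phase, freq, h₁, h₂]
  push_cast
  field_simp

/-- After the product-to-sum formula, orthogonality keeps only `l` congruent to `j` or `-j`. For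
these the phase at `l` equals plus or minus the phase at `j` modulo `2π`, so the shifts enter only
through `a - a'`. -/
lemma sum_region_cos_mul_cos (hp : 0 < p.1 ∧ 0 < p.2) (a a' j l : ℤ × ℤ) :
    ∑ u ∈ region 0 p, Real.cos (phase (u + a) (freq p j)) * Real.cos (phase (u + a') (freq p l)) =
      size p * Real.cos (phase (a - a') (freq p j)) *
        ((if (p.1 : ℤ) ∣ (j - l).1 ∧ (p.2 : ℤ) ∣ (j - l).2 then 1 / 2 else 0) +
          if (p.1 : ℤ) ∣ (-j - l).1 ∧ (p.2 : ℤ) ∣ (-j - l).2 then 1 / 2 else 0) := by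
  have e : ∀ u : ℤ × ℤ,
      Real.cos (phase (u + a) (freq p j)) * Real.cos (phase (u + a') (freq p l)) =
      1 / 2 * Real.cos (phase u (freq p (j - l)) + (phase a (freq p j) - phase a' (freq p l))) +
      1 / 2 * Real.cos (phase u (freq p (-j - l)) +
        (-phase a (freq p j) - phase a' (freq p l))) := by
    intro u
    rw [← mul_add, freq_sub, freq_sub, freq_neg, phase_sub_right, phase_sub_right, phase_neg_right,
      ← Real.cos_neg (-phase u (freq p j) - _ + _)]
    have := Real.two_mul_cos_mul_cos (phase (u + a) (freq p j)) (phase (u + a') (freq p l))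
    rw [phase_add, phase_add] at this ⊢
    have e1 : phase u (freq p j) + phase a (freq p j) - (phase u (freq p l) + phase a' (freq p l))
      = phase u (freq p j) - phase u (freq p l) + (phase a (freq p j) - phase a' (freq p l)) := by
      ring
    have e2 : phase u (freq p j) + phase a (freq p j) + (phase u (freq p l) + phase a' (freq p l))
      = -(-phase u (freq p j) - phase u (freq p l) +
        (-phase a (freq p j) - phase a' (freq p l))) := by ring
    rw [e1, e2] at this
    linarith
  simp_rw [e]
  rw [Finset.sum_add_distrib, ← Finset.mul_sum, ← Finset.mul_sum, sum_region_cos, sum_region_cos,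
    mul_add]
  congr 1
  · split_ifs with hd
    · obtain ⟨n, hn⟩ := exists_phase_freq_eq hp a' hd
      rw [freq_sub, phase_sub_right] at hn
      have : Real.cos (phase a (freq p j) - phase a' (freq p l)) =
          Real.cos (phase (a - a') (freq p j)) := by
        rw [phase_sub, ← Real.cos_add_int_mul_two_pi (phase a (freq p j) - phase a' (freq p j)) n]
        congr 1; linarith
      rw [this]; ring
    · simp
  · split_ifs with hd
    · obtain ⟨n, hn⟩ := exists_phase_freq_eq hp a' hd
      rw [freq_sub, phase_sub_right, freq_neg, phase_neg_right] at hn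
      have : Real.cos (-phase a (freq p j) - phase a' (freq p l)) =
          Real.cos (phase (a - a') (freq p j)) := by
        rw [phase_sub, ← Real.cos_neg (phase a (freq p j) - phase a' (freq p j)),
          ← Real.cos_add_int_mul_two_pi (-(phase a (freq p j) - phase a' (freq p j))) n]
        congr 1; linarith
      rw [this]; ring
    · simp

/-- A discrete Parseval identity: the kernel is a finite Fourier sum and `region 0 p` is one full
period, so the correlation is exact and depends only on the difference of the shifts. -/
lemma sum_kernel_mul_kernel (hp : 0 < p.1 ∧ 0 < p.2) (a a' : ℤ × ℤ) :
    ∑ u ∈ region 0 p, kernel ψ p (u + a) * kernel ψ p (u + a') = kernelCorr ψ p (a - a') := by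
  have hs := size_pos hp
  have e : ∀ u, kernel ψ p (u + a) * kernel ψ p (u + a') = ∑ j ∈ grid p, ∑ l ∈ grid p,
      (size p)⁻¹ * (size p)⁻¹ * (ψ (freq p j) * ψ (freq p l)) *
      (Real.cos (phase (u + a) (freq p j)) * Real.cos (phase (u + a') (freq p l))) := by
    intro u
    rw [kernel, kernel, mul_mul_mul_comm, Finset.sum_mul_sum, Finset.mul_sum]
    refine Finset.sum_congr rfl fun j _ => ?_
    rw [Finset.mul_sum]
    refine Finset.sum_congr rfl fun l _ => by ring
  simp_rw [e]
  rw [Finset.sum_comm, kernelCorr, Finset.mul_sum]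
  refine Finset.sum_congr rfl fun j _ => ?_
  rw [Finset.sum_comm]
  simp_rw [← Finset.mul_sum, sum_region_cos_mul_cos hp]
  simp only [congrSum, add_div, Finset.sum_div, mul_add]
  rw [Finset.mul_sum, Finset.mul_sum, Finset.mul_sum, Finset.mul_sum, ← Finset.sum_add_distrib]
  refine Finset.sum_congr rfl fun l _ => ?_
  congr 1 <;> split_ifs <;> field_simp <;> ring

/-- Each coordinate takes `2⌊q/2⌋ + 1` values, at most `2q` once `q` is positive. -/
lemma card_grid_le (hp : 0 < p.1 ∧ 0 < p.2) : ((grid p).card : ℝ) ≤ 4 * size p := by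
  have h1 : (grid p).card ≤ (2 * (p.1 / 2) + 1) * (2 * (p.2 / 2) + 1) := by
    refine (Finset.card_erase_le).trans ?_
    rw [Finset.card_product, Int.card_Icc, Int.card_Icc]
    gcongr <;> omega
  have h2 : (2 * (p.1 / 2) + 1) * (2 * (p.2 / 2) + 1) ≤ (2 * p.1) * (2 * p.2) := by
    gcongr <;> omega
  have h3 : (grid p).card ≤ (2 * p.1) * (2 * p.2) := h1.trans h2
  have : ((grid p).card : ℝ) ≤ (2 * p.1) * (2 * p.2) := by exact_mod_cast h3
  rw [size]; linarith

lemma abs_inv_size_mul_sum_le (hp : 0 < p.1 ∧ 0 < p.2) {g : ℤ × ℤ → ℝ} {C : ℝ}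
    (hC : 0 ≤ C) (hg : ∀ j ∈ grid p, |g j| ≤ C) :
    |(size p)⁻¹ * ∑ j ∈ grid p, g j| ≤ 4 * C := by
  have hs := size_pos hp
  rw [abs_mul, abs_of_pos (inv_pos.2 hs), inv_mul_le_iff₀ hs]
  refine (Finset.abs_sum_le_sum_abs _ _).trans ((Finset.sum_le_card_nsmul _ _ C hg).trans ?_)
  rw [nsmul_eq_mul]
  nlinarith [card_grid_le hp]

section Bounded

variable {B : ℝ} (hB0 : 0 ≤ B) (hB : ∀ ω ∈ freqDomain, |ψ ω| ≤ B)
include hB0 hB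

lemma abs_kernel_le (hp : 0 < p.1 ∧ 0 < p.2) (h : ℤ × ℤ) : |kernel ψ p h| ≤ 4 * B := by
  refine abs_inv_size_mul_sum_le hp hB0 fun j hj => ?_
  rw [abs_mul]
  exact (mul_le_of_le_one_right (abs_nonneg _) (Real.abs_cos_le_one _)).trans
    (hB _ (freq_mem_freqDomain hj))

/-- Two grid indices differ by at most one period in each coordinate, so a congruence class meets
the grid in at most nine points. -/
lemma abs_congrSum_le {j : ℤ × ℤ} (hp : 0 < p.1 ∧ 0 < p.2) (hj : j ∈ grid p) :
    |congrSum ψ p j| ≤ 9 * B := by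
  rw [congrSum, ← Finset.sum_filter]
  refine (Finset.abs_sum_le_sum_abs _ _).trans ((Finset.sum_le_card_nsmul _ _ B fun l hl =>
    hB _ (freq_mem_freqDomain (Finset.mem_filter.1 hl).1)).trans ?_)
  rw [nsmul_eq_mul]
  refine mul_le_mul_of_nonneg_right ?_ hB0
  set E : Finset (ℤ × ℤ) := Finset.Icc (-1) 1 ×ˢ Finset.Icc (-1) 1
  have hE : E.card = 9 := by simp [E]
  have hsub : ((grid p).filter fun l => (p.1 : ℤ) ∣ (j - l).1 ∧ (p.2 : ℤ) ∣ (j - l).2) ⊆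
      E.image fun e => (j.1 - p.1 * e.1, j.2 - p.2 * e.2) := by
    intro l hl
    obtain ⟨hl, ⟨c₁, h₁⟩, ⟨c₂, h₂⟩⟩ := Finset.mem_filter.1 hl
    obtain ⟨-, j1, j2⟩ := mem_grid.1 hj
    obtain ⟨-, l1, l2⟩ := mem_grid.1 hl
    have aux : ∀ (q : ℕ) (i k c : ℤ), 0 < q → 2 * |i| ≤ q → 2 * |k| ≤ q → i - k = q * c →
        -1 ≤ c ∧ c ≤ 1 := by
      intro q i k c hq hi hk hc
      have h1 : |i - k| ≤ q := (abs_sub i k).trans (by omega)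
      rw [hc, abs_mul, Nat.abs_cast] at h1
      have hq' : (0 : ℤ) < q := by exact_mod_cast hq
      have h2 : |c| ≤ 1 := by nlinarith
      exact abs_le.1 h2
    refine Finset.mem_image.2 ⟨(c₁, c₂), ?_, ?_⟩
    · have b1 := aux _ _ _ _ hp.1 j1 l1 h₁
      have b2 := aux _ _ _ _ hp.2 j2 l2 h₂
      simp [E, b1, b2]
    · rw [← h₁, ← h₂]; ext <;> simp
  have := (Finset.card_le_card hsub).trans Finset.card_image_le
  rw [hE] at this
  exact_mod_cast this

lemma abs_kernelCorr_term_le {j : ℤ × ℤ} (hp : 0 < p.1 ∧ 0 < p.2) (hj : j ∈ grid p) (a : ℤ × ℤ) :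
    |ψ (freq p j) * Real.cos (phase a (freq p j)) * ((congrSum ψ p j + congrSum ψ p (-j)) / 2)| ≤
      B * (9 * B) := by
  rw [abs_mul, abs_mul]
  have h1 := hB _ (freq_mem_freqDomain hj)
  have h2 := abs_congrSum_le hB0 hB hp hj
  have h3 := abs_congrSum_le hB0 hB hp (neg_mem_grid.2 hj)
  have h4 : |(congrSum ψ p j + congrSum ψ p (-j)) / 2| ≤ 9 * B := by
    rw [abs_div, abs_two]
    have := abs_add_le (congrSum ψ p j) (congrSum ψ p (-j))
    linarith
  exact mul_le_mul ((mul_le_of_le_one_right (abs_nonneg _) (Real.abs_cos_le_one _)).trans h1)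
    h4 (abs_nonneg _) hB0

lemma abs_kernelCorr_le (hp : 0 < p.1 ∧ 0 < p.2) (a : ℤ × ℤ) :
    |kernelCorr ψ p a| ≤ 4 * (B * (9 * B)) :=
  abs_inv_size_mul_sum_le hp (by positivity) fun _ hj => abs_kernelCorr_term_le hB0 hB hp hj a

end Bounded

/-- An index strictly within half a period is congruent to no other grid index; repetitions occur
only on the boundary of the grid, when a side is even. -/
lemma congrSum_eq_of_interior {j : ℤ × ℤ} (hj : j ∈ grid p) (h₁ : 2 * |j.1| < p.1)
    (h₂ : 2 * |j.2| < p.2) : congrSum ψ p j = ψ (freq p j) := by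
  rw [congrSum, Finset.sum_eq_single_of_mem j hj]
  · simp
  · intro l hl hne
    refine if_neg fun hd => hne ?_
    obtain ⟨-, l1, l2⟩ := mem_grid.1 hl
    have aux : ∀ (q : ℕ) (i k : ℤ), 2 * |i| < q → 2 * |k| ≤ q → (q : ℤ) ∣ i - k → k = i := by
      intro q i k hi hk hc
      have h1 : |i - k| < q := lt_of_le_of_lt (abs_sub i k) (by omega)
      have := Int.eq_zero_of_abs_lt_dvd hc h1
      omega
    exact Prod.ext (aux _ _ _ h₁ l1 hd.1) (aux _ _ _ h₂ l2 hd.2)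

/-- The sum of squares of the kernel over any row is `kernelCorr 0`. -/
lemma sum_abs_kernel_mul_le (hp : 0 < p.1 ∧ 0 < p.2) (v d : ℤ × ℤ) :
    ∑ u ∈ region 0 p, |kernel ψ p (u - v) * kernel ψ p (u - v + d)| ≤ kernelCorr ψ p 0 := by
  have h1 := sum_kernel_mul_kernel (ψ := ψ) hp (-v) (-v)
  have h2 := sum_kernel_mul_kernel (ψ := ψ) hp (-v + d) (-v + d)
  rw [sub_self] at h1 h2
  -- The inequality between arithmetic and geometric means leaves two sums of squares over a full
  -- period, both equal to the autocorrelation at zero.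
  have h3 : ∀ u ∈ region 0 p, |kernel ψ p (u - v) * kernel ψ p (u - v + d)| ≤
      (kernel ψ p (u + -v) * kernel ψ p (u + -v) +
        kernel ψ p (u + (-v + d)) * kernel ψ p (u + (-v + d))) / 2 := by
    intro u _
    rw [← add_assoc, ← sub_eq_add_neg, abs_mul]
    have := two_mul_le_add_sq |kernel ψ p (u - v)| |kernel ψ p (u - v + d)|
    rw [sq_abs, sq_abs] at this
    linarith
  refine (Finset.sum_le_sum h3).trans ?_
  rw [← Finset.sum_div, Finset.sum_add_distrib, h1, h2]
  linarith

lemma sum_abs_kernel_mul_le' (hp : 0 < p.1 ∧ 0 < p.2) (u d : ℤ × ℤ) :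
    ∑ v ∈ region 0 p, |kernel ψ p (u - v) * kernel ψ p (u - v + d)| ≤ kernelCorr ψ p 0 := by
  refine le_trans (le_of_eq ?_) (sum_abs_kernel_mul_le hp u (-d))
  refine Finset.sum_congr rfl fun v _ => ?_
  rw [← kernel_neg, ← kernel_neg ψ p (u - v + d)]
  congr 3 <;> abel

/-- Each row contributes at most the autocorrelation at zero, so the bound is linear in the size.
This gives the dominating constant for the covariance series without summability of the kernel. -/
lemma abs_pairCoeff_kernel_le (hp : 0 < p.1 ∧ 0 < p.2) (h : (ℤ × ℤ) × (ℤ × ℤ)) :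
    |pairCoeff (region 0 p) (kernel ψ p) h| ≤ size p * kernelCorr ψ p 0 := by
  refine (Finset.abs_sum_le_sum_abs _ _).trans ?_
  rw [Finset.sum_product_right, ← card_region, ← nsmul_eq_mul]
  refine Finset.sum_le_card_nsmul _ _ _ fun v _ => ?_
  refine le_trans (Finset.sum_le_sum fun u _ => ?_) (sum_abs_kernel_mul_le hp v (h.1 - h.2))
  split_ifs
  · exact le_rfl
  · rw [abs_zero]; exact abs_nonneg _

/-- Without the restriction to the rectangle the sum is exactly `size p` times the autocorrelation.
The lost pairs fill `defect` many rows and columns, each costing at most the autocorrelation at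
zero. -/
lemma abs_pairCoeff_kernel_sub_le (hp : 0 < p.1 ∧ 0 < p.2) (h : (ℤ × ℤ) × (ℤ × ℤ)) :
    |pairCoeff (region 0 p) (kernel ψ p) h - size p * kernelCorr ψ p (h.1 - h.2)| ≤
      (defect (region 0 p) h.1 + defect (region 0 p) h.2) * kernelCorr ψ p 0 := by
  set D := region 0 p
  set d := h.1 - h.2
  have e : size p * kernelCorr ψ p d = ∑ r ∈ D ×ˢ D,
      kernel ψ p (r.1 - r.2) * kernel ψ p (r.1 - r.2 + d) := by
    rw [Finset.sum_product_right, ← card_region, ← nsmul_eq_mul]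
    symm
    refine Finset.sum_eq_card_nsmul fun v _ => ?_
    have := sum_kernel_mul_kernel (ψ := ψ) hp (-v + d) (-v)
    rw [add_sub_cancel_left] at this
    rw [← this]
    refine Finset.sum_congr rfl fun u _ => ?_
    rw [mul_comm, ← add_assoc, ← sub_eq_add_neg]
  rw [e, pairCoeff, ← Finset.sum_sub_distrib]
  refine (Finset.abs_sum_le_sum_abs _ _).trans ?_
  have hterm : ∀ r ∈ D ×ˢ D, |(if r + h ∈ D ×ˢ D then
      kernel ψ p (r.1 - r.2) * kernel ψ p (r.1 - r.2 + d) else 0) -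
      kernel ψ p (r.1 - r.2) * kernel ψ p (r.1 - r.2 + d)| ≤
      (if r.1 + h.1 ∈ D then 0 else 1) * |kernel ψ p (r.1 - r.2) * kernel ψ p (r.1 - r.2 + d)| +
      (if r.2 + h.2 ∈ D then 0 else 1) *
        |kernel ψ p (r.1 - r.2) * kernel ψ p (r.1 - r.2 + d)| := by
    intro r _
    simp only [Finset.mem_product, Prod.fst_add, Prod.snd_add]
    by_cases h1 : r.1 + h.1 ∈ D <;> by_cases h2 : r.2 + h.2 ∈ D <;>
      simp [h1, h2, -abs_mul]
  refine (Finset.sum_le_sum hterm).trans ?_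
  rw [Finset.sum_add_distrib, add_mul]
  refine add_le_add ?_ ?_
  · rw [Finset.sum_product, defect, Finset.sum_mul]
    refine Finset.sum_le_sum fun u _ => ?_
    by_cases hu : u + h.1 ∈ D
    · simp [hu]
    · simpa [hu, -abs_mul] using sum_abs_kernel_mul_le' hp u d
  · rw [Finset.sum_product_right, defect, Finset.sum_mul]
    refine Finset.sum_le_sum fun v _ => ?_
    by_cases hv : v + h.2 ∈ D
    · simp [hv]
    · simpa [hv, -abs_mul] using sum_abs_kernel_mul_le hp v d

end Kernel

/-! ### Limits of the kernel and of its autocorrelation. -/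

section KernelLimits

variable {ψ : ℝ × ℝ → ℝ} {p : ℕ → ℕ × ℕ}

lemma two_pi_sq_mul_zpow : ((2 * Real.pi) ^ 2 : ℝ) * (2 * Real.pi) ^ (-2 : ℤ) = 1 := by
  rw [zpow_neg, ← zpow_natCast (2 * Real.pi) 2]
  exact mul_inv_cancel₀ (by positivity)

lemma tendsto_inv_size_mul_sum (hp : Tendsto p atTop atTop) {g : ℕ → ℤ × ℤ → ℝ} {C : ℝ}
    (hC : ∀ᶠ m in atTop, ∀ j ∈ grid (p m), |g m j| ≤ C) {G : ℝ × ℝ → ℝ}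
    (hG : ∀ᵐ ω : ℝ × ℝ, ω ∈ offAxes →
      Tendsto (fun m => g m (gridPoint (p m) ω)) atTop (𝓝 (G ω))) :
    Tendsto (fun m => (size (p m))⁻¹ * ∑ j ∈ grid (p m), g m j) atTop
      (𝓝 ((2 * Real.pi) ^ (-2 : ℤ) * ∫ ω in freqDomain, G ω)) := by
  refine ((tendsto_riemann hp hC hG).const_mul ((2 * Real.pi) ^ (-2 : ℤ))).congr fun m => ?_
  linear_combination (size (p m))⁻¹ * (∑ j ∈ grid (p m), g m j) * two_pi_sq_mul_zpow

lemma tendsto_cos_phase_gridPoint (hp : Tendsto p atTop atTop) (a : ℤ × ℤ) (ω : ℝ × ℝ) :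
    Tendsto (fun m => Real.cos (phase a (freq (p m) (gridPoint (p m) ω)))) atTop
      (𝓝 (Real.cos (phase a ω))) :=
  ((Real.continuous_cos.comp (continuous_phase a)).tendsto ω).comp (tendsto_freq_gridPoint hp ω)

lemma IsBV.tendsto_kernel (hψ : IsBV ψ) (hp : Tendsto p atTop atTop) (a : ℤ × ℤ) :
    Tendsto (fun m => kernel ψ (p m) a) atTop
      (𝓝 ((2 * Real.pi) ^ (-2 : ℤ) * ∫ ω in freqDomain, ψ ω * Real.cos (phase a ω))) := by
  obtain ⟨B, hB0, hB⟩ := hψ.bounded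
  refine tendsto_inv_size_mul_sum hp (C := B) (.of_forall fun m j hj => ?_) ?_
  · rw [abs_mul]
    exact (mul_le_of_le_one_right (abs_nonneg _) (Real.abs_cos_le_one _)).trans
      (hB _ (freq_mem_freqDomain hj))
  · filter_upwards [hψ.ae_tendsto hp] with ω h1 hω
    exact (h1 hω).1.mul (tendsto_cos_phase_gridPoint hp a ω)

/-- At almost every frequency the grid index is eventually interior, where the congruence sums
reduce to `ψ` at `ω` and at `-ω`; the boundary indices do not affect the Riemann sum. -/
lemma IsBV.tendsto_kernelCorr (hψ : IsBV ψ) (hp : Tendsto p atTop atTop) (a : ℤ × ℤ) :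
    Tendsto (fun m => kernelCorr ψ (p m) a) atTop
      (𝓝 ((2 * Real.pi) ^ (-2 : ℤ) * ∫ ω in freqDomain,
        ψ ω * Real.cos (phase a ω) * ((ψ ω + ψ (-ω)) / 2))) := by
  obtain ⟨B, hB0, hB⟩ := hψ.bounded
  refine tendsto_inv_size_mul_sum hp (C := B * (9 * B)) ?_ ?_
  · filter_upwards [eventually_pos hp] with m hm j hj
    exact abs_kernelCorr_term_le hB0 hB hm hj a
  · filter_upwards [hψ.ae_tendsto hp] with ω h1 hω
    have h2 := ((h1 hω).1.mul (tendsto_cos_phase_gridPoint hp a ω)).mul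
      (((h1 hω).1.add (h1 hω).2).div_const 2)
    refine h2.congr' ?_
    filter_upwards [eventually_gridPoint_mem hp hω, eventually_gridPoint hp hω] with m hm hi
    rw [congrSum_eq_of_interior hm hi.2.2.1 hi.2.2.2,
      congrSum_eq_of_interior (neg_mem_grid.2 hm) (by simpa using hi.2.2.1)
        (by simpa using hi.2.2.2)]

lemma measurableSet_freqDomain : MeasurableSet freqDomain := measurableSet_Icc

/-- Measurability of `ψ` is not part of `IsBV`; it follows because `ψ` is almost everywhere a limit
of its own step functions on refining grids. -/
lemma IsBV.aestronglyMeasurable (hψ : IsBV ψ) :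
    AEStronglyMeasurable ψ (volume.restrict freqDomain) ∧
      AEStronglyMeasurable (fun ω => ψ (-ω)) (volume.restrict freqDomain) := by
  have hp : Tendsto (fun m : ℕ => (m, m)) atTop atTop := by
    rw [← prod_atTop_atTop_eq]; exact tendsto_id.prodMk tendsto_id
  have hae : ∀ᵐ ω ∂(volume.restrict freqDomain),
      Tendsto (fun m : ℕ => ψ (freq (m, m) (gridPoint (m, m) ω))) atTop (𝓝 (ψ ω)) ∧
      Tendsto (fun m : ℕ => ψ (freq (m, m) (-gridPoint (m, m) ω))) atTop (𝓝 (ψ (-ω))) := by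
    rw [ae_restrict_iff' measurableSet_freqDomain]
    filter_upwards [hψ.ae_tendsto hp, ae_offAxes] with ω h1 h2 hω using h1 (h2 hω)
  constructor
  · refine aestronglyMeasurable_of_tendsto_ae atTop (fun m : ℕ => ?_) (hae.mono fun ω h => h.1)
    exact ((Measurable.of_discrete (f := fun j => ψ (freq (m, m) j))).comp
      (measurable_gridPoint (m, m))).aestronglyMeasurable
  · refine aestronglyMeasurable_of_tendsto_ae atTop (fun m : ℕ => ?_) (hae.mono fun ω h => h.2)
    exact ((Measurable.of_discrete (f := fun j => ψ (freq (m, m) (-j)))).comp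
      (measurable_gridPoint (m, m))).aestronglyMeasurable

end KernelLimits

/-- Interchange of an integral with a series of bounded functions with summable coefficients. -/
lemma integral_tsum_mul {α β : Type*} [MeasurableSpace α] [Countable β] {μ : Measure α}
    [IsFiniteMeasure μ] {c : β → ℝ} (hc : Summable c) {g : β → α → ℝ}
    (hg : ∀ h, AEStronglyMeasurable (g h) μ) {B : ℝ} (hB : ∀ h, ∀ᵐ x ∂μ, |g h x| ≤ B) :
    ∫ x, ∑' h, c h * g h x ∂μ = ∑' h, c h * ∫ x, g h x ∂μ := by
  have hint : ∀ h, Integrable (g h) μ := fun h => Integrable.of_bound (hg h) B (hB h)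
  rw [← integral_tsum_of_summable_integral_norm (fun h => (hint h).const_mul (c h))]
  · simp_rw [integral_const_mul]
  · refine Summable.of_nonneg_of_le (fun h => integral_nonneg fun x => norm_nonneg _) (fun h => ?_)
      (hc.abs.mul_right (∫ _, B ∂μ))
    rw [← integral_const_mul]
    refine integral_mono_ae ((hint h).const_mul (c h)).norm (integrable_const _) ?_
    filter_upwards [hB h] with x hx
    rw [norm_mul, Real.norm_eq_abs, Real.norm_eq_abs]
    exact mul_le_mul_of_nonneg_left hx (abs_nonneg _)

/-! ### The asymptotic variance of the spectral mean statistic. -/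

section Variance

variable {Ω : Type*} [MeasurableSpace Ω] {P : Measure Ω} [IsProbabilityMeasure P]
  {Z : ℤ × ℤ → Ω → ℝ} {ψ : ℝ × ℝ → ℝ} {p : ℕ → ℕ × ℕ}

instance : IsFiniteMeasure ((volume : Measure (ℝ × ℝ)).restrict freqDomain) :=
  ⟨by
    rw [Measure.restrict_apply_univ]
    exact (isCompact_Icc (a := ((-Real.pi, -Real.pi) : ℝ × ℝ))).measure_lt_top⟩

lemma aesm_cos_phase (a : ℤ × ℤ) (μ : Measure (ℝ × ℝ)) :
    AEStronglyMeasurable (fun ω => Real.cos (phase a ω)) μ :=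
  (Real.continuous_cos.comp (continuous_phase a)).aestronglyMeasurable

/-- Writing `f²` as a double series over lags and integrating termwise gives the form in which the
covariance part converges. -/
lemma IsBV.sigma1Sq_eq (hψ : IsBV ψ) (hZ : FourthOrderStationary P Z)
    (hγ : Summable (autocov P Z)) :
    sigma1Sq P Z ψ = ∑' h : (ℤ × ℤ) × (ℤ × ℤ), autocov P Z h.1 * autocov P Z h.2 *
      (2 * ((2 * Real.pi) ^ (-2 : ℤ) * ∫ ω in freqDomain,
        ψ ω * Real.cos (phase (h.1 - h.2) ω) * ((ψ ω + ψ (-ω)) / 2))) := by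
  obtain ⟨B, hB0, hB⟩ := hψ.bounded
  obtain ⟨m1, m2⟩ := hψ.aestronglyMeasurable
  have key := integral_tsum_mul (μ := volume.restrict freqDomain) (summable_autocov_mul hγ)
    (g := fun h ω => ψ ω * Real.cos (phase (h.1 - h.2) ω) * ((ψ ω + ψ (-ω)) / 2)) (B := B * B)
    (fun h => (m1.mul (aesm_cos_phase _ _)).mul
      (by simpa only [div_eq_mul_inv] using (m1.fun_add m2).mul_const (2⁻¹ : ℝ))) (fun h => ?_)
  · have e : ∀ ω, ∑' h : (ℤ × ℤ) × (ℤ × ℤ), autocov P Z h.1 * autocov P Z h.2 *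
        (ψ ω * Real.cos (phase (h.1 - h.2) ω) * ((ψ ω + ψ (-ω)) / 2)) =
        ((2 * Real.pi) ^ 2) ^ 2 / 2 * (ψ ω * (ψ ω + ψ (-ω)) * specDensity P Z ω ^ 2) := by
      intro ω
      have := hZ.tsum_autocov_mul_cos hγ ω
      calc _ = ∑' h : (ℤ × ℤ) × (ℤ × ℤ), autocov P Z h.1 * autocov P Z h.2 *
          Real.cos (phase (h.1 - h.2) ω) * (ψ ω * ((ψ ω + ψ (-ω)) / 2)) :=
            tsum_congr fun h => by ring
        _ = _ := by rw [tsum_mul_right, this]; ring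
    simp_rw [e] at key
    rw [integral_const_mul] at key
    have e2 : ∀ h : (ℤ × ℤ) × (ℤ × ℤ), autocov P Z h.1 * autocov P Z h.2 *
      (2 * ((2 * Real.pi) ^ (-2 : ℤ) * ∫ ω in freqDomain,
        ψ ω * Real.cos (phase (h.1 - h.2) ω) * ((ψ ω + ψ (-ω)) / 2))) =
      (2 * (2 * Real.pi) ^ (-2 : ℤ)) * (autocov P Z h.1 * autocov P Z h.2 *
        ∫ ω in freqDomain, ψ ω * Real.cos (phase (h.1 - h.2) ω) * ((ψ ω + ψ (-ω)) / 2)) :=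
      fun h => by ring
    simp_rw [e2]
    rw [tsum_mul_left, ← key, sigma1Sq]
    linear_combination -((2 * Real.pi) ^ 2 *
      ∫ ω in freqDomain, ψ ω * (ψ ω + ψ (-ω)) * specDensity P Z ω ^ 2) * two_pi_sq_mul_zpow
  · rw [ae_restrict_iff' measurableSet_freqDomain]
    refine .of_forall fun ω hω => ?_
    have h1 := hB ω hω
    have h2 := hB (-ω) (neg_mem_freqDomain.2 hω)
    rw [abs_mul, abs_mul]
    refine mul_le_mul ((mul_le_of_le_one_right (abs_nonneg _) (Real.abs_cos_le_one _)).trans h1)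
      ?_ (abs_nonneg _) hB0
    rw [abs_div, abs_two]
    have := abs_add_le (ψ ω) (ψ (-ω))
    linarith

/-- The real part of `f₄` factors in `ω₁` and `ω₂` at each triple of lags, so each integrated term
is a product of two Fourier coefficients of `ψ`. -/
lemma IsBV.sigma2Sq_eq (hψ : IsBV ψ) (hκ : Summable (lagCum4 P Z)) :
    sigma2Sq P Z ψ = ∑' h : (ℤ × ℤ) × (ℤ × ℤ) × (ℤ × ℤ), lagCum4 P Z h *
      (((2 * Real.pi) ^ (-2 : ℤ) * ∫ ω in freqDomain, ψ ω * Real.cos (phase h.1 ω)) *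
        ((2 * Real.pi) ^ (-2 : ℤ) *
          ∫ ω in freqDomain, ψ ω * Real.cos (phase (h.2.1 - h.2.2) ω))) := by
  obtain ⟨B, hB0, hB⟩ := hψ.bounded
  obtain ⟨m1, -⟩ := hψ.aestronglyMeasurable
  set c : ℤ × ℤ → ℝ := fun a => ∫ ω in freqDomain, ψ ω * Real.cos (phase a ω) with hc
  have hb : ∀ a, ∀ ω ∈ freqDomain, |ψ ω * Real.cos (phase a ω)| ≤ B := fun a ω hω => by
    rw [abs_mul]
    exact (mul_le_of_le_one_right (abs_nonneg _) (Real.abs_cos_le_one _)).trans (hB ω hω)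
  have hm : ∀ a, AEStronglyMeasurable (fun ω => ψ ω * Real.cos (phase a ω))
      (volume.restrict freqDomain) := fun a => m1.mul (aesm_cos_phase _ _)
  have hcb : ∀ a, |c a| ≤ B * (volume.restrict freqDomain).real Set.univ := fun a => by
    refine norm_integral_le_of_norm_le_const (μ := volume.restrict freqDomain)
      (f := fun ω => ψ ω * Real.cos (phase a ω)) ?_
    rw [ae_restrict_iff' measurableSet_freqDomain]
    exact .of_forall (hb a)
  set V := (volume.restrict freqDomain).real (Set.univ : Set (ℝ × ℝ))
  have inner : ∀ ω₁ ∈ freqDomain, ∫ ω₂ in freqDomain,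
      ψ ω₁ * ψ ω₂ * (cumSpecDensity P Z ω₁ ω₂ (-ω₂)).re = (2 * Real.pi) ^ (-6 : ℤ) *
        ∑' h : (ℤ × ℤ) × (ℤ × ℤ) × (ℤ × ℤ), lagCum4 P Z h *
          (ψ ω₁ * Real.cos (phase h.1 ω₁) * c (h.2.1 - h.2.2)) := by
    intro ω₁ hω₁
    have key := integral_tsum_mul (μ := volume.restrict freqDomain) hκ
      (g := fun h ω₂ => ψ ω₁ * Real.cos (phase h.1 ω₁) *
        (ψ ω₂ * Real.cos (phase (h.2.1 - h.2.2) ω₂))) (B := B * B)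
      (fun h => (hm _).const_mul _) (fun h => ?_)
    · simp_rw [integral_const_mul] at key
      rw [hc, ← key, ← integral_const_mul]
      refine integral_congr_ae (.of_forall fun ω₂ => ?_)
      simp only [re_cumSpecDensity hκ]
      rw [mul_left_comm, ← tsum_mul_left]
      congr 1
      exact tsum_congr fun h => by ring
    · rw [ae_restrict_iff' measurableSet_freqDomain]
      refine .of_forall fun ω₂ hω₂ => ?_
      rw [abs_mul]
      exact mul_le_mul (hb _ _ hω₁) (hb _ _ hω₂) (abs_nonneg _) hB0
  rw [sigma2Sq, setIntegral_congr_fun measurableSet_freqDomain inner, integral_const_mul]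
  have key := integral_tsum_mul (μ := volume.restrict freqDomain) hκ
    (g := fun h ω₁ => ψ ω₁ * Real.cos (phase h.1 ω₁) * c (h.2.1 - h.2.2)) (B := B * (B * V))
    (fun h => (hm _).mul_const _) (fun h => ?_)
  · simp_rw [integral_mul_const] at key
    rw [key]
    have e : ∀ h : (ℤ × ℤ) × (ℤ × ℤ) × (ℤ × ℤ), lagCum4 P Z h *
        ((2 * Real.pi) ^ (-2 : ℤ) * c h.1 * ((2 * Real.pi) ^ (-2 : ℤ) * c (h.2.1 - h.2.2))) =
        ((2 * Real.pi) ^ (-2 : ℤ)) ^ 2 * (lagCum4 P Z h * (c h.1 * c (h.2.1 - h.2.2))) :=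
      fun h => by ring
    change _ = ∑' h : (ℤ × ℤ) × (ℤ × ℤ) × (ℤ × ℤ), lagCum4 P Z h *
        ((2 * Real.pi) ^ (-2 : ℤ) * c h.1 * ((2 * Real.pi) ^ (-2 : ℤ) * c (h.2.1 - h.2.2)))
    simp_rw [e]
    rw [tsum_mul_left, ← mul_assoc]
    congr 1
    -- The powers of `2π` balance: `2 - 6 = -2 - 2`.
    have hπ : (2 * Real.pi) ≠ 0 := by positivity
    rw [← zpow_natCast, ← zpow_natCast, ← zpow_add₀ hπ, ← zpow_mul]
    norm_num
  · rw [ae_restrict_iff' measurableSet_freqDomain]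
    refine .of_forall fun ω₁ hω₁ => ?_
    rw [abs_mul]
    exact mul_le_mul (hb _ _ hω₁) (hcb _) (abs_nonneg _) hB0

lemma IsBV.tendsto_cumPart (hψ : IsBV ψ) (hκ : Summable (lagCum4 P Z))
    (hp : Tendsto p atTop atTop) :
    Tendsto (fun m => (size (p m))⁻¹ * cumPart P Z (region 0 (p m)) (kernel ψ (p m))) atTop
      (𝓝 (sigma2Sq P Z ψ)) := by
  obtain ⟨B, hB0, hB⟩ := hψ.bounded
  rw [hψ.sigma2Sq_eq hκ]
  have key := tendsto_tsum_mul hκ (B := (4 * B) * (4 * B)) (a := fun m h =>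
    kernel ψ (p m) h.1 * kernel ψ (p m) (h.2.1 - h.2.2) *
      (overlap3 (region 0 (p m)) h / size (p m))) (a' := fun h =>
      ((2 * Real.pi) ^ (-2 : ℤ) * ∫ ω in freqDomain, ψ ω * Real.cos (phase h.1 ω)) *
        ((2 * Real.pi) ^ (-2 : ℤ) *
          ∫ ω in freqDomain, ψ ω * Real.cos (phase (h.2.1 - h.2.2) ω))) ?_ ?_
  · refine key.congr fun m => ?_
    rw [cumPart, ← tsum_mul_left]
    exact tsum_congr fun h => by ring
  · filter_upwards [eventually_pos hp] with m hm h
    rw [abs_mul, abs_mul]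
    have h1 : |overlap3 (region 0 (p m)) h / size (p m)| ≤ 1 := by
      rw [abs_of_nonneg (div_nonneg (overlap3_nonneg _ _) (size_nonneg _)),
        div_le_one (size_pos hm), ← card_region]
      exact overlap3_le _ _
    refine (mul_le_of_le_one_right (by positivity) h1).trans ?_
    exact mul_le_mul (abs_kernel_le hB0 hB hm _) (abs_kernel_le hB0 hB hm _) (abs_nonneg _)
      (by positivity)
  · intro h
    simpa using ((hψ.tendsto_kernel hp h.1).mul (hψ.tendsto_kernel hp (h.2.1 - h.2.2))).mul
      (tendsto_overlap3 hp h)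

/-- At a fixed pair of lags the defects are negligible relative to the size, so the pair coefficient
behaves like `size` times the autocorrelation at `h₁ - h₂`. -/
lemma IsBV.tendsto_covPart (hψ : IsBV ψ) (hZ : FourthOrderStationary P Z)
    (hγ : Summable (autocov P Z)) (hp : Tendsto p atTop atTop) :
    Tendsto (fun m => (size (p m))⁻¹ * (2 * covPart P Z (region 0 (p m)) (kernel ψ (p m)))) atTop
      (𝓝 (sigma1Sq P Z ψ)) := by
  obtain ⟨B, hB0, hB⟩ := hψ.bounded
  rw [hψ.sigma1Sq_eq hZ hγ]
  have key := tendsto_tsum_mul (summable_autocov_mul hγ) (B := 2 * (4 * (B * (9 * B))))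
    (a := fun m h => 2 * (pairCoeff (region 0 (p m)) (kernel ψ (p m)) h / size (p m)))
    (a' := fun h => 2 * ((2 * Real.pi) ^ (-2 : ℤ) * ∫ ω in freqDomain,
        ψ ω * Real.cos (phase (h.1 - h.2) ω) * ((ψ ω + ψ (-ω)) / 2))) ?_ ?_
  · refine key.congr fun m => ?_
    rw [covPart, ← tsum_mul_left, ← tsum_mul_left]
    exact tsum_congr fun h => by ring
  · filter_upwards [eventually_pos hp] with m hm h
    have hs := size_pos hm
    rw [abs_mul, abs_two, abs_div, abs_of_pos hs]
    have h1 := abs_pairCoeff_kernel_le (ψ := ψ) hm h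
    have h2 := (le_abs_self _).trans (abs_kernelCorr_le hB0 hB hm 0)
    refine mul_le_mul_of_nonneg_left ?_ zero_le_two
    rw [div_le_iff₀ hs]
    nlinarith
  · intro h
    refine Tendsto.const_mul 2 ?_
    have hd : Tendsto (fun m => (defect (region 0 (p m)) h.1 / size (p m) +
        defect (region 0 (p m)) h.2 / size (p m)) * kernelCorr ψ (p m) 0) atTop (𝓝 0) := by
      simpa using ((tendsto_defect hp h.1).add (tendsto_defect hp h.2)).mul
        (hψ.tendsto_kernelCorr hp 0)
    refine (hψ.tendsto_kernelCorr hp (h.1 - h.2)).congr_dist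
      (squeeze_zero' (.of_forall fun _ => dist_nonneg) ?_ hd)
    filter_upwards [eventually_pos hp] with m hm
    have hs := size_pos hm
    have h3 := abs_pairCoeff_kernel_sub_le (ψ := ψ) hm h
    rw [dist_comm, Real.dist_eq]
    have e : pairCoeff (region 0 (p m)) (kernel ψ (p m)) h / size (p m) -
        kernelCorr ψ (p m) (h.1 - h.2) = (pairCoeff (region 0 (p m)) (kernel ψ (p m)) h -
          size (p m) * kernelCorr ψ (p m) (h.1 - h.2)) / size (p m) := by field_simp
    rw [e, abs_div, abs_of_pos hs, ← add_div, div_mul_eq_mul_div]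
    gcongr

lemma FourthOrderStationary.memLp_hStat (hZ : FourthOrderStationary P Z) (ψ : ℝ × ℝ → ℝ)
    (k : ℤ × ℤ) (q : ℕ × ℕ) : MemLp (hStat Z P ψ k q) 2 P := by
  have : hStat Z P ψ k q = fun x => √(size q) * ((size q)⁻¹ *
      quadForm (region 0 q) (kernel ψ q) (centred P fun s => Z (s + k)) x - specMean P Z ψ) := by
    funext x
    rw [hStat, hZ.specAvg_eq]
  rw [this]
  exact ((((hZ.translate k).memLp_quadForm _ _).const_mul _).sub (memLp_const _)).const_mul _

lemma FourthOrderStationary.integral_hStat (hZ : FourthOrderStationary P Z) (ψ : ℝ × ℝ → ℝ)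
    (k : ℤ × ℤ) (q : ℕ × ℕ) :
    ∫ x, hStat Z P ψ k q x ∂P = √(size q) *
      ((size q)⁻¹ * meanPart P Z (region 0 q) (kernel ψ q) - specMean P Z ψ) := by
  simp_rw [hStat, hZ.specAvg_eq, integral_const_mul]
  rw [integral_sub ((((hZ.translate k).memLp_quadForm _ _).integrable (by norm_num)).const_mul _)
    (integrable_const _), integral_const_mul,
    hZ.integral_quadForm_translate k _ (kernel_neg ψ q)]
  simp

lemma FourthOrderStationary.variance_hStat (hZ : FourthOrderStationary P Z) (ψ : ℝ × ℝ → ℝ)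
    (k : ℤ × ℤ) {q : ℕ × ℕ} (hq : 0 < q.1 ∧ 0 < q.2) :
    Var[hStat Z P ψ k q; P] = (size q)⁻¹ * (cumPart P Z (region 0 q) (kernel ψ q) +
      2 * covPart P Z (region 0 q) (kernel ψ q)) := by
  have hs := size_pos hq
  have hL := (hZ.translate k).memLp_quadForm (region 0 q) (kernel ψ q)
  have : hStat Z P ψ k q = fun x => √(size q) * ((size q)⁻¹ *
      quadForm (region 0 q) (kernel ψ q) (centred P fun s => Z (s + k)) x - specMean P Z ψ) := by
    funext x
    rw [hStat, hZ.specAvg_eq]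
  rw [this, variance_const_mul, variance_sub_const (hL.const_mul _).aestronglyMeasurable,
    variance_const_mul, variance_eq_sub hL]
  simp only [Pi.pow_apply]
  rw [hZ.integral_quadForm_translate k _ (kernel_neg ψ q),
    hZ.integral_quadForm_sq_translate k _ (kernel_neg ψ q), Real.sq_sqrt hs.le]
  field_simp
  ring

/-- The variance of `H_n(ψ)` converges to `σ²(ψ)`. -/
lemma IsBV.tendsto_variance_hStat (hψ : IsBV ψ) (hZ : FourthOrderStationary P Z)
    (hγ : Summable (autocov P Z)) (hκ : Summable (lagCum4 P Z)) (hp : Tendsto p atTop atTop) :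
    Tendsto (fun m => Var[hStat Z P ψ 0 (p m); P]) atTop (𝓝 (sigmaSq P Z ψ)) := by
  have h := (hψ.tendsto_covPart hZ hγ hp).add (hψ.tendsto_cumPart hκ hp)
  refine h.congr' ?_
  filter_upwards [eventually_pos hp] with m hm
  rw [hZ.variance_hStat ψ 0 hm]
  ring

/-- Neither the mean nor the variance depends on the position of the block. -/
lemma FourthOrderStationary.integral_hStat_sq (hZ : FourthOrderStationary P Z) (ψ : ℝ × ℝ → ℝ)
    (k : ℤ × ℤ) {q : ℕ × ℕ} (hq : 0 < q.1 ∧ 0 < q.2) :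
    ∫ x, hStat Z P ψ k q x ^ 2 ∂P = ∫ x, hStat Z P ψ 0 q x ^ 2 ∂P := by
  have aux : ∀ k, ∫ x, hStat Z P ψ k q x ^ 2 ∂P =
      Var[hStat Z P ψ k q; P] + (∫ x, hStat Z P ψ k q x ∂P) ^ 2 := fun k => by
    rw [variance_eq_sub (hZ.memLp_hStat ψ k q)]
    simp
  rw [aux k, aux 0, hZ.variance_hStat ψ k hq, hZ.variance_hStat ψ 0 hq, hZ.integral_hStat,
    hZ.integral_hStat]

end Variance

/-! ### Averages over blocks and over pairs of blocks. -/

section BlockAverages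

variable {n b : ℕ × ℕ}

lemma blockAvg_sub (f g : ℤ × ℤ → ℝ) :
    blockAvg n b (fun k => f k - g k) = blockAvg n b f - blockAvg n b g := by
  simp [blockAvg, Finset.sum_sub_distrib, mul_sub]

lemma blockAvg_const_mul (c : ℝ) (f : ℤ × ℤ → ℝ) :
    blockAvg n b (fun k => c * f k) = c * blockAvg n b f := by
  simp only [blockAvg, ← Finset.mul_sum]; ring

lemma blockAvg_const (h : (blocks n b).Nonempty) (c : ℝ) : blockAvg n b (fun _ => c) = c := by
  have : ((blocks n b).card : ℝ) ≠ 0 := by exact_mod_cast h.card_pos.ne'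
  simp [blockAvg, this]

lemma blockAvg_mono {f g : ℤ × ℤ → ℝ} (h : ∀ k, f k ≤ g k) : blockAvg n b f ≤ blockAvg n b g :=
  mul_le_mul_of_nonneg_left (Finset.sum_le_sum fun k _ => h k) (by positivity)

lemma blockAvg_nonneg {f : ℤ × ℤ → ℝ} (h : ∀ k, 0 ≤ f k) : 0 ≤ blockAvg n b f :=
  mul_nonneg (by positivity) (Finset.sum_nonneg fun k _ => h k)

lemma abs_blockAvg_le (f : ℤ × ℤ → ℝ) : |blockAvg n b f| ≤ blockAvg n b fun k => |f k| := by
  rw [blockAvg, abs_mul, abs_of_nonneg (by positivity)]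
  exact mul_le_mul_of_nonneg_left (Finset.abs_sum_le_sum_abs _ _) (by positivity)

lemma sq_blockAvg_le (f : ℤ × ℤ → ℝ) : blockAvg n b f ^ 2 ≤ blockAvg n b fun k => f k ^ 2 := by
  rcases (blocks n b).eq_empty_or_nonempty with h | h
  · simp [blockAvg, h]
  have hc : (0 : ℝ) < (blocks n b).card := by exact_mod_cast h.card_pos
  rw [blockAvg, blockAvg, mul_pow, inv_pow, inv_mul_le_iff₀ (by positivity)]
  have := sq_sum_le_card_mul_sum_sq (s := blocks n b) (f := f)
  refine this.trans (le_of_eq ?_)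
  field_simp

/-- The empirical variance as a difference of moments. -/
lemma blockAvg_sub_sq (h : (blocks n b).Nonempty) (f : ℤ × ℤ → ℝ) :
    blockAvg n b (fun k => (f k - blockAvg n b f) ^ 2) =
      blockAvg n b (fun k => f k ^ 2) - blockAvg n b f ^ 2 := by
  set μ := blockAvg n b f with hμ
  have e : ∀ k, (f k - μ) ^ 2 = f k ^ 2 - ((2 * μ) * f k - μ ^ 2) := fun k => by ring
  simp_rw [e]
  rw [blockAvg_sub, blockAvg_sub, blockAvg_const_mul, blockAvg_const h, ← hμ]
  ring

section Integral

variable {Ω : Type*} [MeasurableSpace Ω] {P : Measure Ω}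

lemma integrable_blockAvg {F : ℤ × ℤ → Ω → ℝ} (hF : ∀ k, Integrable (F k) P) :
    Integrable (fun x => blockAvg n b fun k => F k x) P :=
  (integrable_finsetSum _ fun k _ => hF k).const_mul _

lemma integral_blockAvg {F : ℤ × ℤ → Ω → ℝ} (hF : ∀ k, Integrable (F k) P) :
    ∫ x, blockAvg n b (fun k => F k x) ∂P = blockAvg n b fun k => ∫ x, F k x ∂P := by
  simp only [blockAvg]
  rw [integral_const_mul, integral_finsetSum _ fun k _ => hF k]

lemma memLp_blockAvg {F : ℤ × ℤ → Ω → ℝ} {q : ENNReal} (hF : ∀ k, MemLp (F k) q P) :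
    MemLp (fun x => blockAvg n b fun k => F k x) q P :=
  (memLp_finsetSum _ fun k _ => hF k).const_mul _

end Integral

lemma card_near_le {N : ℤ} {t : ℝ} (ht : 0 ≤ t) (k : ℤ) :
    (((Finset.Icc 0 N).filter fun l : ℤ => |((k : ℝ) - l)| < t).card : ℝ) ≤ 2 * t + 1 := by
  have hsub : ((Finset.Icc 0 N).filter fun l : ℤ => |((k : ℝ) - l)| < t) ⊆
      Finset.Icc (k - ⌊t⌋) (k + ⌊t⌋) := by
    intro l hl
    have h := (Finset.mem_filter.1 hl).2
    have h' : |k - l| ≤ ⌊t⌋ := by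
      rw [Int.le_floor]
      push_cast
      exact h.le
    rw [abs_le] at h'
    rw [Finset.mem_Icc]
    omega
  have h0 : 0 ≤ ⌊t⌋ := Int.floor_nonneg.2 ht
  have h1 := Finset.card_le_card hsub
  rw [Int.card_Icc] at h1
  have h2 : (((Finset.Icc 0 N).filter fun l : ℤ => |((k : ℝ) - l)| < t).card : ℤ) ≤ 2 * ⌊t⌋ + 1 := by
    omega
  have h3 : (((Finset.Icc 0 N).filter fun l : ℤ => |((k : ℝ) - l)| < t).card : ℝ) ≤ 2 * ⌊t⌋ + 1 := by
    exact_mod_cast h2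
  have := Int.floor_le t
  linarith

/-- An average over pairs of blocks, most of which are distant. -/
lemma abs_blockAvg_pair_le (hbn : b.1 ≤ n.1 ∧ b.2 ≤ n.2) {F : ℤ × ℤ → ℤ × ℤ → ℝ} {M ε τ : ℝ}
    (hM : ∀ k l, |F k l| ≤ M) (hε : 0 ≤ ε) (hτ : 0 ≤ τ)
    (hF : ∀ k l : ℤ × ℤ, τ * b.1 ≤ |((k.1 : ℝ) - l.1)| → τ * b.2 ≤ |((k.2 : ℝ) - l.2)| →
      |F k l| ≤ ε) :
    |blockAvg n b fun k => blockAvg n b fun l => F k l| ≤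
      ε + M * ((2 * (τ * b.1) + 1) / (n.1 - b.1 + 1) + (2 * (τ * b.2) + 1) / (n.2 - b.2 + 1)) := by
  have hM0 : 0 ≤ M := (abs_nonneg _).trans (hM 0 0)
  set N₁ : ℤ := (n.1 : ℤ) - b.1
  set N₂ : ℤ := (n.2 : ℤ) - b.2
  have hN₁ : 0 ≤ N₁ := by have := hbn.1; omega
  have hN₂ : 0 ≤ N₂ := by have := hbn.2; omega
  have c₁ : ((Finset.Icc 0 N₁).card : ℝ) = n.1 - b.1 + 1 := by
    rw [Int.card_Icc, sub_zero]
    have : (((N₁ + 1).toNat : ℤ) : ℝ) = ((N₁ + 1 : ℤ) : ℝ) := by rw [Int.toNat_of_nonneg (by omega)]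
    rw [Int.cast_natCast] at this
    rw [this]; push_cast [N₁]; ring
  have c₂ : ((Finset.Icc 0 N₂).card : ℝ) = n.2 - b.2 + 1 := by
    rw [Int.card_Icc, sub_zero]
    have : (((N₂ + 1).toNat : ℤ) : ℝ) = ((N₂ + 1 : ℤ) : ℝ) := by rw [Int.toNat_of_nonneg (by omega)]
    rw [Int.cast_natCast] at this
    rw [this]; push_cast [N₂]; ring
  have p₁ : (0 : ℝ) < n.1 - b.1 + 1 := by
    have : (b.1 : ℝ) ≤ n.1 := by exact_mod_cast hbn.1
    linarith
  have p₂ : (0 : ℝ) < n.2 - b.2 + 1 := by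
    have : (b.2 : ℝ) ≤ n.2 := by exact_mod_cast hbn.2
    linarith
  have hcard : ((blocks n b).card : ℝ) = (n.1 - b.1 + 1) * (n.2 - b.2 + 1) := by
    rw [← c₁, ← c₂, blocks, Finset.card_product]; push_cast; rfl
  have hne : (blocks n b).Nonempty := by
    rw [← Finset.card_pos]
    have : (0 : ℝ) < (blocks n b).card := by rw [hcard]; positivity
    exact_mod_cast this
  have hc : (0 : ℝ) < (blocks n b).card := by exact_mod_cast hne.card_pos
  set R := ε + M * ((2 * (τ * b.1) + 1) / (n.1 - b.1 + 1) +
    (2 * (τ * b.2) + 1) / (n.2 - b.2 + 1)) with hR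
  have inner : ∀ k, |blockAvg n b fun l => F k l| ≤ R := by
    intro k
    refine (abs_blockAvg_le _).trans ?_
    -- Smallness is available only for blocks distant in both coordinates, so the near blocks form a
    -- union of two strips through the whole array.
    set near := (blocks n b).filter fun l =>
      |((k.1 : ℝ) - l.1)| < τ * b.1 ∨ |((k.2 : ℝ) - l.2)| < τ * b.2 with hnear
    have hnc : (near.card : ℝ) ≤
        (2 * (τ * b.1) + 1) * (n.2 - b.2 + 1) + (n.1 - b.1 + 1) * (2 * (τ * b.2) + 1) := by
      have hsub : near ⊆ (((Finset.Icc 0 N₁).filter fun l : ℤ => |((k.1 : ℝ) - l)| < τ * b.1) ×ˢ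
          Finset.Icc 0 N₂) ∪ (Finset.Icc 0 N₁ ×ˢ
            ((Finset.Icc 0 N₂).filter fun l : ℤ => |((k.2 : ℝ) - l)| < τ * b.2)) := by
        intro l hl
        simp only [hnear, blocks, Finset.mem_filter, Finset.mem_product, Finset.mem_union] at hl ⊢
        tauto
      have h1 := (Finset.card_le_card hsub).trans (Finset.card_union_le _ _)
      rw [Finset.card_product, Finset.card_product] at h1
      have h2 : (near.card : ℝ) ≤
          (((Finset.Icc 0 N₁).filter fun l : ℤ => |((k.1 : ℝ) - l)| < τ * b.1).card : ℝ) *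
            (Finset.Icc 0 N₂).card + (Finset.Icc 0 N₁).card *
          (((Finset.Icc 0 N₂).filter fun l : ℤ => |((k.2 : ℝ) - l)| < τ * b.2).card : ℝ) := by
        exact_mod_cast h1
      rw [c₁, c₂] at h2
      refine h2.trans ?_
      gcongr
      · exact card_near_le (by positivity) _
      · exact card_near_le (by positivity) _
    have hsum : ∑ l ∈ blocks n b, |F k l| ≤ (blocks n b).card * ε + near.card * M := by
      have hb : ∀ l ∈ blocks n b, |F k l| ≤ ε +
          if |((k.1 : ℝ) - l.1)| < τ * b.1 ∨ |((k.2 : ℝ) - l.2)| < τ * b.2 then M else 0 := by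
        intro l _
        split_ifs with hl
        · linarith [hM k l]
        · push Not at hl
          linarith [hF k l hl.1 hl.2]
      refine (Finset.sum_le_sum hb).trans (le_of_eq ?_)
      rw [Finset.sum_add_distrib, ← Finset.sum_filter, Finset.sum_const, Finset.sum_const,
        nsmul_eq_mul, nsmul_eq_mul]
    rw [blockAvg, inv_mul_le_iff₀ hc]
    refine hsum.trans ?_
    rw [hR, mul_add]
    refine add_le_add le_rfl ?_
    have := mul_le_mul_of_nonneg_right hnc hM0
    refine this.trans (le_of_eq ?_)
    rw [hcard]
    field_simp
  refine (abs_blockAvg_le _).trans ((blockAvg_mono inner).trans ?_)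
  rw [blockAvg_const hne]

end BlockAverages

/-! ### The threshold between near and distant blocks. -/

section Regime

variable {n b : ℕ → ℕ × ℕ}

lemma eventually_le_of_ratio (hn : Tendsto n atTop atTop)
    (h₁ : Tendsto (fun m => ((b m).1 : ℝ) / (n m).1) atTop (𝓝 0))
    (h₂ : Tendsto (fun m => ((b m).2 : ℝ) / (n m).2) atTop (𝓝 0)) :
    ∀ᶠ m in atTop, (b m).1 ≤ (n m).1 ∧ (b m).2 ≤ (n m).2 := by
  filter_upwards [eventually_pos hn, h₁.eventually (gt_mem_nhds one_pos),
    h₂.eventually (gt_mem_nhds one_pos)] with m hm a1 a2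
  have p1 : (0 : ℝ) < (n m).1 := by exact_mod_cast hm.1
  have p2 : (0 : ℝ) < (n m).2 := by exact_mod_cast hm.2
  rw [div_lt_one p1] at a1
  rw [div_lt_one p2] at a2
  exact ⟨by exact_mod_cast a1.le, by exact_mod_cast a2.le⟩

lemma eventually_blocks_nonempty (hn : Tendsto n atTop atTop)
    (h₁ : Tendsto (fun m => ((b m).1 : ℝ) / (n m).1) atTop (𝓝 0))
    (h₂ : Tendsto (fun m => ((b m).2 : ℝ) / (n m).2) atTop (𝓝 0)) :
    ∀ᶠ m in atTop, (blocks (n m) (b m)).Nonempty := by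
  filter_upwards [eventually_le_of_ratio hn h₁ h₂] with m hm
  refine ⟨0, ?_⟩
  simp [blocks]
  omega

/-- The distance threshold, in multiples of the block size, beyond which blocks count as
distant. -/
def threshold (n b : ℕ × ℕ) : ℝ := (√((b.1 : ℝ) / n.1 + (b.2 : ℝ) / n.2))⁻¹

lemma tendsto_threshold (hn : Tendsto n atTop atTop) (hb : Tendsto b atTop atTop)
    (h₁ : Tendsto (fun m => ((b m).1 : ℝ) / (n m).1) atTop (𝓝 0))
    (h₂ : Tendsto (fun m => ((b m).2 : ℝ) / (n m).2) atTop (𝓝 0)) :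
    Tendsto (fun m => threshold (n m) (b m)) atTop atTop := by
  have h := (Real.continuous_sqrt.tendsto _).comp (h₁.add h₂)
  rw [add_zero, Real.sqrt_zero] at h
  refine Tendsto.inv_tendsto_nhdsGT_zero (tendsto_nhdsWithin_iff.2 ⟨h, ?_⟩)
  filter_upwards [eventually_pos hn, eventually_pos hb] with m hm hbm
  have p1 : (0 : ℝ) < (n m).1 := by exact_mod_cast hm.1
  have p2 : (0 : ℝ) < (b m).1 := by exact_mod_cast hbm.1
  have : (0 : ℝ) < ((b m).1 : ℝ) / (n m).1 + ((b m).2 : ℝ) / (n m).2 := by positivity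
  exact Real.sqrt_pos.2 this

/-- With `s = b₁/n₁ + b₂/n₂` the threshold is `s^(-1/2)`. It diverges, yet the strip proportions
`threshold * bᵢ/nᵢ` are at most `s^(1/2)` and vanish. -/
lemma tendsto_near_fraction (hn : Tendsto n atTop atTop)
    (h₁ : Tendsto (fun m => ((b m).1 : ℝ) / (n m).1) atTop (𝓝 0))
    (h₂ : Tendsto (fun m => ((b m).2 : ℝ) / (n m).2) atTop (𝓝 0)) :
    Tendsto (fun m => (2 * (threshold (n m) (b m) * (b m).1) + 1) / ((n m).1 - (b m).1 + 1) +
      (2 * (threshold (n m) (b m) * (b m).2) + 1) / ((n m).2 - (b m).2 + 1)) atTop (𝓝 0) := by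
  have hsq := (Real.continuous_sqrt.tendsto _).comp (h₁.add h₂)
  rw [add_zero, Real.sqrt_zero] at hsq
  have aux : ∀ (N B : ℕ → ℕ), Tendsto (fun m => (N m : ℝ)) atTop atTop →
      Tendsto (fun m => (B m : ℝ) / N m) atTop (𝓝 0) →
      (∀ m, (B m : ℝ) / N m ≤ ((b m).1 : ℝ) / (n m).1 + ((b m).2 : ℝ) / (n m).2) →
      Tendsto (fun m => (2 * (threshold (n m) (b m) * B m) + 1) / ((N m : ℝ) - B m + 1)) atTop
        (𝓝 0) := by
    intro N B hN hB hle
    have hτ : Tendsto (fun m => threshold (n m) (b m) * (B m / N m)) atTop (𝓝 0) := by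
      refine squeeze_zero (fun m => by unfold threshold; positivity) (fun m => ?_) hsq
      simp only [threshold, Function.comp_apply]
      set s := ((b m).1 : ℝ) / (n m).1 + ((b m).2 : ℝ) / (n m).2
      have hs : 0 ≤ s := by positivity
      calc (√s)⁻¹ * (B m / N m) ≤ (√s)⁻¹ * s := by gcongr; exact hle m
        _ = √s := by
          rcases hs.eq_or_lt with h | h
          · rw [← h]; simp
          · rw [inv_mul_eq_div, Real.div_sqrt]
    have hinv : Tendsto (fun m => 1 / (N m : ℝ)) atTop (𝓝 0) := hN.const_div_atTop 1
    have hq : Tendsto (fun m => (2 * (threshold (n m) (b m) * (B m / N m)) + 1 / N m) /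
        (1 - B m / N m + 1 / N m)) atTop (𝓝 ((2 * 0 + 0) / (1 - 0 + 0))) :=
      ((hτ.const_mul 2).add hinv).div ((tendsto_const_nhds.sub hB).add hinv) (by norm_num)
    simp only [mul_zero, add_zero, sub_zero, zero_div] at hq
    refine hq.congr' ?_
    filter_upwards [hN.eventually_gt_atTop 0] with m hm
    rw [show 2 * (threshold (n m) (b m) * (B m / N m)) + 1 / N m =
      (2 * (threshold (n m) (b m) * B m) + 1) / N m by ring,
      show (1 : ℝ) - B m / N m + 1 / N m = (N m - B m + 1) / N m by field_simp]
    exact div_div_div_cancel_right₀ hm.ne' _ _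
  have t1 := aux (fun m => (n m).1) (fun m => (b m).1) (tendsto_fst_snd hn).1 h₁ fun m => by
    have : (0 : ℝ) ≤ ((b m).2 : ℝ) / (n m).2 := by positivity
    linarith
  have t2 := aux (fun m => (n m).2) (fun m => (b m).2) (tendsto_fst_snd hn).2 h₂ fun m => by
    have : (0 : ℝ) ≤ ((b m).1 : ℝ) / (n m).1 := by positivity
    linarith
  simpa using t1.add t2

end Regime

/-! ### Truncation. -/

section Clip

/-- Truncation at level `K`. -/
def clip (K x : ℝ) : ℝ := max (-K) (min x K)

lemma continuous_clip (K : ℝ) : Continuous (clip K) := by unfold clip; fun_prop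

lemma abs_clip_le {K : ℝ} (hK : 0 ≤ K) (x : ℝ) : |clip K x| ≤ K := by
  unfold clip
  rw [abs_le]
  exact ⟨le_max_left _ _, max_le (by linarith) (min_le_right _ _)⟩

lemma clip_eq {K x : ℝ} (h : |x| ≤ K) : clip K x = x := by
  rw [abs_le] at h
  simp [clip, h.1, h.2]

/-- The difference of the two sides is `2 c (x - c)` with `c = clip K x`, and the overshoot `x - c`
has the sign of `c`. Thus the squared truncation error is controlled by the loss of second moment
alone. -/
lemma sub_clip_sq_le {K : ℝ} (hK : 0 ≤ K) (x : ℝ) : (x - clip K x) ^ 2 ≤ x ^ 2 - clip K x ^ 2 := by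
  unfold clip
  rcases le_total x K with h | h
  · rw [min_eq_left h]
    rcases le_total (-K) x with h' | h'
    · rw [max_eq_right h']; simp
    · rw [max_eq_left h']; nlinarith
  · rw [min_eq_right h, max_eq_right (by linarith)]; nlinarith

lemma clip_sq_le {K : ℝ} (hK : 0 ≤ K) (x : ℝ) : clip K x ^ 2 ≤ x ^ 2 := by
  have := sub_clip_sq_le hK x
  have := sq_nonneg (x - clip K x)
  linarith

lemma abs_sub_clip_mul_le {K : ℝ} (hK : 0 ≤ K) (x : ℝ) : |x - clip K x| * K ≤ x ^ 2 := by
  unfold clip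
  rcases le_total x K with h | h
  · rw [min_eq_left h]
    rcases le_total (-K) x with h' | h'
    · rw [max_eq_right h']; simp; positivity
    · rw [max_eq_left h', abs_of_nonpos (by linarith)]; nlinarith
  · rw [min_eq_right h, max_eq_right (by linarith), abs_of_nonneg (by linarith)]; nlinarith

/-- The truncation error of the second moment vanishes. -/
lemma tendsto_integral_sub_clip {ν : Measure ℝ} [IsProbabilityMeasure ν]
    (hν : Integrable (fun x => x ^ 2) ν) :
    Tendsto (fun K : ℕ => ∫ x, (x ^ 2 - clip K x ^ 2) ∂ν) atTop (𝓝 0) := by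
  have h := tendsto_integral_of_dominated_convergence (μ := ν) (fun x : ℝ => x ^ 2)
    (F := fun (K : ℕ) x => x ^ 2 - clip K x ^ 2) (f := fun _ => 0) (fun K => ?_) hν (fun K => ?_) ?_
  · simpa using h
  · have := continuous_clip K
    exact Continuous.aestronglyMeasurable (by fun_prop)
  · refine .of_forall fun x => ?_
    have h1 := clip_sq_le (Nat.cast_nonneg K) x
    rw [Real.norm_eq_abs, abs_of_nonneg (by linarith)]
    linarith [sq_nonneg (clip K x)]
  · refine .of_forall fun x => ?_
    refine tendsto_const_nhds.congr' ?_
    filter_upwards [eventually_ge_atTop ⌈|x|⌉₊] with K hK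
    rw [clip_eq (Nat.ceil_le.1 hK)]; simp

end Clip

/-! ### Consistency of empirical variances over asymptotically independent blocks. -/

section PairLimits

variable {Ω : Type*} [MeasurableSpace Ω] {P : Measure Ω} [IsProbabilityMeasure P]
  {X : ℕ → ℤ × ℤ → Ω → ℝ} {n b : ℕ → ℕ × ℕ} {ν : Measure ℝ} [IsProbabilityMeasure ν]

/-- Statistics on distant blocks are asymptotically independent with law `ν`. -/
def PairLimit (P : Measure Ω) (X : ℕ → ℤ × ℤ → Ω → ℝ) (b : ℕ → ℕ × ℕ) (ν : Measure ℝ) : Prop :=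
  ∀ j k : ℕ → ℤ × ℤ,
    Tendsto (fun m => |((j m).1 - (k m).1 : ℝ)| / (b m).1) atTop atTop →
    Tendsto (fun m => |((j m).2 - (k m).2 : ℝ)| / (b m).2) atTop atTop →
    ∀ G : BoundedContinuousFunction (ℝ × ℝ) ℝ,
      Tendsto (fun m => ∫ x, G (X m (j m) x, X m (k m) x) ∂P) atTop
        (𝓝 (∫ z, G z ∂(ν.prod ν)))

/-- The limit over distant pairs is uniform. -/
lemma PairLimit.uniform (hX : PairLimit P X b ν) (hb : Tendsto b atTop atTop)
    {τ : ℕ → ℝ} (hτ : Tendsto τ atTop atTop) {G : BoundedContinuousFunction (ℝ × ℝ) ℝ}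
    (hG : ∫ z, G z ∂(ν.prod ν) = 0) {ε : ℝ} (hε : 0 < ε) :
    ∀ᶠ m in atTop, ∀ j k : ℤ × ℤ, τ m * (b m).1 ≤ |((j.1 : ℝ) - k.1)| →
      τ m * (b m).2 ≤ |((j.2 : ℝ) - k.2)| → |∫ x, G (X m j x, X m k x) ∂P| ≤ ε := by
  -- For each `m` a distant pair violating the bound is selected if there is one, and any distant
  -- pair otherwise. The sequential hypothesis along these pairs excludes violations for large `m`.
  have hex : ∀ m, ∃ jk : (ℤ × ℤ) × (ℤ × ℤ), (τ m * (b m).1 ≤ |((jk.1.1 : ℝ) - jk.2.1)| ∧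
      τ m * (b m).2 ≤ |((jk.1.2 : ℝ) - jk.2.2)|) ∧
      ((∃ j k : ℤ × ℤ, τ m * (b m).1 ≤ |((j.1 : ℝ) - k.1)| ∧
        τ m * (b m).2 ≤ |((j.2 : ℝ) - k.2)| ∧ ε < |∫ x, G (X m j x, X m k x) ∂P|) →
        ε < |∫ x, G (X m jk.1 x, X m jk.2 x) ∂P|) := by
    intro m
    by_cases h : ∃ j k : ℤ × ℤ, τ m * (b m).1 ≤ |((j.1 : ℝ) - k.1)| ∧
        τ m * (b m).2 ≤ |((j.2 : ℝ) - k.2)| ∧ ε < |∫ x, G (X m j x, X m k x) ∂P|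
    · obtain ⟨j, k, h1, h2, h3⟩ := h
      exact ⟨(j, k), ⟨h1, h2⟩, fun _ => h3⟩
    · refine ⟨((⌈τ m * (b m).1⌉, ⌈τ m * (b m).2⌉), 0), ⟨?_, ?_⟩, fun h' => absurd h' h⟩
      · simpa using (Int.le_ceil _).trans (le_abs_self _)
      · simpa using (Int.le_ceil _).trans (le_abs_self _)
  choose jk hjk hbad using hex
  have far1 : Tendsto (fun m => |((jk m).1.1 - (jk m).2.1 : ℝ)| / (b m).1) atTop atTop := by
    refine tendsto_atTop_mono' _ ?_ hτ
    filter_upwards [eventually_pos hb] with m hm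
    have : (0 : ℝ) < (b m).1 := by exact_mod_cast hm.1
    rw [le_div_iff₀ this]
    exact (hjk m).1
  have far2 : Tendsto (fun m => |((jk m).1.2 - (jk m).2.2 : ℝ)| / (b m).2) atTop atTop := by
    refine tendsto_atTop_mono' _ ?_ hτ
    filter_upwards [eventually_pos hb] with m hm
    have : (0 : ℝ) < (b m).2 := by exact_mod_cast hm.2
    rw [le_div_iff₀ this]
    exact (hjk m).2
  have hlim := (hX (fun m => (jk m).1) (fun m => (jk m).2) far1 far2 G).abs
  rw [hG, abs_zero] at hlim
  filter_upwards [hlim.eventually (gt_mem_nhds hε)] with m hm j k h1 h2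
  by_contra hcon
  exact absurd (hbad m ⟨j, k, h1, h2, not_le.1 hcon⟩) (not_lt.2 hm.le)

/-- Pointwise `|y| ≤ δ + y²/δ`. -/
lemma integral_abs_le_of_sq {Y : Ω → ℝ} (hY : MemLp Y 2 P) {δ : ℝ} (hδ : 0 < δ) :
    ∫ x, |Y x| ∂P ≤ δ + δ⁻¹ * ∫ x, Y x ^ 2 ∂P := by
  have h2 := hY.integrable_sq
  calc ∫ x, |Y x| ∂P ≤ ∫ x, (δ + δ⁻¹ * Y x ^ 2) ∂P := by
        refine integral_mono (hY.integrable (by norm_num)).abs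
          ((integrable_const _).add (h2.const_mul _)) fun x => ?_
        have : |Y x| * δ ≤ δ * δ + Y x ^ 2 := by
          rw [← sq_abs]
          nlinarith [sq_nonneg (|Y x| - δ), abs_nonneg (Y x)]
        calc |Y x| = δ⁻¹ * (|Y x| * δ) := by field_simp
          _ ≤ δ⁻¹ * (δ * δ + Y x ^ 2) := by gcongr
          _ = δ + δ⁻¹ * Y x ^ 2 := by field_simp
    _ = _ := by
        rw [integral_add (integrable_const _) (h2.const_mul _), integral_const_mul]
        simp

/-- Convergence in mean square implies convergence in mean. -/
lemma tendsto_integral_abs {Y : ℕ → Ω → ℝ} (hY : ∀ᶠ m in atTop, MemLp (Y m) 2 P)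
    (h : Tendsto (fun m => ∫ x, Y m x ^ 2 ∂P) atTop (𝓝 0)) :
    Tendsto (fun m => ∫ x, |Y m x| ∂P) atTop (𝓝 0) := by
  rw [tendsto_order]
  refine ⟨fun a ha => .of_forall fun m => ha.trans_le (integral_nonneg fun x => abs_nonneg _),
    fun ε hε => ?_⟩
  have h' := h.const_mul (ε / 2)⁻¹
  rw [mul_zero] at h'
  filter_upwards [hY, h'.eventually (gt_mem_nhds (half_pos hε))] with m hm h2
  linarith [integral_abs_le_of_sq hm (half_pos hε)]

lemma add_add_sq_le (a b c : ℝ) : (a + b + c) ^ 2 ≤ 3 * (a ^ 2 + b ^ 2 + c ^ 2) := by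
  nlinarith [sq_nonneg (a - b), sq_nonneg (b - c), sq_nonneg (a - c)]

lemma abs_add_sub_le {a b c : ℝ} (ha : 0 ≤ a) (hc : 0 ≤ c) : |a + b - c| ≤ a + |b| + c := by
  have h1 := neg_abs_le b
  have h2 := le_abs_self b
  rw [abs_le]
  constructor <;> linarith

/-- Truncation error of block averages of first and second moments. -/
lemma blockAvg_clip_bounds {X : ℤ × ℤ → Ω → ℝ} {n b : ℕ × ℕ} (hne : (blocks n b).Nonempty)
    (hL : ∀ k, MemLp (X k) 2 P) {e K T c₁ c₂ μ₁ μ₂ : ℝ} (hK : 0 ≤ K)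
    (he : ∀ k, ∫ x, X k x ^ 2 ∂P = e) (hT : T = μ₂ - c₂) (hT0 : 0 ≤ T) (hc : (c₁ - μ₁) ^ 2 ≤ T) :
    ∫ x, |blockAvg n b (fun k => X k x ^ 2) - μ₂| ∂P ≤
        (e - ∫ x, blockAvg n b (fun k => clip K (X k x) ^ 2) ∂P) +
          ∫ x, |blockAvg n b (fun k => clip K (X k x) ^ 2) - c₂| ∂P + T ∧
      ∫ x, (blockAvg n b (fun k => X k x) - μ₁) ^ 2 ∂P ≤
        3 * ((e - ∫ x, blockAvg n b (fun k => clip K (X k x) ^ 2) ∂P) +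
          ∫ x, (blockAvg n b (fun k => clip K (X k x)) - c₁) ^ 2 ∂P + T) := by
  have hcc := continuous_clip K
  have iX2 : ∀ k, Integrable (fun x => X k x ^ 2) P := fun k => (hL k).integrable_sq
  have hcb2 : ∀ x, |clip K x ^ 2| ≤ K ^ 2 := fun x => by
    rw [abs_pow]; exact pow_le_pow_left₀ (abs_nonneg _) (abs_clip_le hK x) 2
  have iC2 : ∀ k, Integrable (fun x => clip K (X k x) ^ 2) P := fun k =>
    Integrable.of_bound ((hcc.pow 2).comp_aestronglyMeasurable (hL k).aestronglyMeasurable)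
      (K ^ 2) (.of_forall fun x => hcb2 _)
  have mC : ∀ k, MemLp (fun x => clip K (X k x)) 2 P := fun k =>
    MemLp.of_bound (hcc.comp_aestronglyMeasurable (hL k).aestronglyMeasurable)
      K (.of_forall fun x => abs_clip_le hK _)
  -- `Y` is the second moment lost by truncation. It is nonnegative, so its mean absolute value is
  -- just its mean, which the exact second moment `e` makes computable.
  obtain ⟨Y, hY⟩ : ∃ Y : Ω → ℝ, ∀ x, Y x =
    blockAvg n b (fun k => X k x ^ 2) - blockAvg n b (fun k => clip K (X k x) ^ 2) :=
    ⟨_, fun _ => rfl⟩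
  have iY : Integrable Y P := by
    rw [funext hY]; exact (integrable_blockAvg iX2).sub (integrable_blockAvg iC2)
  have eY : e - ∫ x, blockAvg n b (fun k => clip K (X k x) ^ 2) ∂P = ∫ x, Y x ∂P := by
    simp only [hY]
    rw [integral_sub (integrable_blockAvg iX2) (integrable_blockAvg iC2), integral_blockAvg iX2]
    simp_rw [he]
    rw [blockAvg_const hne]
  have hY0 : ∀ x, 0 ≤ Y x := fun x => by
    rw [hY, sub_nonneg]; exact blockAvg_mono fun k => clip_sq_le hK _
  obtain ⟨A₂, hA₂⟩ : ∃ A : Ω → ℝ, ∀ x, A x = blockAvg n b (fun k => clip K (X k x) ^ 2) - c₂ :=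
    ⟨_, fun _ => rfl⟩
  obtain ⟨A₁, hA₁⟩ : ∃ A : Ω → ℝ, ∀ x, A x = blockAvg n b (fun k => clip K (X k x)) - c₁ :=
    ⟨_, fun _ => rfl⟩
  have iA₂ : Integrable (fun x => |A₂ x|) P := by
    simp only [hA₂]; exact ((integrable_blockAvg iC2).sub (integrable_const _)).abs
  have iA₁ : Integrable (fun x => A₁ x ^ 2) P := by
    simp only [hA₁]; exact ((memLp_blockAvg mC).sub (memLp_const _)).integrable_sq
  simp only [← hA₁, ← hA₂, eY]
  have hY2 : Integrable (fun x => Y x + |A₂ x|) P := iY.add iA₂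
  have hY1 : Integrable (fun x => Y x + A₁ x ^ 2) P := iY.add iA₁
  constructor
  · calc ∫ x, |blockAvg n b (fun k => X k x ^ 2) - μ₂| ∂P ≤ ∫ x, (Y x + |A₂ x| + T) ∂P := by
          refine integral_mono ((integrable_blockAvg iX2).sub (integrable_const _)).abs
            (hY2.add (integrable_const _)) fun x => ?_
          have e1 : blockAvg n b (fun k => X k x ^ 2) - μ₂ = Y x + A₂ x - T := by
            rw [hY, hA₂, hT]; ring
          show |blockAvg n b (fun k => X k x ^ 2) - μ₂| ≤ Y x + |A₂ x| + T
          rw [e1]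
          exact abs_add_sub_le (hY0 x) hT0
      _ = _ := by
          rw [integral_add hY2 (integrable_const _), integral_add iY iA₂]
          simp
  · calc ∫ x, (blockAvg n b (fun k => X k x) - μ₁) ^ 2 ∂P ≤ ∫ x, 3 * (Y x + A₁ x ^ 2 + T) ∂P := by
          refine integral_mono ((memLp_blockAvg hL).sub (memLp_const _)).integrable_sq
            ((hY1.add (integrable_const _)).const_mul 3) fun x => ?_
          have e1 : blockAvg n b (fun k => X k x) - μ₁ =
              blockAvg n b (fun k => X k x - clip K (X k x)) + A₁ x + (c₁ - μ₁) := by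
            rw [hA₁, blockAvg_sub]; ring
          -- The Cauchy–Schwarz inequality over the blocks, then the pointwise bound on the squared
          -- truncation error.
          have e2 : blockAvg n b (fun k => X k x - clip K (X k x)) ^ 2 ≤ Y x := by
            rw [hY, ← blockAvg_sub]
            exact (sq_blockAvg_le _).trans (blockAvg_mono fun k => sub_clip_sq_le hK _)
          show (blockAvg n b (fun k => X k x) - μ₁) ^ 2 ≤ 3 * (Y x + A₁ x ^ 2 + T)
          rw [e1]
          refine (add_add_sq_le _ _ _).trans ?_
          gcongr
      _ = _ := by
          rw [integral_const_mul, integral_add hY1 (integrable_const _), integral_add iY iA₁]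
          simp

variable (hX : PairLimit P X b ν) (hn : Tendsto n atTop atTop) (hb : Tendsto b atTop atTop)
  (h₁ : Tendsto (fun m => ((b m).1 : ℝ) / (n m).1) atTop (𝓝 0))
  (h₂ : Tendsto (fun m => ((b m).2 : ℝ) / (n m).2) atTop (𝓝 0))
include hX hn hb h₁ h₂

/-- Block averages of a bounded continuous function converge in mean square. -/
lemma PairLimit.tendsto_bounded
    (hm : ∀ᶠ m in atTop, ∀ k, AEStronglyMeasurable (X m k) P)
    {φ : ℝ → ℝ} (hφ : Continuous φ) {M : ℝ} (hM : ∀ x, |φ x| ≤ M) :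
    Tendsto (fun m => ∫ x, (blockAvg (n m) (b m) (fun k => φ (X m k x)) - ∫ y, φ y ∂ν) ^ 2 ∂P)
      atTop (𝓝 0) := by
  set c := ∫ y, φ y ∂ν with hc
  have hM0 : 0 ≤ M := (abs_nonneg _).trans (hM 0)
  have hcM : |c| ≤ M := by
    have := norm_integral_le_of_norm_le_const (μ := ν) (f := φ) (C := M) (.of_forall hM)
    simpa using this
  have hd : ∀ x, |φ x - c| ≤ 2 * M := fun x => (abs_sub _ _).trans (by linarith [hM x])
  have hGb : ∀ z : ℝ × ℝ, |(φ z.1 - c) * (φ z.2 - c)| ≤ 2 * M * (2 * M) := fun z => by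
    rw [abs_mul]; exact mul_le_mul (hd _) (hd _) (abs_nonneg _) (by positivity)
  -- The product of two centred values has mean zero under the product law, so far pairs of blocks
  -- are asymptotically uncorrelated.
  let G : BoundedContinuousFunction (ℝ × ℝ) ℝ := BoundedContinuousFunction.ofNormedAddCommGroup
    (fun z => (φ z.1 - c) * (φ z.2 - c)) (by fun_prop) _ hGb
  have hint : Integrable φ ν := Integrable.of_bound hφ.aestronglyMeasurable M (.of_forall hM)
  have hG : ∫ z, G z ∂(ν.prod ν) = 0 := by
    have e : ∫ x, (φ x - c) ∂ν = 0 := by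
      rw [integral_sub hint (integrable_const _)]; simp [hc]
    change ∫ z : ℝ × ℝ, (φ z.1 - c) * (φ z.2 - c) ∂(ν.prod ν) = 0
    rw [integral_prod_mul (fun x => φ x - c) (fun x => φ x - c), e, zero_mul]
  rw [Metric.tendsto_atTop']
  intro ε hε
  have hnear := tendsto_near_fraction hn h₁ h₂
  have hnear' := (hnear.const_mul (2 * M * (2 * M))).eventually
    (gt_mem_nhds (show 2 * M * (2 * M) * 0 < ε / 2 by simpa using by positivity))
  have hev := (((hX.uniform hb (tendsto_threshold hn hb h₁ h₂) hG
    (show 0 < ε / 4 by positivity)).and hnear').and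
    ((eventually_le_of_ratio hn h₁ h₂).and (eventually_blocks_nonempty hn h₁ h₂))).and hm
  obtain ⟨m₀, hm₀⟩ := eventually_atTop.1 hev
  refine ⟨m₀, fun m hm => ?_⟩
  obtain ⟨⟨⟨hu, hnr⟩, hle, hne⟩, hmeas⟩ := hm₀ m hm.le
  have hgm : ∀ k l, Integrable (fun x => (φ (X m k x) - c) * (φ (X m l x) - c)) P := by
    intro k l
    refine Integrable.of_bound ?_ (2 * M * (2 * M)) (.of_forall fun x => hGb (X m k x, X m l x))
    exact ((hφ.comp_aestronglyMeasurable (hmeas k)).sub aestronglyMeasurable_const).mul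
      ((hφ.comp_aestronglyMeasurable (hmeas l)).sub aestronglyMeasurable_const)
  have e : ∫ x, (blockAvg (n m) (b m) (fun k => φ (X m k x)) - c) ^ 2 ∂P =
      blockAvg (n m) (b m) fun k => blockAvg (n m) (b m) fun l =>
        ∫ x, G (X m k x, X m l x) ∂P := by
    have e1 : ∀ x, (blockAvg (n m) (b m) (fun k => φ (X m k x)) - c) ^ 2 =
        blockAvg (n m) (b m) fun k => blockAvg (n m) (b m) fun l =>
          (φ (X m k x) - c) * (φ (X m l x) - c) := by
      intro x
      have e2 : blockAvg (n m) (b m) (fun k => φ (X m k x)) - c =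
          blockAvg (n m) (b m) fun k => φ (X m k x) - c := by
        rw [blockAvg_sub, blockAvg_const hne]
      simp_rw [blockAvg_const_mul, mul_comm _ (blockAvg _ _ _), blockAvg_const_mul]
      rw [e2, sq]
    simp_rw [e1]
    rw [integral_blockAvg fun k => integrable_blockAvg fun l => hgm k l]
    congr 1
    funext k
    rw [integral_blockAvg fun l => hgm k l]
    rfl
  have hbound := abs_blockAvg_pair_le (n := n m) (b := b m) hle
    (F := fun k l => ∫ x, G (X m k x, X m l x) ∂P) (M := 2 * M * (2 * M)) (ε := ε / 4)
    (τ := threshold (n m) (b m)) (fun k l => ?_) (by positivity)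
    (by unfold threshold; positivity) (fun k l => hu k l)
  · rw [dist_zero_right, Real.norm_eq_abs, e]
    linarith
  · have := norm_integral_le_of_norm_le_const (μ := P)
      (f := fun x => G (X m k x, X m l x)) (C := 2 * M * (2 * M))
      (.of_forall fun x => hGb (X m k x, X m l x))
    simpa using this

/-- Block averages of first and second moments converge, with a bound in terms of the truncation
error of the limit law. -/
lemma PairLimit.exists_bound (hL : ∀ᶠ m in atTop, ∀ k, MemLp (X m k) 2 P) {e : ℕ → ℝ}
    (he : ∀ᶠ m in atTop, ∀ k, ∫ x, X m k x ^ 2 ∂P = e m)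
    (hν : Integrable (fun x => x ^ 2) ν) (hlim : Tendsto e atTop (𝓝 (∫ x, x ^ 2 ∂ν))) (K : ℕ) :
    ∃ U : ℕ → ℝ, Tendsto U atTop (𝓝 (6 * ∫ x, (x ^ 2 - clip K x ^ 2) ∂ν)) ∧
      ∀ᶠ m in atTop,
        ∫ x, |blockAvg (n m) (b m) (fun k => X m k x ^ 2) - ∫ y, y ^ 2 ∂ν| ∂P ≤ U m ∧
        ∫ x, (blockAvg (n m) (b m) (fun k => X m k x) - ∫ y, y ∂ν) ^ 2 ∂P ≤ U m := by
  set T := ∫ x, (x ^ 2 - clip K x ^ 2) ∂ν with hT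
  have hK : (0 : ℝ) ≤ K := Nat.cast_nonneg K
  have hcc := continuous_clip K
  have hc2 : Continuous fun x => clip K x ^ 2 := hcc.pow 2
  have hcb := abs_clip_le hK
  have hcb2 : ∀ x, |clip K x ^ 2| ≤ (K : ℝ) ^ 2 := fun x => by
    rw [abs_pow]; exact pow_le_pow_left₀ (abs_nonneg _) (hcb x) 2
  have hm := hL.mono fun m h k => (h k).aestronglyMeasurable
  have iν1 : Integrable (clip K) ν :=
    Integrable.of_bound hcc.aestronglyMeasurable K (.of_forall hcb)
  have iν2 : Integrable (fun x => clip K x ^ 2) ν :=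
    Integrable.of_bound hc2.aestronglyMeasurable ((K : ℝ) ^ 2) (.of_forall hcb2)
  have iν0 : Integrable (fun x : ℝ => x) ν :=
    ((memLp_two_iff_integrable_sq aestronglyMeasurable_id).2 hν).integrable (by norm_num)
  have hTeq : T = ∫ x, x ^ 2 ∂ν - ∫ x, clip K x ^ 2 ∂ν := integral_sub hν iν2
  have hT0 : 0 ≤ T := integral_nonneg fun x => sub_nonneg.2 (clip_sq_le hK x)
  -- Jensen's inequality in the form of a nonnegative variance, followed by the bound on the squared
  -- truncation error.
  have hmean : (∫ y, clip K y ∂ν - ∫ y, y ∂ν) ^ 2 ≤ T := by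
    rw [← integral_sub iν1 iν0]
    have hLp : MemLp (fun y => clip K y - y) 2 ν :=
      (MemLp.of_bound hcc.aestronglyMeasurable K (.of_forall hcb)).sub
        ((memLp_two_iff_integrable_sq aestronglyMeasurable_id).2 hν)
    have h1 := variance_nonneg (fun y => clip K y - y) ν
    rw [variance_eq_sub hLp] at h1
    have h2 : ∫ y, ((fun y => clip K y - y) ^ 2) y ∂ν ≤ T := by
      refine integral_mono hLp.integrable_sq (hν.sub iν2) fun y => ?_
      have := sub_clip_sq_le hK y
      simp only [Pi.pow_apply]
      nlinarith
    linarith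
  have hd := hX.tendsto_bounded hn hb h₁ h₂ hm hcc hcb
  have ha2 := hX.tendsto_bounded hn hb h₁ h₂ hm (φ := fun x => clip K x ^ 2) hc2 hcb2
  have hmemX : ∀ m, (∀ k, MemLp (X m k) 2 P) → ∀ k, MemLp (fun x => clip K (X m k x) ^ 2) 2 P :=
    fun m h k => MemLp.of_bound (hc2.comp_aestronglyMeasurable (h k).aestronglyMeasurable)
      ((K : ℝ) ^ 2) (.of_forall fun x => hcb2 _)
  have ha := tendsto_integral_abs (P := P) (Y := fun m x =>
      blockAvg (n m) (b m) (fun k => clip K (X m k x) ^ 2) - ∫ y, clip K y ^ 2 ∂ν)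
    (hL.mono fun m h => (memLp_blockAvg fun k => hmemX m h k).sub (memLp_const _)) ha2
  have hA : Tendsto (fun m => ∫ x, blockAvg (n m) (b m) (fun k => clip K (X m k x) ^ 2) ∂P) atTop
      (𝓝 (∫ y, clip K y ^ 2 ∂ν)) := by
    rw [tendsto_iff_dist_tendsto_zero]
    refine squeeze_zero' (.of_forall fun _ => dist_nonneg) ?_ ha
    filter_upwards [hL] with m h
    rw [Real.dist_eq]
    have hi := (memLp_blockAvg (n := n m) (b := b m) fun k => hmemX m h k).integrable
      (by norm_num)
    have : ∫ x, blockAvg (n m) (b m) (fun k => clip K (X m k x) ^ 2) ∂P - ∫ y, clip K y ^ 2 ∂ν =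
        ∫ x, (blockAvg (n m) (b m) (fun k => clip K (X m k x) ^ 2) - ∫ y, clip K y ^ 2 ∂ν) ∂P := by
      rw [integral_sub hi (integrable_const _)]; simp
    rw [this]
    exact abs_integral_le_integral_abs
  -- Convergence of the full second moments is used here: the truncated ones converge by
  -- boundedness, hence the loss tends to that of the limit law.
  have hr : Tendsto (fun m => e m -
      ∫ x, blockAvg (n m) (b m) (fun k => clip K (X m k x) ^ 2) ∂P) atTop (𝓝 T) := by
    rw [hTeq]; exact hlim.sub hA
  refine ⟨fun m => 3 * ((e m - ∫ x, blockAvg (n m) (b m) (fun k => clip K (X m k x) ^ 2) ∂P) +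
    ∫ x, |blockAvg (n m) (b m) (fun k => clip K (X m k x) ^ 2) - ∫ y, clip K y ^ 2 ∂ν| ∂P +
    ∫ x, (blockAvg (n m) (b m) (fun k => clip K (X m k x)) - ∫ y, clip K y ∂ν) ^ 2 ∂P + T), ?_, ?_⟩
  · have := (((hr.add ha).add hd).add_const T).const_mul 3
    convert this using 2
    ring
  filter_upwards [hL, he, eventually_blocks_nonempty hn h₁ h₂] with m hLm hem hne
  have hbd := blockAvg_clip_bounds hne hLm hK hem hTeq hT0 hmean
  have n1 : 0 ≤ ∫ x, |blockAvg (n m) (b m) (fun k => X m k x ^ 2) - ∫ y, y ^ 2 ∂ν| ∂P :=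
    integral_nonneg fun x => abs_nonneg _
  have n2 : 0 ≤ ∫ x, |blockAvg (n m) (b m) (fun k => clip K (X m k x) ^ 2) -
      ∫ y, clip K y ^ 2 ∂ν| ∂P := integral_nonneg fun x => abs_nonneg _
  have n3 : 0 ≤ ∫ x, (blockAvg (n m) (b m) (fun k => clip K (X m k x)) -
      ∫ y, clip K y ∂ν) ^ 2 ∂P := integral_nonneg fun x => sq_nonneg _
  constructor
  · linarith [hbd.1]
  · linarith [hbd.2]

/-- Consistency in mean of the empirical variance over blocks. -/
theorem PairLimit.tendsto_blockVar (hL : ∀ᶠ m in atTop, ∀ k, MemLp (X m k) 2 P) {e : ℕ → ℝ}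
    (he : ∀ᶠ m in atTop, ∀ k, ∫ x, X m k x ^ 2 ∂P = e m)
    (hν : Integrable (fun x => x ^ 2) ν) (hlim : Tendsto e atTop (𝓝 (∫ x, x ^ 2 ∂ν))) :
    Tendsto (fun m => ∫ x, |blockAvg (n m) (b m) (fun k =>
        (X m k x - blockAvg (n m) (b m) fun l => X m l x) ^ 2) -
      (∫ y, y ^ 2 ∂ν - (∫ y, y ∂ν) ^ 2)| ∂P) atTop (𝓝 0) := by
  have hT := (tendsto_integral_sub_clip hν).const_mul 6
  rw [mul_zero] at hT
  -- The level `K` is fixed first, making the truncation error of `ν` small; only then does `m` tend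
  -- to infinity.
  have small : ∀ ε > 0, ∀ᶠ m in atTop,
      ∫ x, |blockAvg (n m) (b m) (fun k => X m k x ^ 2) - ∫ y, y ^ 2 ∂ν| ∂P < ε ∧
      ∫ x, (blockAvg (n m) (b m) (fun k => X m k x) - ∫ y, y ∂ν) ^ 2 ∂P < ε := by
    intro ε hε
    obtain ⟨K, hK⟩ := (hT.eventually (gt_mem_nhds hε)).exists
    obtain ⟨U, hU, hle⟩ := hX.exists_bound hn hb h₁ h₂ hL he hν hlim K
    filter_upwards [hle, hU.eventually (gt_mem_nhds hK)] with m h1 h2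
    exact ⟨h1.1.trans_lt h2, h1.2.trans_lt h2⟩
  have hS : Tendsto (fun m => ∫ x, |blockAvg (n m) (b m) (fun k => X m k x ^ 2) -
      ∫ y, y ^ 2 ∂ν| ∂P) atTop (𝓝 0) := by
    rw [tendsto_order]
    exact ⟨fun a ha => .of_forall fun m => ha.trans_le (integral_nonneg fun x => abs_nonneg _),
      fun ε hε => (small ε hε).mono fun m h => h.1⟩
  have hQ : Tendsto (fun m => ∫ x, (blockAvg (n m) (b m) (fun k => X m k x) -
      ∫ y, y ∂ν) ^ 2 ∂P) atTop (𝓝 0) := by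
    rw [tendsto_order]
    exact ⟨fun a ha => .of_forall fun m => ha.trans_le (integral_nonneg fun x => sq_nonneg _),
      fun ε hε => (small ε hε).mono fun m h => h.2⟩
  have hQ1 := tendsto_integral_abs (P := P) (Y := fun m x =>
      blockAvg (n m) (b m) (fun k => X m k x) - ∫ y, y ∂ν)
    (hL.mono fun m h => (memLp_blockAvg h).sub (memLp_const _)) hQ
  set μ := ∫ y, y ∂ν
  have hsum := (hS.add hQ).add (hQ1.const_mul (2 * |μ|))
  rw [mul_zero, add_zero, add_zero] at hsum
  refine squeeze_zero' (.of_forall fun m => integral_nonneg fun x => abs_nonneg _) ?_ hsum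
  filter_upwards [hL, eventually_blocks_nonempty hn h₁ h₂] with m hLm hne
  have i1 : Integrable (fun x => |blockAvg (n m) (b m) (fun k => X m k x ^ 2) -
      ∫ y, y ^ 2 ∂ν|) P :=
    ((integrable_blockAvg fun k => (hLm k).integrable_sq).sub (integrable_const _)).abs
  have mD : MemLp (fun x => blockAvg (n m) (b m) (fun k => X m k x) - μ) 2 P :=
    (memLp_blockAvg hLm).sub (memLp_const _)
  have i2 := mD.integrable_sq
  have i3 : Integrable (fun x => |blockAvg (n m) (b m) (fun k => X m k x) - μ|) P :=
    (mD.integrable (by norm_num)).abs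
  have i12 : Integrable (fun x => |blockAvg (n m) (b m) (fun k => X m k x ^ 2) -
      ∫ y, y ^ 2 ∂ν| + (blockAvg (n m) (b m) (fun k => X m k x) - μ) ^ 2) P := i1.add i2
  rw [← integral_const_mul, ← integral_add i1 i2, ← integral_add i12 (i3.const_mul _)]
  have hpt : ∀ x, |blockAvg (n m) (b m) (fun k =>
        (X m k x - blockAvg (n m) (b m) fun l => X m l x) ^ 2) - (∫ y, y ^ 2 ∂ν - μ ^ 2)| ≤
      |blockAvg (n m) (b m) (fun k => X m k x ^ 2) - ∫ y, y ^ 2 ∂ν| +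
        (blockAvg (n m) (b m) (fun k => X m k x) - μ) ^ 2 +
        2 * |μ| * |blockAvg (n m) (b m) (fun k => X m k x) - μ| := by
    intro x
    rw [blockAvg_sub_sq hne]
    set s := blockAvg (n m) (b m) (fun k => X m k x ^ 2)
    set a := blockAvg (n m) (b m) (fun k => X m k x)
    have e1 : s - a ^ 2 - (∫ y, y ^ 2 ∂ν - μ ^ 2) =
        (s - ∫ y, y ^ 2 ∂ν) + (-(a - μ) ^ 2 + -(2 * μ * (a - μ))) := by ring
    rw [e1]
    refine (abs_add_le _ _).trans ?_
    have h2 := abs_add_le (-(a - μ) ^ 2) (-(2 * μ * (a - μ)))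
    rw [abs_neg, abs_neg, abs_of_nonneg (sq_nonneg (a - μ)), abs_mul, abs_mul, abs_two] at h2
    linarith
  refine integral_mono_of_nonneg (.of_forall fun x => abs_nonneg _)
    (i12.add (i3.const_mul _)) (.of_forall hpt)

end PairLimits

/-! ### Moments of the standard exponential law. -/

section Exponential

lemma stdExp_eq : stdExp =
    (volume.restrict (Set.Ioi 0)).withDensity fun x => ENNReal.ofReal (Real.exp (-x)) := by
  have h : gammaPDF 1 1 =
      (Set.Ici (0 : ℝ)).indicator fun x => ENNReal.ofReal (Real.exp (-x)) := by
    funext x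
    by_cases hx : 0 ≤ x
    · rw [gammaPDF_of_nonneg hx, Set.indicator_of_mem (Set.mem_Ici.2 hx)]
      simp
    · rw [gammaPDF_of_neg (not_le.1 hx), Set.indicator_of_notMem (by simpa using hx)]
  rw [stdExp, expMeasure, gammaMeasure, h, withDensity_indicator measurableSet_Ici,
    restrict_Ioi_eq_restrict_Ici]

lemma integral_stdExp (g : ℝ → ℝ) :
    ∫ x, g x ∂stdExp = ∫ x in Set.Ioi 0, Real.exp (-x) * g x := by
  rw [stdExp_eq, integral_withDensity_eq_integral_toReal_smul (by fun_prop) (by simp)]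
  simp [ENNReal.toReal_ofReal (Real.exp_pos _).le]

lemma integrable_pow_stdExp (k : ℕ) : Integrable (fun x => x ^ k) stdExp := by
  rw [stdExp_eq, integrable_withDensity_iff (by fun_prop) (by simp)]
  have h := Real.GammaIntegral_convergent (s := k + 1) (by positivity)
  refine h.congr ?_
  filter_upwards with x
  rw [ENNReal.toReal_ofReal (Real.exp_pos _).le]
  simp [mul_comm]

lemma integral_pow_stdExp (k : ℕ) : ∫ x, x ^ k ∂stdExp = k.factorial := by
  rw [integral_stdExp, ← Real.Gamma_nat_eq_factorial, Real.Gamma_eq_integral (by positivity)]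
  simp

end Exponential

/-! ### Convergence of means from weak convergence and bounded variances. -/

section Means

variable {Ω : Type*} [MeasurableSpace Ω] {P : Measure Ω} [IsProbabilityMeasure P]

/-- Integrals of bounded continuous functions converge under convergence in distribution. -/
lemma tendsto_integral_of_tendstoInDistribution {E Ω' : Type*} [TopologicalSpace E]
    [MeasurableSpace E] [OpensMeasurableSpace E] [MeasurableSpace Ω'] {ρ : Measure Ω'}
    [IsProbabilityMeasure ρ] {X : ℕ → Ω → E} {Y : Ω' → E}
    (h : TendstoInDistribution X atTop Y (fun _ => P) ρ) (G : BoundedContinuousFunction E ℝ) :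
    Tendsto (fun m => ∫ x, G (X m x) ∂P) atTop (𝓝 (∫ y, G y ∂(ρ.map Y))) := by
  have h1 := ProbabilityMeasure.tendsto_iff_forall_integral_tendsto.1 h.tendsto G
  refine h1.congr fun m => ?_
  exact integral_map (h.forall_aemeasurable m) G.continuous.measurable.aestronglyMeasurable

variable {X : ℕ → Ω → ℝ} {ν : Measure ℝ} [IsProbabilityMeasure ν]

lemma min_abs_le (x β K : ℝ) : min |β| K ≤ min |x| K + |x - β| := by
  have h : |β| ≤ |x| + |x - β| := by
    have := abs_sub_abs_le_abs_sub β x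
    rw [abs_sub_comm] at this
    linarith
  rcases le_total |x| K with h' | h'
  · rw [min_eq_left h']; exact (min_le_left _ _).trans h
  · rw [min_eq_right h']; exact (min_le_right _ _).trans (by linarith [abs_nonneg (x - β)])

/-- If the laws converge weakly and the variances are bounded, then the means are bounded. -/
lemma eventually_abs_integral_le (hX : ∀ᶠ m in atTop, MemLp (X m) 2 P) {v : ℝ}
    (hV : ∀ᶠ m in atTop, Var[X m; P] ≤ v) (hν : Integrable (fun x => x ^ 2) ν)
    (hlim : ∀ G : BoundedContinuousFunction ℝ ℝ,
      Tendsto (fun m => ∫ x, G (X m x) ∂P) atTop (𝓝 (∫ y, G y ∂ν))) :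
    ∃ B, ∀ᶠ m in atTop, |∫ x, X m x ∂P| ≤ B := by
  have iν0 : Integrable (fun x : ℝ => x) ν :=
    ((memLp_two_iff_integrable_sq aestronglyMeasurable_id).2 hν).integrable (by norm_num)
  set a := ∫ y, |y| ∂ν with ha
  have ha0 : 0 ≤ a := integral_nonneg fun y => abs_nonneg y
  -- The mean of `min |X| K` is eventually below `a + 1` and the mean deviation is at most `1 + v`.
  -- The extra one makes `min |β| K` strictly less than `K`, so the minimum must be `|β|`.
  set K := a + 1 + (1 + |v|) + 1 with hKdef
  have hK0 : 0 ≤ K := by positivity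
  have hGb : ∀ x, |min |x| K| ≤ K := fun x => by
    rw [abs_of_nonneg (le_min (abs_nonneg _) hK0)]; exact min_le_right _ _
  let G : BoundedContinuousFunction ℝ ℝ := BoundedContinuousFunction.ofNormedAddCommGroup
    (fun x => min |x| K) (by fun_prop) K hGb
  have hGle : ∫ y, G y ∂ν ≤ a :=
    integral_mono (G.integrable ν) iν0.abs fun y => min_le_left _ _
  have hev := (hlim G).eventually (gt_mem_nhds (show ∫ y, G y ∂ν < a + 1 by linarith))
  refine ⟨K, ?_⟩
  filter_upwards [hX, hV, hev] with m hm hv hG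
  set β := ∫ x, X m x ∂P with hβ
  have hi := hm.integrable (by norm_num : (1 : ENNReal) ≤ 2)
  have hsub : MemLp (fun x => X m x - β) 2 P := hm.sub (memLp_const _)
  have h1 : ∫ x, |X m x - β| ∂P ≤ 1 + Var[X m; P] := by
    have := integral_abs_le_of_sq hsub one_pos
    rw [variance_eq_integral hm.aestronglyMeasurable.aemeasurable]
    simpa using this
  have iG : Integrable (fun x => G (X m x)) P :=
    Integrable.of_bound (G.continuous.comp_aestronglyMeasurable hm.aestronglyMeasurable) K
      (.of_forall fun x => hGb _)
  have h2 : min |β| K ≤ ∫ x, G (X m x) ∂P + ∫ x, |X m x - β| ∂P := by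
    rw [← integral_add iG (hsub.integrable (by norm_num)).abs]
    calc min |β| K = ∫ _, min |β| K ∂P := by simp
      _ ≤ _ := integral_mono (integrable_const _)
          (iG.add (hsub.integrable (by norm_num)).abs) fun x => min_abs_le _ _ _
  have h3 : min |β| K < K := by linarith [le_abs_self v]
  rcases min_lt_iff.1 h3 with h | h
  · exact h.le
  · exact absurd h (lt_irrefl _)

lemma abs_integral_sub_clip_le {Ω : Type*} [MeasurableSpace Ω] {P : Measure Ω}
    [IsProbabilityMeasure P] {Y : Ω → ℝ} (hY : MemLp Y 2 P) {K : ℝ} (hK : 0 < K) :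
    |∫ x, Y x ∂P - ∫ x, clip K (Y x) ∂P| ≤ (∫ x, Y x ^ 2 ∂P) / K := by
  have iC : Integrable (fun x => clip K (Y x)) P :=
    Integrable.of_bound ((continuous_clip K).comp_aestronglyMeasurable hY.aestronglyMeasurable) K
      (.of_forall fun x => abs_clip_le hK.le _)
  have iY := hY.integrable (by norm_num : (1 : ENNReal) ≤ 2)
  rw [← integral_sub iY iC, div_eq_mul_inv, mul_comm, ← integral_const_mul]
  refine abs_integral_le_integral_abs.trans ?_
  refine integral_mono (iY.sub iC).abs (hY.integrable_sq.const_mul _) fun x => ?_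
  have := abs_sub_clip_mul_le hK.le (Y x)
  show |Y x - clip K (Y x)| ≤ K⁻¹ * Y x ^ 2
  rw [inv_mul_eq_div, le_div_iff₀ hK]
  exact this

/-- If the laws converge weakly and the variances are bounded, then the means converge. -/
lemma tendsto_integral_of_variance_le (hX : ∀ᶠ m in atTop, MemLp (X m) 2 P) {v : ℝ}
    (hV : ∀ᶠ m in atTop, Var[X m; P] ≤ v) (hν : Integrable (fun x => x ^ 2) ν)
    (hlim : ∀ G : BoundedContinuousFunction ℝ ℝ,
      Tendsto (fun m => ∫ x, G (X m x) ∂P) atTop (𝓝 (∫ y, G y ∂ν))) :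
    Tendsto (fun m => ∫ x, X m x ∂P) atTop (𝓝 (∫ y, y ∂ν)) := by
  obtain ⟨B, hB⟩ := eventually_abs_integral_le hX hV hν hlim
  have hνL : MemLp (fun x : ℝ => x) 2 ν := (memLp_two_iff_integrable_sq aestronglyMeasurable_id).2 hν
  set S := |v| + B ^ 2 + ∫ y, y ^ 2 ∂ν with hS
  have hS0 : 0 ≤ S := by
    have : 0 ≤ ∫ y, y ^ 2 ∂ν := integral_nonneg fun y => sq_nonneg y
    positivity
  rw [Metric.tendsto_atTop']
  intro ε hε
  -- `S` dominates the second moments of `X m` and of `ν` together, so both truncation errors add up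
  -- to at most `S / K`.
  obtain ⟨K, hK0, hK⟩ : ∃ K : ℝ, 0 < K ∧ S / K < ε / 2 := by
    refine ⟨2 * (S + 1) / ε, by positivity, ?_⟩
    rw [div_div_eq_mul_div, div_lt_iff₀ (by positivity)]
    nlinarith
  let G : BoundedContinuousFunction ℝ ℝ := BoundedContinuousFunction.ofNormedAddCommGroup
    (clip K) (continuous_clip K) K (abs_clip_le hK0.le)
  have hG := Metric.tendsto_nhds.1 (hlim G) (ε / 2) (half_pos hε)
  obtain ⟨m₀, hm₀⟩ := eventually_atTop.1 (((hX.and hV).and hB).and hG)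
  refine ⟨m₀, fun m hm => ?_⟩
  obtain ⟨⟨⟨h1, h2⟩, h3⟩, h4⟩ := hm₀ m hm.le
  have hsq : ∫ x, X m x ^ 2 ∂P ≤ |v| + B ^ 2 := by
    have e := variance_eq_sub h1
    have : (∫ x, X m x ∂P) ^ 2 ≤ B ^ 2 := by
      rw [← sq_abs]; exact pow_le_pow_left₀ (abs_nonneg _) h3 2
    have e2 : ∫ x, X m x ^ 2 ∂P = Var[X m; P] + (∫ x, X m x ∂P) ^ 2 := by rw [e]; simp
    linarith [le_abs_self v]
  have a1 := abs_integral_sub_clip_le h1 hK0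
  have a2 := abs_integral_sub_clip_le hνL hK0
  rw [Real.dist_eq] at h4 ⊢
  have e : ∫ x, X m x ∂P - ∫ y, y ∂ν = (∫ x, X m x ∂P - ∫ x, clip K (X m x) ∂P) +
      (∫ x, clip K (X m x) ∂P - ∫ y, clip K y ∂ν) + -(∫ y, y ∂ν - ∫ y, clip K y ∂ν) := by ring
  have h4' : |∫ x, clip K (X m x) ∂P - ∫ y, clip K y ∂ν| < ε / 2 := h4
  rw [e]
  refine (abs_add_three _ _ _).trans_lt ?_
  rw [abs_neg]
  have : (∫ x, X m x ^ 2 ∂P) / K + (∫ y, y ^ 2 ∂ν) / K ≤ S / K := by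
    rw [← add_div]; gcongr; linarith
  linarith

end Means

/-! ### Consistency of the subsampling variance estimator. -/

section Subsampling

variable {Ω : Type*} [MeasurableSpace Ω] {P : Measure Ω} [IsProbabilityMeasure P]
  {Z : ℤ × ℤ → Ω → ℝ} {ψ : ℝ × ℝ → ℝ} {n b : ℕ → ℕ × ℕ}

/-- Markov's inequality. -/
lemma tendstoInMeasure_of_tendsto_integral_abs {Y : ℕ → Ω → ℝ} {c : ℝ}
    (hi : ∀ᶠ m in atTop, Integrable (Y m) P)
    (h : Tendsto (fun m => ∫ x, |Y m x - c| ∂P) atTop (𝓝 0)) :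
    TendstoInMeasure P Y atTop fun _ => c := by
  rw [tendstoInMeasure_iff_measureReal_dist]
  intro ε hε
  have h' := h.const_mul ε⁻¹
  rw [mul_zero] at h'
  refine squeeze_zero' (.of_forall fun _ => measureReal_nonneg) ?_ h'
  filter_upwards [hi] with m hm
  have := mul_meas_ge_le_integral_of_nonneg (μ := P) (f := fun x => |Y m x - c|)
    (.of_forall fun x => abs_nonneg _) (hm.sub (integrable_const _)).abs ε
  simp only [Real.dist_eq]
  rwa [inv_mul_eq_div, le_div_iff₀' hε]

lemma integral_sq_gaussianReal (v : NNReal) : ∫ x, x ^ 2 ∂(gaussianReal 0 v) = v := by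
  have h := variance_eq_sub (memLp_id_gaussianReal (μ := 0) (v := v) 2)
  rw [variance_id_gaussianReal] at h
  have e : ∫ x, id x ∂(gaussianReal 0 v) = 0 := integral_id_gaussianReal
  rw [e] at h
  rw [h]
  simp

lemma integrable_sq_gaussianReal (v : NNReal) :
    Integrable (fun x => x ^ 2) (gaussianReal 0 v) :=
  (memLp_id_gaussianReal (μ := 0) (v := v) 2).integrable_sq

lemma LimitLaws.pairLimit_hStat (hL : LimitLaws P Z ψ b) :
    PairLimit P (fun m k => hStat Z P ψ k (b m)) b
      (gaussianReal 0 (sigmaSq P Z ψ).toNNReal) := by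
  intro j k h1 h2 G
  have := tendsto_integral_of_tendstoInDistribution (hL.pair_normal j k h1 h2) G
  rwa [Measure.map_id] at this

lemma sigmaSq_nonneg (hψ : IsBV ψ) (hZ : FourthOrderStationary P Z)
    (hγ : Summable (autocov P Z)) (hκ : Summable (lagCum4 P Z)) (hb : Tendsto b atTop atTop) :
    0 ≤ sigmaSq P Z ψ :=
  ge_of_tendsto' (hψ.tendsto_variance_hStat hZ hγ hκ hb) fun _ => variance_nonneg _ _

/-- The second moments of `H` converge to `σ²`. -/
lemma LimitLaws.tendsto_integral_hStat_sq (hL : LimitLaws P Z ψ b) (hψ : IsBV ψ)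
    (hZ : FourthOrderStationary P Z) (hγ : Summable (autocov P Z)) (hκ : Summable (lagCum4 P Z))
    (hb : Tendsto b atTop atTop) :
    Tendsto (fun m => ∫ x, hStat Z P ψ 0 (b m) x ^ 2 ∂P) atTop (𝓝 (sigmaSq P Z ψ)) := by
  have hV := hψ.tendsto_variance_hStat hZ hγ hκ hb
  -- The central limit theorem together with bounded variances shows that the mean of `H`, that is
  -- the scaled bias, vanishes; so the second moment has the same limit as the variance.
  have hβ := tendsto_integral_of_variance_le (P := P) (X := fun m => hStat Z P ψ 0 (b m))
    (.of_forall fun m => hZ.memLp_hStat ψ 0 (b m))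
    ((hV.eventually (gt_mem_nhds (lt_add_one _))).mono fun m h => le_of_lt h)
    (integrable_sq_gaussianReal (sigmaSq P Z ψ).toNNReal) fun G => by
      have := tendsto_integral_of_tendstoInDistribution hL.clt G
      rwa [Measure.map_id] at this
  rw [integral_id_gaussianReal] at hβ
  have h := hV.add (hβ.pow 2)
  have e0 : sigmaSq P Z ψ + 0 ^ 2 = sigmaSq P Z ψ := by ring
  rw [e0] at h
  refine h.congr fun m => ?_
  rw [variance_eq_sub (hZ.memLp_hStat ψ 0 (b m))]
  simp

/-- `H` is an affine function of the spectral average with slope `√(size b)`, and centring at the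
block average removes the unknown spectral mean. -/
lemma subVar_eq {n b : ℕ × ℕ} (hne : (blocks n b).Nonempty) (x : Ω) :
    subVar Z ψ n b x = blockAvg n b fun k =>
      (hStat Z P ψ k b x - blockAvg n b fun l => hStat Z P ψ l b x) ^ 2 := by
  unfold subVar
  congr 1
  funext k
  have e : (blockAvg n b fun l => hStat Z P ψ l b x) =
      √(size b) * ((blockAvg n b fun l => specAvg Z ψ l b x) - specMean P Z ψ) := by
    simp only [hStat]
    rw [blockAvg_const_mul, blockAvg_sub, blockAvg_const hne]
  rw [e, hStat, ← mul_sub, mul_pow, Real.sq_sqrt (size_nonneg b)]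
  ring

variable (hψ : IsBV ψ) (hZ : FourthOrderStationary P Z)
    (hγ : Summable (autocov P Z)) (hκ : Summable (lagCum4 P Z))
    (hn : Tendsto n atTop atTop) (hb : Tendsto b atTop atTop)
    (h₁ : Tendsto (fun m => ((b m).1 : ℝ) / (n m).1) atTop (𝓝 0))
    (h₂ : Tendsto (fun m => ((b m).2 : ℝ) / (n m).2) atTop (𝓝 0))
    (hL : LimitLaws P Z ψ b)
include hψ hZ hγ hκ hn hb h₁ h₂ hL

/-- Consistency of the subsampling variance estimator. -/
theorem tendstoInMeasure_subVar :
    TendstoInMeasure P (fun m => subVar Z ψ (n m) (b m)) atTop fun _ => sigmaSq P Z ψ := by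
  have hσ := sigmaSq_nonneg hψ hZ hγ hκ hb
  have e2 : ∫ x, x ^ 2 ∂(gaussianReal 0 (sigmaSq P Z ψ).toNNReal) = sigmaSq P Z ψ := by
    rw [integral_sq_gaussianReal, Real.coe_toNNReal _ hσ]
  have h := hL.pairLimit_hStat.tendsto_blockVar hn hb h₁ h₂
    (.of_forall fun m k => hZ.memLp_hStat ψ k (b m))
    ((eventually_pos hb).mono fun m hm k => hZ.integral_hStat_sq ψ k hm)
    (integrable_sq_gaussianReal _)
    (by rw [e2]; exact hL.tendsto_integral_hStat_sq hψ hZ hγ hκ hb)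
  rw [e2, integral_id_gaussianReal, zero_pow two_ne_zero, sub_zero] at h
  have hne := eventually_blocks_nonempty hn h₁ h₂
  refine tendstoInMeasure_of_tendsto_integral_abs ?_ (h.congr' ?_)
  · filter_upwards [hne] with m hm
    have : subVar Z ψ (n m) (b m) = fun x => blockAvg (n m) (b m) fun k =>
        (hStat Z P ψ k (b m) x - blockAvg (n m) (b m) fun l => hStat Z P ψ l (b m) x) ^ 2 :=
      funext fun x => subVar_eq hm x
    rw [this]
    exact integrable_blockAvg fun k => ((hZ.memLp_hStat ψ k (b m)).sub
      (memLp_blockAvg fun l => hZ.memLp_hStat ψ l (b m))).integrable_sq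
  · filter_upwards [hne] with m hm
    simp_rw [subVar_eq (P := P) hm]

end Subsampling

/-! ### Consistency of the estimator of the first variance component. -/

section FirstComponent

variable {Ω : Type*} [MeasurableSpace Ω] {P : Measure Ω} [IsProbabilityMeasure P]
  {Z : ℤ × ℤ → Ω → ℝ} {ψ : ℝ × ℝ → ℝ} {n b : ℕ → ℕ × ℕ}

/-- The empirical variance over the blocks of the periodogram ordinates at index `j`. -/
def ordinateVar (Z : ℤ × ℤ → Ω → ℝ) (n b : ℕ × ℕ) (j : ℤ × ℤ) (x : Ω) : ℝ :=
  blockAvg n b fun k => (periodogram Z k b (freq b j) x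
    - blockAvg n b fun l => periodogram Z l b (freq b j) x) ^ 2

lemma FourthOrderStationary.integrable_ordinateVar (hZ : FourthOrderStationary P Z)
    (n b : ℕ × ℕ) {j : ℤ × ℤ} (hj : j ∈ grid b) : Integrable (ordinateVar Z n b j) P :=
  integrable_blockAvg fun k => ((hZ.memLp_periodogram k hj).sub
    (memLp_blockAvg fun l => hZ.memLp_periodogram l hj)).integrable_sq

/-- An empirical variance is at most the empirical second moment, whose mean is the same in all
blocks. This supplies the dominating constant for the sum over the grid. -/
lemma FourthOrderStationary.integral_ordinateVar_le (hZ : FourthOrderStationary P Z)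
    {n b : ℕ × ℕ} (hne : (blocks n b).Nonempty) {j : ℤ × ℤ} (hj : j ∈ grid b) :
    ∫ x, ordinateVar Z n b j x ∂P ≤ ∫ x, periodogram Z 0 b (freq b j) x ^ 2 ∂P := by
  have hi : ∀ k, Integrable (fun x => periodogram Z k b (freq b j) x ^ 2) P :=
    fun k => (hZ.memLp_periodogram k hj).integrable_sq
  calc ∫ x, ordinateVar Z n b j x ∂P
      ≤ ∫ x, blockAvg n b (fun k => periodogram Z k b (freq b j) x ^ 2) ∂P := by
        refine integral_mono (hZ.integrable_ordinateVar n b hj) (integrable_blockAvg hi)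
          fun x => ?_
        show ordinateVar Z n b j x ≤ _
        rw [ordinateVar, blockAvg_sub_sq hne fun k => periodogram Z k b (freq b j) x]
        exact sub_le_self _ (sq_nonneg _)
    _ = _ := by
        rw [integral_blockAvg hi]
        simp_rw [fun k => hZ.integral_periodogram_sq_translate k hj]
        rw [blockAvg_const hne]

lemma integral_map_const_mul_stdExp (c : ℝ) (k : ℕ) :
    ∫ y, y ^ k ∂(stdExp.map fun u => c * u) = c ^ k * k.factorial := by
  rw [integral_map (by fun_prop) (by fun_prop)]
  simp_rw [mul_pow]
  rw [integral_const_mul, integral_pow_stdExp]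

lemma abs_le_sub_div {b : ℕ} {i : ℤ} (h : 2 * |i| ≤ b) : |i| ≤ (b : ℤ) - (b / 2 : ℕ) := by
  omega

variable (hZ : FourthOrderStationary P Z)
    (hγ : Summable (autocov P Z)) (hκ : Summable (lagCum4 P Z))
    (hn : Tendsto n atTop atTop) (hb : Tendsto b atTop atTop)
    (h₁ : Tendsto (fun m => ((b m).1 : ℝ) / (n m).1) atTop (𝓝 0))
    (h₂ : Tendsto (fun m => ((b m).2 : ℝ) / (n m).2) atTop (𝓝 0))
    (hL : LimitLaws P Z ψ b)
include hZ hγ hκ hn hb h₁ h₂ hL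

/-- The empirical variance of the ordinates near `ω` converges in mean to `f(ω)²`. -/
lemma tendsto_ordinateVar {ω : ℝ × ℝ} (hω : ω ∈ offAxes) :
    Tendsto (fun m => ∫ x, |ordinateVar Z (n m) (b m) (gridPoint (b m) ω) x -
      specDensity P Z (freq (b m) (gridPoint (b m) ω)) ^ 2| ∂P) atTop (𝓝 0) := by
  classical
  set f := specDensity P Z ω with hf
  -- The limit law requires the index bounds for every `m`, but the grid point satisfies them only
  -- eventually; elsewhere it is replaced by `0`.
  set r : ℕ → ℤ × ℤ := fun m =>
    if gridPoint (b m) ω ∈ grid (b m) then gridPoint (b m) ω else 0 with hr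
  have hmem := eventually_gridPoint_mem hb hω
  have hreq : ∀ᶠ m in atTop, r m = gridPoint (b m) ω := hmem.mono fun m hm => if_pos hm
  have hrω : Tendsto (fun m => freq (b m) (r m)) atTop (𝓝 ω) :=
    (tendsto_freq_gridPoint hb ω).congr' (hreq.mono fun m hm => by simp only [hm])
  have hrb : ∀ m, |(r m).1| ≤ (b m).1 - ((b m).1 / 2 : ℕ) ∧
      |(r m).2| ≤ (b m).2 - ((b m).2 / 2 : ℕ) := by
    intro m
    by_cases hm : gridPoint (b m) ω ∈ grid (b m)
    · simp only [hr, if_pos hm]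
      have := mem_grid.1 hm
      exact ⟨abs_le_sub_div this.2.1, abs_le_sub_div this.2.2⟩
    · simp only [hr, if_neg hm]
      constructor <;> simp <;> omega
  have hpair : PairLimit P (fun m k => periodogram Z k (b m) (freq (b m) (r m))) b
      (stdExp.map fun u => f * u) := by
    intro j k hj hk G
    have := tendsto_integral_of_tendstoInDistribution
      (hL.pair_exponential r ω hrb hrω hω.1.1 hω.1.2 hω.2.1 hω.2.2 j k hj hk) G
    rw [Measure.map_prod_map _ _ (by fun_prop) (by fun_prop)]
    exact this
  have hgr : ∀ᶠ m in atTop, r m ∈ grid (b m) := by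
    filter_upwards [hreq, hmem] with m h1 h2
    rwa [h1]
  have : IsProbabilityMeasure (stdExp.map fun u => f * u) :=
    Measure.isProbabilityMeasure_map (by fun_prop)
  have e2 : ∫ y, y ^ 2 ∂(stdExp.map fun u => f * u) = 2 * f ^ 2 := by
    rw [integral_map_const_mul_stdExp]; simp [mul_comm]
  have e1 : ∫ y, y ∂(stdExp.map fun u => f * u) = f := by
    simpa using integral_map_const_mul_stdExp f 1
  have hlim := hZ.tendsto_integral_periodogram_sq hγ hκ hb hgr (by
    filter_upwards [hreq, eventually_gridPoint hb hω] with m h1 h2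
    rw [h1]
    exact ⟨h2.1, h2.2.2.1⟩) hrω
  have h := hpair.tendsto_blockVar hn hb h₁ h₂
    (hgr.mono fun m hm k => hZ.memLp_periodogram k hm)
    (hgr.mono fun m hm k => hZ.integral_periodogram_sq_translate k hm)
    (by
      rw [integrable_map_measure (by fun_prop) (by fun_prop)]
      simpa only [Function.comp_def, mul_pow] using (integrable_pow_stdExp 2).const_mul (f ^ 2))
    (by rw [e2]; exact hlim)
  -- An exponential variable scaled by `f` has second moment `2 f²` and mean `f`, hence variance
  -- `f²`.
  rw [e2, e1, show 2 * f ^ 2 - f ^ 2 = f ^ 2 by ring] at h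
  have hfc : Tendsto (fun m => |specDensity P Z (freq (b m) (gridPoint (b m) ω)) ^ 2 - f ^ 2|)
      atTop (𝓝 0) := by
    have h0 : Tendsto (fun m => specDensity P Z (freq (b m) (gridPoint (b m) ω)) ^ 2) atTop
        (𝓝 (f ^ 2)) :=
      (((continuous_specDensity hγ).tendsto ω).comp (tendsto_freq_gridPoint hb ω)).pow 2
    have h1 := (h0.sub_const (f ^ 2)).abs
    rwa [sub_self, abs_zero] at h1
  have hsum := h.add hfc
  rw [add_zero] at hsum
  refine squeeze_zero' (.of_forall fun m => integral_nonneg fun x => abs_nonneg _) ?_ hsum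
  filter_upwards [hreq, hmem] with m hm hg
  simp only [hm]
  have hi := hZ.integrable_ordinateVar (n m) (b m) hg
  have i1 : Integrable (fun x => |ordinateVar Z (n m) (b m) (gridPoint (b m) ω) x - f ^ 2|) P :=
    (hi.sub (integrable_const _)).abs
  set c := specDensity P Z (freq (b m) (gridPoint (b m) ω)) ^ 2
  calc ∫ x, |ordinateVar Z (n m) (b m) (gridPoint (b m) ω) x - c| ∂P
      ≤ ∫ x, (|ordinateVar Z (n m) (b m) (gridPoint (b m) ω) x - f ^ 2| + |c - f ^ 2|) ∂P := by
        refine integral_mono (hi.sub (integrable_const _)).abs (i1.add (integrable_const _))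
          fun x => ?_
        show |ordinateVar Z (n m) (b m) (gridPoint (b m) ω) x - c| ≤
          |ordinateVar Z (n m) (b m) (gridPoint (b m) ω) x - f ^ 2| + |c - f ^ 2|
        rw [abs_sub_comm c]
        exact abs_sub_le _ _ _
    _ = _ := by
        rw [integral_add i1 (integrable_const _)]
        simp [ordinateVar]

/-- The average over the grid of the mean errors of the empirical ordinate variances vanishes. -/
lemma tendsto_sum_ordinateVar :
    Tendsto (fun m => (2 * Real.pi) ^ 2 / size (b m) * ∑ j ∈ grid (b m),
      ∫ x, |ordinateVar Z (n m) (b m) j x - specDensity P Z (freq (b m) j) ^ 2| ∂P)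
      atTop (𝓝 0) := by
  obtain ⟨C, hC⟩ := hZ.exists_periodogram_bound hγ hκ
  obtain ⟨F, hF0, hF⟩ := specDensity_bounded (P := P) (Z := Z) hγ
  have h := tendsto_riemann hb (G := fun _ => 0) (C := C + F ^ 2) (g := fun m j =>
      ∫ x, |ordinateVar Z (n m) (b m) j x - specDensity P Z (freq (b m) j) ^ 2| ∂P) ?_
    (.of_forall fun ω hω => tendsto_ordinateVar hZ hγ hκ hn hb h₁ h₂ hL hω)
  · simpa using h
  · filter_upwards [eventually_pos hb, eventually_blocks_nonempty hn h₁ h₂] with m hm hne j hj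
    rw [abs_of_nonneg (integral_nonneg fun x => abs_nonneg _)]
    have hi := hZ.integrable_ordinateVar (n m) (b m) hj
    calc ∫ x, |ordinateVar Z (n m) (b m) j x - specDensity P Z (freq (b m) j) ^ 2| ∂P
        ≤ ∫ x, (ordinateVar Z (n m) (b m) j x + F ^ 2) ∂P := by
          refine integral_mono (hi.sub (integrable_const _)).abs (hi.add (integrable_const _))
            fun x => ?_
          have h0 : 0 ≤ ordinateVar Z (n m) (b m) j x := blockAvg_nonneg fun k => sq_nonneg _
          have h1 : specDensity P Z (freq (b m) j) ^ 2 ≤ F ^ 2 := by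
            rw [← sq_abs]; exact pow_le_pow_left₀ (abs_nonneg _) (hF _) 2
          show |ordinateVar Z (n m) (b m) j x - specDensity P Z (freq (b m) j) ^ 2| ≤
            ordinateVar Z (n m) (b m) j x + F ^ 2
          rw [abs_le]
          constructor <;> nlinarith [sq_nonneg (specDensity P Z (freq (b m) j))]
      _ = ∫ x, ordinateVar Z (n m) (b m) j x ∂P + F ^ 2 := by
          rw [integral_add hi (integrable_const _)]; simp
      _ ≤ C + F ^ 2 := by
          gcongr
          exact (hZ.integral_ordinateVar_le hne hj).trans (hC _ hm j hj 0)

omit hZ hκ hn h₁ h₂ hL in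
/-- Riemann sums for `σ₁²`. -/
lemma IsBV.tendsto_sigma1Sq (hψ : IsBV ψ) :
    Tendsto (fun m => (2 * Real.pi) ^ 2 * ((2 * Real.pi) ^ 2 / size (b m) * ∑ j ∈ grid (b m),
      ψ (freq (b m) j) * (ψ (freq (b m) j) + ψ (freq (b m) (-j))) *
        specDensity P Z (freq (b m) j) ^ 2)) atTop (𝓝 (sigma1Sq P Z ψ)) := by
  obtain ⟨B, hB0, hB⟩ := hψ.bounded
  obtain ⟨F, hF0, hF⟩ := specDensity_bounded (P := P) (Z := Z) hγ
  refine Tendsto.const_mul _ (tendsto_riemann hb (C := B * (B + B) * F ^ 2) ?_ ?_)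
  · refine .of_forall fun m j hj => ?_
    have a1 := hB _ (freq_mem_freqDomain hj)
    have a2 := hB _ (freq_mem_freqDomain (neg_mem_grid.2 hj))
    rw [abs_mul, abs_mul, abs_pow]
    have := abs_add_le (ψ (freq (b m) j)) (ψ (freq (b m) (-j)))
    gcongr
    · linarith
    · exact hF _
  · filter_upwards [hψ.ae_tendsto hb] with ω h hω
    obtain ⟨h1, h2⟩ := h hω
    exact (h1.mul (h1.add h2)).mul
      ((((continuous_specDensity hγ).tendsto ω).comp (tendsto_freq_gridPoint hb ω)).pow 2)

/-- Consistency of the subsampling estimator of the first variance component. -/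
theorem tendstoInMeasure_subVar1 (hψ : IsBV ψ) :
    TendstoInMeasure P (fun m => subVar1 Z ψ (n m) (b m)) atTop fun _ => sigma1Sq P Z ψ := by
  obtain ⟨B, hB0, hB⟩ := hψ.bounded
  have hR := hψ.tendsto_sigma1Sq (P := P) (Z := Z) hγ hb
  set a : ℕ → ℤ × ℤ → ℝ := fun m j =>
    ψ (freq (b m) j) * (ψ (freq (b m) j) + ψ (freq (b m) (-j))) with ha
  have haB : ∀ m, ∀ j ∈ grid (b m), |a m j| ≤ B * (B + B) := by
    intro m j hj
    have a1 := hB _ (freq_mem_freqDomain hj)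
    have a2 := hB _ (freq_mem_freqDomain (neg_mem_grid.2 hj))
    rw [ha, abs_mul]
    have := abs_add_le (ψ (freq (b m) j)) (ψ (freq (b m) (-j)))
    gcongr
    linarith
  have e : ∀ m x, subVar1 Z ψ (n m) (b m) x = (2 * Real.pi) ^ 2 * ((2 * Real.pi) ^ 2 /
      size (b m) * ∑ j ∈ grid (b m), a m j * ordinateVar Z (n m) (b m) j x) := by
    intro m x
    rw [subVar1]
    simp only [ordinateVar, ha]
    ring
  -- `S` has the true `f²` in place of the empirical variances. The distance from the estimator to
  -- `S` is averaged over the grid in mean; the distance from `S` to `σ₁²` is a deterministic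
  -- Riemann error.
  set S : ℕ → ℝ := fun m => (2 * Real.pi) ^ 2 * ((2 * Real.pi) ^ 2 / size (b m) *
    ∑ j ∈ grid (b m), a m j * specDensity P Z (freq (b m) j) ^ 2) with hS
  have hSlim : Tendsto (fun m => |S m - sigma1Sq P Z ψ|) atTop (𝓝 0) := by
    simpa using (hR.sub_const (sigma1Sq P Z ψ)).abs
  have hV := (tendsto_sum_ordinateVar hZ hγ hκ hn hb h₁ h₂ hL).const_mul
    ((2 * Real.pi) ^ 2 * (B * (B + B)))
  have hsum := hV.add hSlim
  rw [mul_zero, add_zero] at hsum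
  have hint : ∀ m, ∀ j ∈ grid (b m), Integrable
      (fun x => |ordinateVar Z (n m) (b m) j x - specDensity P Z (freq (b m) j) ^ 2|) P :=
    fun m j hj => ((hZ.integrable_ordinateVar (n m) (b m) hj).sub (integrable_const _)).abs
  have hi1 : ∀ m, Integrable (subVar1 Z ψ (n m) (b m)) P := by
    intro m
    rw [funext (e m)]
    exact ((integrable_finsetSum _ fun j hj =>
      (hZ.integrable_ordinateVar (n m) (b m) hj).const_mul _).const_mul _).const_mul _
  refine tendstoInMeasure_of_tendsto_integral_abs (.of_forall hi1)
    (squeeze_zero (fun m => integral_nonneg fun x => abs_nonneg _) (fun m => ?_) hsum)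
  set c := (2 * Real.pi) ^ 2 / size (b m) with hc
  have hc0 : 0 ≤ c := div_nonneg (by positivity) (size_nonneg _)
  have isum : Integrable (fun x => ∑ j ∈ grid (b m),
      |ordinateVar Z (n m) (b m) j x - specDensity P Z (freq (b m) j) ^ 2|) P :=
    integrable_finsetSum _ (hint m)
  calc ∫ x, |subVar1 Z ψ (n m) (b m) x - sigma1Sq P Z ψ| ∂P
      ≤ ∫ x, ((2 * Real.pi) ^ 2 * (B * (B + B)) * (c * ∑ j ∈ grid (b m),
          |ordinateVar Z (n m) (b m) j x - specDensity P Z (freq (b m) j) ^ 2|) +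
          |S m - sigma1Sq P Z ψ|) ∂P := by
        refine integral_mono ((hi1 m).sub (integrable_const _)).abs
          (((isum.const_mul c).const_mul _).add (integrable_const _)) fun x => ?_
        show |subVar1 Z ψ (n m) (b m) x - sigma1Sq P Z ψ| ≤
          (2 * Real.pi) ^ 2 * (B * (B + B)) * (c * ∑ j ∈ grid (b m),
          |ordinateVar Z (n m) (b m) j x - specDensity P Z (freq (b m) j) ^ 2|) +
          |S m - sigma1Sq P Z ψ|
        refine (abs_sub_le _ (S m) _).trans (add_le_add_left ?_ _)
        have e3 : subVar1 Z ψ (n m) (b m) x - S m = (2 * Real.pi) ^ 2 * (c *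
            ∑ j ∈ grid (b m), a m j *
              (ordinateVar Z (n m) (b m) j x - specDensity P Z (freq (b m) j) ^ 2)) := by
          rw [e]
          simp only [hS, ← hc, mul_sub, Finset.sum_sub_distrib]
        rw [e3, abs_mul, abs_mul, abs_of_nonneg hc0, abs_of_nonneg (by positivity), mul_assoc,
          mul_left_comm (B * (B + B)), Finset.mul_sum]
        gcongr
        refine (Finset.abs_sum_le_sum_abs _ _).trans (Finset.sum_le_sum fun j hj => ?_)
        rw [abs_mul]
        gcongr
        exact haB m j hj
    _ = _ := by
        rw [integral_add ((isum.const_mul c).const_mul _) (integrable_const _),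
          integral_const_mul, integral_const_mul, integral_finsetSum _ (hint m)]
        simp

end FirstComponent

/-! ### A central limit theorem for weighted sums of centred exponentials. -/

section WeightedCLT

/-- A weighted sum of centred resampling variables. -/
def bootSum (s : Finset (ℤ × ℤ)) (a : ℤ × ℤ → ℝ) (u : ℤ × ℤ → ℝ) : ℝ :=
  ∑ j ∈ s, a j * (u j - 1)

instance : IsProbabilityMeasure bootLaw := by unfold bootLaw; infer_instance

lemma measurable_bootSum (s : Finset (ℤ × ℤ)) (a : ℤ × ℤ → ℝ) : Measurable (bootSum s a) := by
  unfold bootSum; fun_prop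

lemma iIndepFun_bootLaw (a : ℤ × ℤ → ℝ) :
    iIndepFun (fun j (u : ℤ × ℤ → ℝ) => a j * (u j - 1)) bootLaw :=
  iIndepFun_infinitePi (X := fun j x => a j * (x - 1)) fun j => by fun_prop

lemma measurePreserving_eval_bootLaw (j : ℤ × ℤ) :
    MeasurePreserving (fun u : ℤ × ℤ → ℝ => u j) bootLaw stdExp :=
  measurePreserving_eval_infinitePi (fun _ => stdExp) j

lemma integral_sub_one_stdExp : ∫ x, (x - 1) ∂stdExp = 0 := by
  have h1 : ∫ x, x ∂stdExp = 1 := by simpa using integral_pow_stdExp 1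
  have i1 : Integrable (fun x => x) stdExp := by simpa using integrable_pow_stdExp 1
  rw [integral_sub i1 (integrable_const _), h1]
  simp

lemma integral_sub_one_sq_stdExp : ∫ x, (x - 1) ^ 2 ∂stdExp = 1 := by
  have h1 : ∫ x, x ∂stdExp = 1 := by simpa using integral_pow_stdExp 1
  have h2 : ∫ x, x ^ 2 ∂stdExp = 2 := by simpa using integral_pow_stdExp 2
  have i1 : Integrable (fun x => x) stdExp := by simpa using integrable_pow_stdExp 1
  have i2 := integrable_pow_stdExp 2
  have e : ∀ x : ℝ, (x - 1) ^ 2 = x ^ 2 - (2 * x - 1) := fun x => by ring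
  simp_rw [e]
  have i3 : Integrable (fun x : ℝ => 2 * x - 1) stdExp := (i1.const_mul 2).sub (integrable_const _)
  rw [integral_sub i2 i3, integral_sub (i1.const_mul 2) (integrable_const _), integral_const_mul,
    h1, h2]
  norm_num

lemma memLp_sub_one_stdExp : MemLp (fun x : ℝ => x - 1) 2 stdExp :=
  MemLp.sub ((memLp_two_iff_integrable_sq aestronglyMeasurable_id).2 (integrable_pow_stdExp 2))
    (memLp_const _)

lemma memLp_boot (a : ℤ × ℤ → ℝ) (j : ℤ × ℤ) :
    MemLp (fun u : ℤ × ℤ → ℝ => a j * (u j - 1)) 2 bootLaw :=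
  (memLp_sub_one_stdExp.comp_measurePreserving (measurePreserving_eval_bootLaw j)).const_mul _

lemma variance_boot (a : ℤ × ℤ → ℝ) (j : ℤ × ℤ) :
    Var[fun u : ℤ × ℤ → ℝ => a j * (u j - 1); bootLaw] = a j ^ 2 := by
  have hm : Var[fun x : ℝ => x - 1; stdExp] = 1 := by
    rw [variance_eq_sub memLp_sub_one_stdExp, integral_sub_one_stdExp]
    simpa using integral_sub_one_sq_stdExp
  have := (measurePreserving_eval_bootLaw j).variance_fun_comp (f := fun x : ℝ => x - 1)
    (by fun_prop)
  rw [variance_const_mul, this, hm, mul_one]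

lemma variance_bootSum (s : Finset (ℤ × ℤ)) (a : ℤ × ℤ → ℝ) :
    Var[bootSum s a; bootLaw] = ∑ j ∈ s, a j ^ 2 := by
  have e : bootSum s a = ∑ j ∈ s, fun u : ℤ × ℤ → ℝ => a j * (u j - 1) := by
    funext u; simp [bootSum]
  rw [e, IndepFun.variance_sum (fun j _ => memLp_boot a j)
    fun i _ j _ hij => (iIndepFun_bootLaw a).indepFun hij]
  exact Finset.sum_congr rfl fun j _ => variance_boot a j

lemma charFun_bootSum (s : Finset (ℤ × ℤ)) (a : ℤ × ℤ → ℝ) (t : ℝ) :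
    charFun (bootLaw.map (bootSum s a)) t =
      ∏ j ∈ s, charFun (stdExp.map fun x => x - 1) (a j * t) := by
  have h := iIndepFun.charFun_map_fun_finsetSum_eq_prod (s := s)
    (X := fun j (u : ℤ × ℤ → ℝ) => a j * (u j - 1)) (P := bootLaw)
    (fun j _ => Measurable.aemeasurable (by fun_prop)) ((iIndepFun_bootLaw a).restrict _)
  have h' := congrFun h t
  unfold bootSum
  rw [h', Finset.prod_apply]
  refine Finset.prod_congr rfl fun j _ => ?_
  rw [charFun_map_mul_comp (Measurable.aemeasurable (by fun_prop)), ← (measurePreserving_eval_bootLaw j).map_eq,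
    Measure.map_map (by fun_prop) (by fun_prop)]
  rfl

/-- The factors are exchanged one at a time; all others have modulus at most one. -/
lemma norm_prod_sub_prod_le {ι : Type*} (s : Finset ι) {z w : ι → ℂ} (hz : ∀ i, ‖z i‖ ≤ 1)
    (hw : ∀ i, ‖w i‖ ≤ 1) : ‖∏ i ∈ s, z i - ∏ i ∈ s, w i‖ ≤ ∑ i ∈ s, ‖z i - w i‖ := by
  classical
  induction s using Finset.induction_on with
  | empty => simp
  | insert i s hi ih =>
    rw [Finset.prod_insert hi, Finset.prod_insert hi, Finset.sum_insert hi]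
    have e : z i * ∏ i ∈ s, z i - w i * ∏ i ∈ s, w i =
        (z i - w i) * ∏ i ∈ s, z i + w i * (∏ i ∈ s, z i - ∏ i ∈ s, w i) := by ring
    have hp : ‖∏ i ∈ s, z i‖ ≤ 1 := by
      rw [norm_prod]
      exact Finset.prod_le_one (fun _ _ => norm_nonneg _) fun i _ => hz i
    rw [e]
    refine (norm_add_le _ _).trans (add_le_add ?_ ?_)
    · rw [norm_mul]; exact mul_le_of_le_one_right (norm_nonneg _) hp
    · rw [norm_mul]; exact (mul_le_of_le_one_left (norm_nonneg _) (hw i)).trans ih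

/-- The centred exponential and the standard normal law share mean and variance, so their
second-order Taylor expansions at zero coincide. -/
lemma isLittleO_charFun_stdExp :
    (fun t : ℝ => charFun (stdExp.map fun x => x - 1) t - charFun (gaussianReal 0 1) t)
      =o[𝓝 0] fun t : ℝ => t ^ 2 := by
  have h1 := taylor_charFun_two (P := stdExp) (X := fun x => x - 1) (by fun_prop)
    integral_sub_one_stdExp (by simpa using integral_sub_one_sq_stdExp)
  have h2 := taylor_charFun_two (P := gaussianReal 0 1) (X := id) (by fun_prop)
    (by simp) (by simpa using integral_sq_gaussianReal 1)
  rw [Measure.map_id] at h2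
  refine (h1.sub h2).congr_left fun t => ?_
  ring

lemma prod_charFun_gaussian (s : Finset (ℤ × ℤ)) (a : ℤ × ℤ → ℝ) (t : ℝ) :
    ∏ j ∈ s, charFun (gaussianReal 0 1) (a j * t) =
      Complex.exp (-(((∑ j ∈ s, a j ^ 2) * t ^ 2 / 2 : ℝ) : ℂ)) := by
  simp_rw [charFun_gaussianReal]
  rw [← Complex.exp_sum]
  congr 1
  push_cast
  rw [Finset.sum_mul, Finset.sum_div, ← Finset.sum_neg_distrib]
  refine Finset.sum_congr rfl fun j _ => ?_
  simp
  ring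

/-- A central limit theorem for weighted sums with asymptotically negligible weights. -/
lemma tendsto_charFun_bootSum {s : ℕ → Finset (ℤ × ℤ)} {a : ℕ → ℤ × ℤ → ℝ} {v : NNReal}
    (hv : Tendsto (fun m => ∑ j ∈ s m, a m j ^ 2) atTop (𝓝 v))
    {δ : ℕ → ℝ} (hδ : Tendsto δ atTop (𝓝 0)) (ha : ∀ᶠ m in atTop, ∀ j ∈ s m, |a m j| ≤ δ m)
    (t : ℝ) : Tendsto (fun m => charFun (bootLaw.map (bootSum (s m) (a m))) t) atTop
      (𝓝 (charFun (gaussianReal 0 v) t)) := by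
  set φ := charFun (stdExp.map fun x => x - 1) with hφ
  set γ := charFun (gaussianReal 0 1) with hγ
  have : IsProbabilityMeasure (stdExp.map fun x => x - 1) :=
    Measure.isProbabilityMeasure_map (by fun_prop)
  have hG : Tendsto (fun m => ∏ j ∈ s m, γ (a m j * t)) atTop
      (𝓝 (charFun (gaussianReal 0 v) t)) := by
    simp_rw [hγ, prod_charFun_gaussian, charFun_gaussianReal]
    have h0 := ((hv.mul_const (t ^ 2)).div_const 2).ofReal.neg
    have h1 := (Complex.continuous_exp.tendsto _).comp h0
    have e : Complex.exp (t * (0 : ℝ) * Complex.I - (v : ℝ) * t ^ 2 / 2) =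
        Complex.exp (-(((v : ℝ) * t ^ 2 / 2 : ℝ) : ℂ)) := by
      congr 1
      push_cast
      ring
    rw [e]
    exact h1
  have hD : Tendsto (fun m => ∏ j ∈ s m, φ (a m j * t) - ∏ j ∈ s m, γ (a m j * t)) atTop
      (𝓝 0) := by
    rw [Metric.tendsto_nhds]
    intro ε hε
    -- Chosen so that `η (v + 1) (t² + 1) = ε/2`, where `v + 1` eventually bounds the sum of squared
    -- weights.
    set η := ε / (2 * (v + 1) * (t ^ 2 + 1)) with hη
    have hη0 : 0 < η := by positivity
    have hlo := isLittleO_charFun_stdExp.def hη0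
    rw [Metric.eventually_nhds_iff] at hlo
    obtain ⟨r, hr, hlo⟩ := hlo
    have hδt : Tendsto (fun m => δ m * |t|) atTop (𝓝 0) := by simpa using hδ.mul_const |t|
    filter_upwards [ha, hδt.eventually (gt_mem_nhds hr),
      hv.eventually (gt_mem_nhds (lt_add_one (v : ℝ)))] with m hm hmr hmv
    rw [dist_zero_right]
    calc ‖∏ j ∈ s m, φ (a m j * t) - ∏ j ∈ s m, γ (a m j * t)‖
        ≤ ∑ j ∈ s m, ‖φ (a m j * t) - γ (a m j * t)‖ :=
          norm_prod_sub_prod_le _ (fun j => norm_charFun_le_one _) fun j => norm_charFun_le_one _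
      _ ≤ ∑ j ∈ s m, η * (a m j ^ 2 * t ^ 2) := by
          refine Finset.sum_le_sum fun j hj => ?_
          have := @hlo (a m j * t) (by
            rw [dist_zero_right, Real.norm_eq_abs, abs_mul]
            exact (mul_le_mul_of_nonneg_right (hm j hj) (abs_nonneg t)).trans_lt hmr)
          simpa [mul_pow, hφ, hγ] using this
      _ = η * ((∑ j ∈ s m, a m j ^ 2) * t ^ 2) := by rw [← Finset.mul_sum, Finset.sum_mul]
      _ ≤ η * ((v + 1) * (t ^ 2 + 1)) := by
          gcongr
          linarith
      _ = ε / 2 := by rw [hη]; field_simp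
      _ < ε := half_lt_self hε
  have := hD.add hG
  rw [zero_add] at this
  refine this.congr fun m => ?_
  rw [charFun_bootSum]
  ring

end WeightedCLT

/-! ### Uniform convergence of distribution functions. -/

section Polya

/-- Pólya's theorem: pointwise convergence of distribution functions to a continuous distribution
function is uniform. -/
lemma eventually_abs_cdf_sub_le_of_continuous {μ : ℕ → Measure ℝ} [∀ m, IsProbabilityMeasure (μ m)]
    {ν : Measure ℝ} [IsProbabilityMeasure ν] (hc : Continuous (cdf ν))
    (h : ∀ t, Tendsto (fun m => cdf (μ m) t) atTop (𝓝 (cdf ν t))) {ε : ℝ} (hε : 0 < ε) :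
    ∀ᶠ m in atTop, ∀ t, |cdf (μ m) t - cdf ν t| ≤ ε := by
  obtain ⟨N, hN⟩ := exists_nat_gt (2 / ε)
  have hN0 : (0 : ℝ) < N := (by positivity : 0 < 2 / ε).trans hN
  have hNε : 1 / (N : ℝ) ≤ ε / 2 := by
    rw [div_le_iff₀ hN0]
    rw [div_lt_iff₀ hε] at hN
    linarith
  -- Points where the limit takes the values `i/N` exist by the intermediate value theorem; finitely
  -- many of them control all `t` by monotonicity. Outside `0 < i < N` the value is arbitrary.
  have hx : ∀ i : ℕ, ∃ x, 0 < i → i < N → cdf ν x = i / N := by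
    intro i
    by_cases hi : 0 < i ∧ i < N
    · have h1 : (0 : ℝ) < i / N := div_pos (by exact_mod_cast hi.1) hN0
      have h2 : (i : ℝ) / N < 1 := by rw [div_lt_one hN0]; exact_mod_cast hi.2
      obtain ⟨x, hx⟩ := ((tendsto_cdf_atBot ν).eventually (gt_mem_nhds h1)).exists
      obtain ⟨y, hy⟩ := ((tendsto_cdf_atTop ν).eventually (lt_mem_nhds h2)).exists
      obtain ⟨z, hz⟩ := mem_range_of_exists_le_of_exists_ge hc ⟨x, hx.le⟩ ⟨y, hy.le⟩
      exact ⟨z, fun _ _ => hz⟩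
    · exact ⟨0, fun h1 h2 => absurd ⟨h1, h2⟩ hi⟩
  choose x hx using hx
  have hev : ∀ᶠ m in atTop, ∀ i ∈ Finset.range N, |cdf (μ m) (x i) - cdf ν (x i)| < ε / 2 := by
    rw [eventually_all_finset]
    intro i _
    have := Metric.tendsto_nhds.1 (h (x i)) (ε / 2) (half_pos hε)
    simpa only [Real.dist_eq] using this
  filter_upwards [hev] with m hm t
  set F := cdf ν t with hF
  have hF0 : 0 ≤ F := cdf_nonneg ν t
  have hF1 : F ≤ 1 := cdf_le_one ν t
  have mono := monotone_cdf (μ m)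
  have monoν := monotone_cdf ν
  rw [abs_le]
  constructor
  · -- compare with the largest partition value below `F`
    set i := ⌈N * F⌉₊ - 1 with hi
    by_cases hi0 : 0 < i
    · have hc1 : N * F < ⌈N * F⌉₊ + 1 := by linarith [Nat.le_ceil (N * F)]
      have hc2 : (⌈N * F⌉₊ : ℝ) < N * F + 1 := Nat.ceil_lt_add_one (by positivity)
      have hii : (i : ℝ) = ⌈N * F⌉₊ - 1 := by
        rw [hi, Nat.cast_sub (by omega)]; simp
      have hlt : (i : ℝ) < N * F := by rw [hii]; linarith
      have hiN : i < N := by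
        have : (i : ℝ) < N := hlt.trans_le (by nlinarith)
        exact_mod_cast this
      have e := hx i hi0 hiN
      have hxt : x i ≤ t := by
        by_contra hcon
        have := monoν (not_le.1 hcon).le
        rw [e, ← hF, le_div_iff₀ hN0] at this
        linarith
      have h1 := abs_lt.1 (hm i (Finset.mem_range.2 hiN))
      have h2 := mono hxt
      have h3 : F - 1 / N ≤ i / N := by
        rw [hii, sub_div]
        gcongr
        rw [le_div_iff₀ hN0]
        linarith [Nat.le_ceil (N * F)]
      rw [e] at h1
      linarith [h1.1]
    · have hle : N * F ≤ 1 := by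
        have : ⌈N * F⌉₊ ≤ 1 := by omega
        exact_mod_cast Nat.ceil_le.1 this
      have : F ≤ 1 / N := by rw [le_div_iff₀ hN0]; linarith
      linarith [cdf_nonneg (μ m) t]
  -- The comparison is now with the least partition value above `F`; if there is none, `F` is within
  -- `1/N` of one.
  · set i := ⌊N * F⌋₊ + 1 with hi
    have hfl : (⌊N * F⌋₊ : ℝ) ≤ N * F := Nat.floor_le (by positivity)
    have hii : (i : ℝ) = ⌊N * F⌋₊ + 1 := by rw [hi]; simp
    have hlt : N * F < i := by rw [hii]; exact Nat.lt_floor_add_one _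
    by_cases hiN : i < N
    · have e := hx i (by omega) hiN
      have hxt : t ≤ x i := by
        by_contra hcon
        have := monoν (not_le.1 hcon).le
        rw [e, ← hF, div_le_iff₀ hN0] at this
        linarith
      have h1 := abs_lt.1 (hm i (Finset.mem_range.2 hiN))
      have h2 := mono hxt
      have h3 : (i : ℝ) / N ≤ F + 1 / N := by
        rw [hii, add_div]
        gcongr
        rw [div_le_iff₀ hN0]
        linarith
      rw [e] at h1
      linarith [h1.2]
    · have : (N : ℝ) ≤ i := by exact_mod_cast not_lt.1 hiN
      have : 1 ≤ F + 1 / N := by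
        have h1 : N * (F + 1 / N) = N * F + 1 := by field_simp
        by_contra hcon
        nlinarith [not_le.1 hcon]
      linarith [cdf_le_one (μ m) t]

/-- The jump of a distribution function at a point is the mass of that point. -/
lemma continuous_cdf {ν : Measure ℝ} [IsProbabilityMeasure ν] (h : ∀ x, ν {x} = 0) :
    Continuous (cdf ν) := by
  rw [continuous_iff_continuousAt]
  intro x
  have h1 := (cdf ν).measure_singleton x
  rw [measure_cdf, h, eq_comm, ENNReal.ofReal_eq_zero, sub_nonpos] at h1
  rw [continuousAt_iff_continuous_left'_right']
  exact ⟨((cdf ν).mono.continuousWithinAt_Iio_iff_leftLim_eq).2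
    (le_antisymm ((cdf ν).mono.leftLim_le le_rfl) h1),
    ((cdf ν).right_continuous x).mono Set.Ioi_subset_Ici_self⟩

/-- Uniform convergence of distribution functions under weak convergence to a centred Gaussian
law. -/
lemma eventually_abs_cdf_sub_le {μ : ℕ → ProbabilityMeasure ℝ} {v : NNReal} (hv : v ≠ 0)
    (h : Tendsto μ atTop (𝓝 ⟨gaussianReal 0 v, inferInstance⟩)) {ε : ℝ} (hε : 0 < ε) :
    ∀ᶠ m in atTop, ∀ t, |cdf (μ m : Measure ℝ) t - cdf (gaussianReal 0 v) t| ≤ ε := by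
  have := nullSingletonClass_gaussianReal (μ := 0) hv
  refine eventually_abs_cdf_sub_le_of_continuous (μ := fun m => (μ m : Measure ℝ))
    (continuous_cdf fun x => measure_singleton x) (fun t => ?_) hε
  have h1 := ProbabilityMeasure.tendsto_measure_of_null_frontier_of_tendsto' h
    (E := Set.Iic t) (by simp)
  have h2 := (ENNReal.tendsto_toReal (measure_ne_top (gaussianReal 0 v) _)).comp h1
  simp_rw [cdf_eq_real]
  exact h2

end Polya

/-! ### The bootstrap statistic as a sum of independent terms. -/

section HalfGrid

/-- The half of the grid on which the resampling variables are drawn. -/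
def halfGrid (n : ℕ × ℕ) : Finset (ℤ × ℤ) :=
  (grid n).filter fun j => 0 < j.1 ∨ (j.1 = 0 ∧ 0 < j.2)

lemma mem_halfGrid {n : ℕ × ℕ} {j : ℤ × ℤ} :
    j ∈ halfGrid n ↔ j ∈ grid n ∧ (0 < j.1 ∨ (j.1 = 0 ∧ 0 < j.2)) := Finset.mem_filter

lemma sum_grid (n : ℕ × ℕ) (F : ℤ × ℤ → ℝ) :
    ∑ j ∈ grid n, F j = ∑ j ∈ halfGrid n, (F j + F (-j)) := by
  rw [← Finset.sum_filter_add_sum_filter_not (grid n) fun j => 0 < j.1 ∨ (j.1 = 0 ∧ 0 < j.2),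
    Finset.sum_add_distrib]
  congr 1
  refine Finset.sum_nbij' (fun j => -j) (fun j => -j) (fun j hj => ?_) (fun j hj => ?_)
    (fun j _ => neg_neg j) (fun j _ => neg_neg j) (fun j _ => by rw [neg_neg])
  · obtain ⟨hg, hc⟩ := Finset.mem_filter.1 hj
    refine mem_halfGrid.2 ⟨neg_mem_grid.2 hg, ?_⟩
    have h0 : j ≠ 0 := (mem_grid.1 hg).1
    simp only [Prod.fst_neg, Prod.snd_neg]
    by_contra hcon
    refine h0 (Prod.ext ?_ ?_) <;> simp <;> omega
  · obtain ⟨hg, hc⟩ := mem_halfGrid.1 hj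
    refine Finset.mem_filter.2 ⟨neg_mem_grid.2 hg, ?_⟩
    simp only [Prod.fst_neg, Prod.snd_neg]
    omega

lemma bootU_of_mem {n : ℕ × ℕ} {j : ℤ × ℤ} (hj : j ∈ halfGrid n) (u : ℤ × ℤ → ℝ) :
    bootU j u = u j ∧ bootU (-j) u = u j := by
  have h := (mem_halfGrid.1 hj).2
  constructor
  · rw [bootU, if_pos h]
  · rw [bootU, if_neg, neg_neg]
    simp only [Prod.fst_neg, Prod.snd_neg]
    omega

/-- The weight of the resampling variable `U*_j` in `Q*`. -/
def bootWeight (ψ g : ℝ × ℝ → ℝ) (n : ℕ × ℕ) (j : ℤ × ℤ) : ℝ :=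
  √(size n) * ((2 * Real.pi) ^ 2 * (size n)⁻¹) *
    (ψ (freq n j) * g (freq n j) + ψ (freq n (-j)) * g (freq n (-j)))

/-- Since `j` and `-j` carry the same variable, their coefficients must be added before independence
can be used. -/
lemma qStar_eq (ψ g : ℝ × ℝ → ℝ) (n : ℕ × ℕ) :
    qStar ψ g n = bootSum (halfGrid n) (bootWeight ψ g n) := by
  funext u
  rw [qStar, sum_grid, bootSum, Finset.mul_sum, Finset.mul_sum]
  refine Finset.sum_congr rfl fun j hj => ?_
  rw [(bootU_of_mem hj u).1, (bootU_of_mem hj u).2, bootWeight]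
  ring

lemma varQ_eq_sum_sq (ψ g : ℝ × ℝ → ℝ) (n : ℕ × ℕ) :
    varQ ψ g n = ∑ j ∈ halfGrid n, bootWeight ψ g n j ^ 2 := by
  rw [varQ, qStar_eq, variance_bootSum]

/-- Over a pair `±j` the square `(F_j + F_{-j})²` equals the sum of `F_j (F_j + F_{-j})` and its
reflection. This is the source of the factor `ψ(ω) [ψ(ω) + ψ(-ω)]` in `σ₁²`. -/
lemma varQ_eq (ψ g : ℝ × ℝ → ℝ) (n : ℕ × ℕ) :
    varQ ψ g n = (2 * Real.pi) ^ 2 * ((2 * Real.pi) ^ 2 / size n * ∑ j ∈ grid n,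
      ψ (freq n j) * g (freq n j) *
        (ψ (freq n j) * g (freq n j) + ψ (freq n (-j)) * g (freq n (-j)))) := by
  rw [varQ_eq_sum_sq, sum_grid, Finset.mul_sum, Finset.mul_sum]
  refine Finset.sum_congr rfl fun j _ => ?_
  have e : (√(size n) * ((2 * Real.pi) ^ 2 * (size n)⁻¹)) ^ 2 =
      (2 * Real.pi) ^ 2 * ((2 * Real.pi) ^ 2 / size n) := by
    rw [mul_pow, Real.sq_sqrt (size_nonneg n)]
    rcases eq_or_ne (size n) 0 with h | h
    · simp [h]
    · field_simp
  rw [bootWeight, mul_pow, e, neg_neg]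
  ring

lemma hStar_eq (ψ g : ℝ × ℝ → ℝ) (v : ℝ) (n : ℕ × ℕ) :
    hStar ψ g v n = bootSum (halfGrid n) fun j =>
      √(varQ ψ g n + v) / √(varQ ψ g n) * bootWeight ψ g n j := by
  funext u
  rw [hStar, qStar_eq, bootSum, bootSum, mul_div_assoc', mul_comm, mul_div_assoc, mul_comm,
    Finset.mul_sum]
  exact Finset.sum_congr rfl fun j _ => by ring

lemma sum_sq_hStar {ψ g : ℝ × ℝ → ℝ} {v : ℝ} {n : ℕ × ℕ} (h0 : 0 < varQ ψ g n)
    (h1 : 0 ≤ varQ ψ g n + v) :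
    ∑ j ∈ halfGrid n, (√(varQ ψ g n + v) / √(varQ ψ g n) * bootWeight ψ g n j) ^ 2 =
      varQ ψ g n + v := by
  simp_rw [mul_pow, div_pow]
  rw [← Finset.mul_sum, ← varQ_eq_sum_sq, Real.sq_sqrt h1, Real.sq_sqrt h0.le,
    div_mul_cancel₀ _ h0.ne']

/-- The two sign conditions exclude the cases in which the conventions for the square root and for
division by zero would interfere. -/
lemma variance_hStar {ψ g : ℝ × ℝ → ℝ} {v : ℝ} {n : ℕ × ℕ} (h0 : 0 < varQ ψ g n)
    (h1 : 0 ≤ varQ ψ g n + v) : Var[hStar ψ g v n; bootLaw] = varQ ψ g n + v := by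
  rw [hStar_eq, variance_bootSum, sum_sq_hStar h0 h1]

end HalfGrid

/-! ### The bootstrap along deterministic, uniformly convergent spectral estimates. -/

section Deterministic

variable {Ω : Type*} [MeasurableSpace Ω] {P : Measure Ω} [IsProbabilityMeasure P]
  {Z : ℤ × ℤ → Ω → ℝ} {ψ : ℝ × ℝ → ℝ} {p : ℕ → ℕ × ℕ} {g : ℕ → ℝ × ℝ → ℝ} {v : ℕ → ℝ}

lemma abs_le_iSup_grid (q : ℕ × ℕ) (d : ℤ × ℤ → ℝ) {j : ℤ × ℤ} (hj : j ∈ grid q) :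
    |d j| ≤ ⨆ j : grid q, |d j| :=
  le_ciSup (f := fun j : grid q => |d j|) (Set.finite_range _).bddAbove ⟨j, hj⟩

variable (hψ : IsBV ψ) (hγ : Summable (autocov P Z)) (hp : Tendsto p atTop atTop)
  (hg : Tendsto (fun m => ⨆ j : grid (p m),
    |g m (freq (p m) j) - specDensity P Z (freq (p m) j)|) atTop (𝓝 0))
include hψ hγ hp hg

lemma eventually_abs_mul_le : ∃ C, 0 ≤ C ∧ ∀ᶠ m in atTop, ∀ j ∈ grid (p m),
    |ψ (freq (p m) j) * g m (freq (p m) j)| ≤ C := by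
  obtain ⟨B, hB0, hB⟩ := hψ.bounded
  obtain ⟨F, hF0, hF⟩ := specDensity_bounded (P := P) (Z := Z) hγ
  refine ⟨B * (F + 1), by positivity, ?_⟩
  filter_upwards [hg.eventually (gt_mem_nhds one_pos)] with m hm j hj
  have h1 := abs_le_iSup_grid (p m)
    (fun j => g m (freq (p m) j) - specDensity P Z (freq (p m) j)) hj
  have h2 := hF (freq (p m) j)
  have h3 : |g m (freq (p m) j)| ≤ F + 1 := by
    have := abs_sub_abs_le_abs_sub (g m (freq (p m) j)) (specDensity P Z (freq (p m) j))
    linarith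
  rw [abs_mul]
  exact mul_le_mul (hB _ (freq_mem_freqDomain hj)) h3 (abs_nonneg _) hB0

omit hψ hp in
lemma tendsto_gridPoint_estimate {ω : ℝ × ℝ} {r : ℕ → ℤ × ℤ}
    (hr : ∀ᶠ m in atTop, r m ∈ grid (p m))
    (hrω : Tendsto (fun m => freq (p m) (r m)) atTop (𝓝 ω)) :
    Tendsto (fun m => g m (freq (p m) (r m))) atTop (𝓝 (specDensity P Z ω)) := by
  have hd : Tendsto (fun m => g m (freq (p m) (r m)) - specDensity P Z (freq (p m) (r m))) atTop
      (𝓝 0) := by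
    refine squeeze_zero_norm' ?_ hg
    filter_upwards [hr] with m hm
    exact abs_le_iSup_grid (p m)
      (fun j => g m (freq (p m) j) - specDensity P Z (freq (p m) j)) hm
  have := hd.add (((continuous_specDensity (P := P) (Z := Z) hγ).tendsto ω).comp hrω)
  rw [zero_add] at this
  refine this.congr fun m => ?_
  simp

/-- The bootstrap variance converges to `σ₁²` along uniformly convergent spectral estimates. -/
lemma tendsto_varQ : Tendsto (fun m => varQ ψ (g m) (p m)) atTop (𝓝 (sigma1Sq P Z ψ)) := by
  simp_rw [varQ_eq]
  obtain ⟨C, hC0, hC⟩ := eventually_abs_mul_le hψ hγ hp hg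
  refine Tendsto.const_mul _ (tendsto_riemann hp (C := C * (C + C)) ?_ ?_)
  · filter_upwards [hC] with m hm j hj
    have a1 := hm j hj
    have a2 := hm (-j) (neg_mem_grid.2 hj)
    rw [abs_mul]
    refine mul_le_mul a1 ((abs_add_le _ _).trans (add_le_add a1 a2)) (abs_nonneg _) hC0
  · filter_upwards [hψ.ae_tendsto hp] with ω h hω
    obtain ⟨h1, h2⟩ := h hω
    have hmem := eventually_gridPoint_mem hp hω
    have hfr := tendsto_freq_gridPoint hp ω
    have g1 := tendsto_gridPoint_estimate hγ hg hmem hfr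
    have g2 := tendsto_gridPoint_estimate hγ hg
      (r := fun m => -gridPoint (p m) ω) (hmem.mono fun m hm => neg_mem_grid.2 hm)
      (by simp_rw [freq_neg]; exact hfr.neg)
    rw [specDensity_neg hγ] at g2
    have := (h1.mul g1).mul ((h1.mul g1).add (h2.mul g2))
    convert this using 2
    ring

/-- The products `ψ g` stay bounded on the grid, so the weights are uniformly of order
`size^(-1/2)`; this is the negligibility needed for the central limit theorem. -/
lemma exists_bootWeight_bound : ∃ δ : ℕ → ℝ, Tendsto δ atTop (𝓝 0) ∧
    ∀ᶠ m in atTop, ∀ j ∈ halfGrid (p m), |bootWeight ψ (g m) (p m) j| ≤ δ m := by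
  obtain ⟨C, hC0, hC⟩ := eventually_abs_mul_le hψ hγ hp hg
  refine ⟨fun m => (2 * Real.pi) ^ 2 * (2 * C) * (√(size (p m)))⁻¹, ?_, ?_⟩
  · have := (tendsto_inv_atTop_zero.comp (Real.tendsto_sqrt_atTop.comp (tendsto_size hp))).const_mul
      ((2 * Real.pi) ^ 2 * (2 * C))
    simpa using this
  · filter_upwards [hC, eventually_pos hp] with m hm hpos j hj
    have hj' := (mem_halfGrid.1 hj).1
    have hs := size_pos hpos
    have a1 := hm j hj'
    have a2 := hm (-j) (neg_mem_grid.2 hj')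
    have e : √(size (p m)) * ((2 * Real.pi) ^ 2 * (size (p m))⁻¹) =
        (2 * Real.pi) ^ 2 * (√(size (p m)))⁻¹ := by
      have h1 : √(size (p m)) ≠ 0 := (Real.sqrt_pos.2 hs).ne'
      have h2 := Real.sq_sqrt hs.le
      field_simp
      exact h2
    rw [bootWeight, e, abs_mul, abs_of_nonneg (by positivity)]
    calc _ ≤ (2 * Real.pi) ^ 2 * (√(size (p m)))⁻¹ * (C + C) := by
          gcongr
          exact (abs_add_le _ _).trans (add_le_add a1 a2)
      _ = _ := by ring

/-- The hybrid bootstrap law converges weakly to `N(0, σ²)`, uniformly in the distribution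
function. -/
lemma eventually_hStar_cdf {s : ℝ} (hs : 0 < s) (h1 : 0 < sigma1Sq P Z ψ)
    (hv : Tendsto (fun m => varQ ψ (g m) (p m) + v m) atTop (𝓝 s)) {ε : ℝ} (hε : 0 < ε) :
    ∀ᶠ m in atTop, ∀ t, |bootLaw.real {u | hStar ψ (g m) (v m) (p m) u ≤ t} -
      cdf (gaussianReal 0 s.toNNReal) t| ≤ ε := by
  have hQ := tendsto_varQ hψ hγ hp hg
  set c : ℕ → ℝ := fun m => √(varQ ψ (g m) (p m) + v m) / √(varQ ψ (g m) (p m)) with hc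
  -- Positivity of `σ₁²` keeps the rescaling factor bounded, so the rescaled weights remain
  -- negligible.
  have hclim : Tendsto c atTop (𝓝 (√s / √(sigma1Sq P Z ψ))) :=
    ((Real.continuous_sqrt.tendsto _).comp hv).div ((Real.continuous_sqrt.tendsto _).comp hQ)
      (Real.sqrt_pos.2 h1).ne'
  obtain ⟨δ, hδ, hw⟩ := exists_bootWeight_bound hψ hγ hp hg
  have hlaw : ∀ m, IsProbabilityMeasure (bootLaw.map (hStar ψ (g m) (v m) (p m))) := fun m => by
    rw [hStar_eq]
    exact Measure.isProbabilityMeasure_map (measurable_bootSum _ _).aemeasurable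
  have hweak : Tendsto (β := ProbabilityMeasure ℝ)
      (fun m => ⟨bootLaw.map (hStar ψ (g m) (v m) (p m)), hlaw m⟩) atTop
      (𝓝 ⟨gaussianReal 0 s.toNNReal, inferInstance⟩) := by
    refine ProbabilityMeasure.tendsto_of_tendsto_charFun fun t => ?_
    have := tendsto_charFun_bootSum (s := fun m => halfGrid (p m))
      (a := fun m j => c m * bootWeight ψ (g m) (p m) j) (v := s.toNNReal)
      (δ := fun m => |c m| * δ m) ?_ ?_ ?_ t
    · simpa only [ProbabilityMeasure.coe_mk, hStar_eq] using this
    · rw [Real.coe_toNNReal _ hs.le]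
      refine hv.congr' ?_
      filter_upwards [hQ.eventually (lt_mem_nhds h1), hv.eventually (lt_mem_nhds hs)] with m a b
      exact (sum_sq_hStar a b.le).symm
    · simpa using hclim.abs.mul hδ
    · filter_upwards [hw] with m hm j hj
      rw [abs_mul]
      exact mul_le_mul_of_nonneg_left (hm j hj) (abs_nonneg _)
  have hv0 : s.toNNReal ≠ 0 := by simpa using hs
  filter_upwards [eventually_abs_cdf_sub_le hv0 hweak hε] with m hm t
  have := hm t
  rw [ProbabilityMeasure.coe_mk, cdf_eq_real, map_measureReal_apply (by
    rw [hStar_eq]; exact measurable_bootSum _ _) measurableSet_Iic] at this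
  exact this

end Deterministic

/-! ### From sequences of realizations to convergence in probability. -/

section InProbability

variable {Ω : Type*} [MeasurableSpace Ω] {P : Measure Ω}

/-- If `Q` holds eventually along every sequence of realizations for which `S` and `V` converge to
`s` and `v`, and `S` and `V` converge in probability, then `Q` holds with probability tending
to one. -/
lemma tendsto_measure_not_of_seq {S V : ℕ → Ω → ℝ} {s v : ℝ}
    (hS : TendstoInMeasure P S atTop fun _ => s) (hV : TendstoInMeasure P V atTop fun _ => v)
    {Q : ℕ → Ω → Prop}
    (hQ : ∀ (m : ℕ → ℕ) (x : ℕ → Ω), Tendsto m atTop atTop →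
      Tendsto (fun k => S (m k) (x k)) atTop (𝓝 s) →
      Tendsto (fun k => V (m k) (x k)) atTop (𝓝 v) → ∀ᶠ k in atTop, Q (m k) (x k)) :
    Tendsto (fun m => P {x | ¬ Q m x}) atTop (𝓝 0) := by
  -- If no such `δ` and `M` existed, tolerances `1/(k+1)` would yield indices and realizations along
  -- which the estimates converge and `Q` always fails. The realization changes with `k`, so no
  -- almost sure convergence is involved.
  obtain ⟨δ, hδ, M, hM⟩ : ∃ δ > 0, ∃ M, ∀ m ≥ M, ∀ x, dist (S m x) s < δ → dist (V m x) v < δ →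
      Q m x := by
    by_contra! hcon
    choose m hm x h1 h2 h3 using fun k : ℕ => hcon (1 / ((k : ℝ) + 1)) (by positivity) k
    have hlim := tendsto_one_div_add_atTop_nhds_zero_nat (𝕜 := ℝ)
    have := hQ m x (tendsto_atTop_mono hm tendsto_id)
      (tendsto_iff_dist_tendsto_zero.2 (squeeze_zero (fun _ => dist_nonneg)
        (fun k => (h1 k).le) hlim))
      (tendsto_iff_dist_tendsto_zero.2 (squeeze_zero (fun _ => dist_nonneg)
        (fun k => (h2 k).le) hlim))
    obtain ⟨k, hk⟩ := this.exists
    exact h3 k hk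
  have hsum := (tendstoInMeasure_iff_dist.1 hS δ hδ).add (tendstoInMeasure_iff_dist.1 hV δ hδ)
  rw [add_zero] at hsum
  refine tendsto_of_tendsto_of_tendsto_of_le_of_le' tendsto_const_nhds hsum
    (.of_forall fun _ => zero_le) ?_
  filter_upwards [eventually_ge_atTop M] with m hm
  refine (measure_mono fun x hx => ?_).trans (measure_union_le _ _)
  by_contra hcon
  simp only [Set.mem_union, Set.mem_ofPred_eq, not_or, not_le] at hcon
  exact hx (hM m hm x hcon.1 hcon.2)

lemma tendstoInMeasure_of_seq {S V : ℕ → Ω → ℝ} {s v : ℝ}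
    (hS : TendstoInMeasure P S atTop fun _ => s) (hV : TendstoInMeasure P V atTop fun _ => v)
    {Y : ℕ → Ω → ℝ} {c : ℝ}
    (hY : ∀ (m : ℕ → ℕ) (x : ℕ → Ω), Tendsto m atTop atTop →
      Tendsto (fun k => S (m k) (x k)) atTop (𝓝 s) →
      Tendsto (fun k => V (m k) (x k)) atTop (𝓝 v) →
      Tendsto (fun k => Y (m k) (x k)) atTop (𝓝 c)) :
    TendstoInMeasure P Y atTop fun _ => c := by
  rw [tendstoInMeasure_iff_dist]
  intro ε hε
  have := tendsto_measure_not_of_seq hS hV (Q := fun m x => dist (Y m x) c < ε)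
    fun m x h1 h2 h3 => Metric.tendsto_nhds.1 (hY m x h1 h2 h3) ε hε
  simpa only [not_lt] using this

end InProbability

/-! ### The second variance component and the law of the original statistic. -/

section Assembly

variable {Ω : Type*} [MeasurableSpace Ω] {P : Measure Ω} [IsProbabilityMeasure P]
  {Z : ℤ × ℤ → Ω → ℝ} {ψ : ℝ × ℝ → ℝ} {n b : ℕ → ℕ × ℕ}

/-- Consistency of the subsampling estimator of the second variance component. -/
lemma tendstoInMeasure_subVar2 (hψ : IsBV ψ) (hZ : FourthOrderStationary P Z)
    (hγ : Summable (autocov P Z)) (hκ : Summable (lagCum4 P Z))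
    (hn : Tendsto n atTop atTop) (hb : Tendsto b atTop atTop)
    (h₁ : Tendsto (fun m => ((b m).1 : ℝ) / (n m).1) atTop (𝓝 0))
    (h₂ : Tendsto (fun m => ((b m).2 : ℝ) / (n m).2) atTop (𝓝 0))
    (hL : LimitLaws P Z ψ b) :
    TendstoInMeasure P (fun m => subVar2 Z ψ (n m) (b m)) atTop fun _ => sigma2Sq P Z ψ :=
  tendstoInMeasure_of_seq (tendstoInMeasure_subVar hψ hZ hγ hκ hn hb h₁ h₂ hL)
    (tendstoInMeasure_subVar1 hZ hγ hκ hn hb h₁ h₂ hL hψ) fun m x _ h1 h2 => by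
      have := h1.sub h2
      rwa [show sigmaSq P Z ψ - sigma1Sq P Z ψ = sigma2Sq P Z ψ by rw [sigmaSq]; ring] at this

/-- The distribution functions of `H` converge uniformly to that of `N(0, σ²)`. -/
lemma LimitLaws.eventually_hStat_cdf (hL : LimitLaws P Z ψ n) (hσ : 0 < sigmaSq P Z ψ) {ε : ℝ}
    (hε : 0 < ε) : ∀ᶠ m in atTop, ∀ t, |P.real {y | hStat Z P ψ 0 (n m) y ≤ t} -
      cdf (gaussianReal 0 (sigmaSq P Z ψ).toNNReal) t| ≤ ε := by
  have hprob : ∀ m, IsProbabilityMeasure (P.map fun x => hStat Z P ψ 0 (n m) x) := fun m =>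
    Measure.isProbabilityMeasure_map (hL.clt.forall_aemeasurable m)
  have hweak : Tendsto (β := ProbabilityMeasure ℝ)
      (fun m => ⟨P.map fun x => hStat Z P ψ 0 (n m) x, hprob m⟩) atTop
      (𝓝 ⟨gaussianReal 0 (sigmaSq P Z ψ).toNNReal, inferInstance⟩) := by
    have h := hL.clt.tendsto
    simp only [Measure.map_id] at h
    exact h
  have hv0 : (sigmaSq P Z ψ).toNNReal ≠ 0 := by simpa using hσ
  filter_upwards [eventually_abs_cdf_sub_le hv0 hweak hε] with m hm t
  have := hm t
  rw [ProbabilityMeasure.coe_mk, cdf_eq_real, measureReal_def,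
    Measure.map_apply_of_aemeasurable (hL.clt.forall_aemeasurable m) measurableSet_Iic] at this
  exact this

end Assembly

end HFDB
end

/-! ### The main theorem. -/

theorem theorem2 {Ω : Type*} [MeasurableSpace Ω] (P : Measure Ω) [IsProbabilityMeasure P]
    (Z : ℤ × ℤ → Ω → ℝ) (ψ : ℝ × ℝ → ℝ) (hψ : HFDB.IsBV ψ)
    (hZ : HFDB.FourthOrderStationary P Z)
    (hγ : Summable (HFDB.autocov P Z)) (hκ : Summable (HFDB.lagCum4 P Z))
    -- sample sizes `n` and block sizes `b`, both growing in each direction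
    (n b : ℕ → ℕ × ℕ) (hn : Tendsto n atTop atTop) (hb : Tendsto b atTop atTop)
    (hbn₁ : Tendsto (fun m => ((b m).1 : ℝ) / (n m).1) atTop (𝓝 0))
    (hbn₂ : Tendsto (fun m => ((b m).2 : ℝ) / (n m).2) atTop (𝓝 0))
    (hLn : HFDB.LimitLaws P Z ψ n) (hLb : HFDB.LimitLaws P Z ψ b)
    -- the spectral density estimators, uniformly consistent over the Fourier frequencies
    (fhat : ℕ → Ω → ℝ × ℝ → ℝ)
    (hf : TendstoInMeasure P
      (fun m x => ⨆ j : HFDB.grid (n m),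
        |fhat m x (HFDB.freq (n m) j) - HFDB.specDensity P Z (HFDB.freq (n m) j)|)
      atTop (fun _ => (0 : ℝ))) :
    TendstoInMeasure P
      (fun m x => HFDB.varQ ψ (fhat m x) (n m) + HFDB.subVar2 Z ψ (n m) (b m) x)
      atTop (fun _ => HFDB.sigmaSq P Z ψ) ∧
    (0 < HFDB.sigma1Sq P Z ψ → 0 < HFDB.sigmaSq P Z ψ →
      Tendsto (fun m => P {x | ¬ (
          Var[HFDB.hStar ψ (fhat m x) (HFDB.subVar2 Z ψ (n m) (b m) x) (n m); HFDB.bootLaw] =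
          HFDB.varQ ψ (fhat m x) (n m) + HFDB.subVar2 Z ψ (n m) (b m) x)}) atTop (𝓝 0) ∧
      TendstoInMeasure P
        (fun m x =>
          Var[HFDB.hStar ψ (fhat m x) (HFDB.subVar2 Z ψ (n m) (b m) x) (n m); HFDB.bootLaw])
        atTop (fun _ => HFDB.sigmaSq P Z ψ) ∧
      TendstoInMeasure P
        (fun m x => ⨆ t : ℝ,
          |HFDB.bootLaw.real
              {u | HFDB.hStar ψ (fhat m x) (HFDB.subVar2 Z ψ (n m) (b m) x) (n m) u ≤ t} -
            P.real {y | HFDB.hStat Z P ψ 0 (n m) y ≤ t}|)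
        atTop (fun _ => (0 : ℝ))) := by
  have hV := HFDB.tendstoInMeasure_subVar2 hψ hZ hγ hκ hn hb hbn₁ hbn₂ hLb
  have hA : ∀ (m : ℕ → ℕ) (x : ℕ → Ω), Tendsto m atTop atTop →
      Tendsto (fun k => ⨆ j : HFDB.grid (n (m k)), |fhat (m k) (x k) (HFDB.freq (n (m k)) j) -
        HFDB.specDensity P Z (HFDB.freq (n (m k)) j)|) atTop (𝓝 0) →
      Tendsto (fun k => HFDB.subVar2 Z ψ (n (m k)) (b (m k)) (x k)) atTop
        (𝓝 (HFDB.sigma2Sq P Z ψ)) →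
      Tendsto (fun k => HFDB.varQ ψ (fhat (m k) (x k)) (n (m k)) +
        HFDB.subVar2 Z ψ (n (m k)) (b (m k)) (x k)) atTop (𝓝 (HFDB.sigmaSq P Z ψ)) :=
    fun m x hm h1 h2 => (HFDB.tendsto_varQ hψ hγ (hn.comp hm) h1).add h2
  refine ⟨HFDB.tendstoInMeasure_of_seq hf hV hA, fun hσ1 hσ => ?_⟩
  -- Positivity of both limits eventually makes the bootstrap variance and the corrected variance
  -- positive, which is what the exact variance formula needs.
  have hB : ∀ (m : ℕ → ℕ) (x : ℕ → Ω), Tendsto m atTop atTop →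
      Tendsto (fun k => ⨆ j : HFDB.grid (n (m k)), |fhat (m k) (x k) (HFDB.freq (n (m k)) j) -
        HFDB.specDensity P Z (HFDB.freq (n (m k)) j)|) atTop (𝓝 0) →
      Tendsto (fun k => HFDB.subVar2 Z ψ (n (m k)) (b (m k)) (x k)) atTop
        (𝓝 (HFDB.sigma2Sq P Z ψ)) →
      ∀ᶠ k in atTop, Var[HFDB.hStar ψ (fhat (m k) (x k))
          (HFDB.subVar2 Z ψ (n (m k)) (b (m k)) (x k)) (n (m k)); HFDB.bootLaw] =
        HFDB.varQ ψ (fhat (m k) (x k)) (n (m k)) +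
          HFDB.subVar2 Z ψ (n (m k)) (b (m k)) (x k) := by
    intro m x hm h1 h2
    filter_upwards [(HFDB.tendsto_varQ hψ hγ (hn.comp hm) h1).eventually (lt_mem_nhds hσ1),
      (hA m x hm h1 h2).eventually (lt_mem_nhds hσ)] with k a1 a2
    exact HFDB.variance_hStar a1 a2.le
  refine ⟨HFDB.tendsto_measure_not_of_seq hf hV hB,
    HFDB.tendstoInMeasure_of_seq hf hV fun m x hm h1 h2 =>
      (hA m x hm h1 h2).congr' ((hB m x hm h1 h2).mono fun k hk => hk.symm),
    HFDB.tendstoInMeasure_of_seq hf hV fun m x hm h1 h2 => ?_⟩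
  rw [tendsto_order]
  refine ⟨fun a ha => .of_forall fun k => ha.trans_le (Real.iSup_nonneg fun _ => abs_nonneg _),
    fun ε hε => ?_⟩
  have hε3 : 0 < ε / 3 := by positivity
  -- Both distribution functions are compared with the common Gaussian limit; errors of `ε/3` each
  -- leave room for a strict inequality after taking the supremum.
  filter_upwards [HFDB.eventually_hStar_cdf hψ hγ (hn.comp hm) h1 hσ hσ1 (hA m x hm h1 h2) hε3,
    hm.eventually (hLn.eventually_hStat_cdf hσ hε3)] with k a1 a2
  refine (Real.iSup_le (fun t => ?_) (by positivity)).trans_lt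
    (show ε / 3 + ε / 3 < ε by linarith)
  refine (abs_sub_le _ (cdf (gaussianReal 0 (HFDB.sigmaSq P Z ψ).toNNReal) t) _).trans
    (add_le_add (a1 t) ?_)
  rw [abs_sub_comm]
  exact a2 t
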